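/- **Graded Antipode Lemma.** Let $\{x_1,\dots,x_N\}$ be a basis of the free group $F_N$, let $2\le k<N$, and let $A=\langle x_1,\dots,x_k\rangle$. Let $u\in F_N$ be primitive (that is, an element of some basis of $F_N$). Consider the conditions 1. $u\in A$; 2. there is an automorphism $\phi$ of $F_N$ with $\phi(A)=A$ and $\phi(u)=x_{k+1}$; 3. there is a primitive element $p$ of $F_N$ with $p\in A$ such that $\langle p,u\rangle$ is not contained in any free factor of $F_N$ of rank $2$. (A free factor of $F_N$ is a subgroup $H$ such that $F_N=H*K$ for some subgroup $K$.) Then at least one of (1), (2), (3) holds, and (2) is incompatible with (1) and with (3). Thus if $u\notin A$, then exactly one of (2) and (3) holds. If $k=2$, then (1) and (3) are also incompatible, so exactly one of (1), (2), (3) holds. -/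

import Mathlib

namespace GradedAntipode

universe u

/-- An element of a free group is primitive if it belongs to some basis. -/
def IsPrimitive {G : Type u} [Group G] (g : G) : Prop :=
  ∃ (ι : Type u) (b : FreeGroupBasis ι G) (i : ι), b i = g

/-- `H` is a free factor of `G`: there is a subgroup `K` such that `G` is the internal free
product `H * K`, that is, the natural map from the free product of `H` and `K` to `G` is
bijective. -/
def IsFreeFactor {G : Type u} [Group G] (H : Subgroup G) : Prop :=
  ∃ K : Subgroup G, Function.Bijective (Monoid.Coprod.lift H.subtype K.subtype)

/-- `H` is a free factor of `G` which is itself a free group of rank `r`. -/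
def IsFreeFactorOfRank {G : Type u} [Group G] (r : ℕ) (H : Subgroup G) : Prop :=
  IsFreeFactor H ∧ Nonempty (FreeGroupBasis (Fin r) H)

/-- Some automorphism `φ` with `φ(A) = A` sends `g` to `x`. -/
def ExistsAutPreserving {G : Type u} [Group G] (A : Subgroup G) (g x : G) : Prop :=
  ∃ φ : G ≃* G, A.map φ.toMonoidHom = A ∧ φ g = x

/-- Some primitive `p ∈ A` is such that `⟨p, g⟩` is contained in no rank two free factor. -/
def ExistsFarPrimitive {G : Type u} [Group G] (A : Subgroup G) (g : G) : Prop :=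
  ∃ p : G, IsPrimitive p ∧ p ∈ A ∧
    ¬ ∃ H : Subgroup G, IsFreeFactorOfRank 2 H ∧ Subgroup.closure {p, g} ≤ H

end GradedAntipode

namespace GradedAntipode

section Words

variable {γ : Type*}

theorem mk_inj_of_isReduced {L L' : List (γ × Bool)} (h : FreeGroup.IsReduced L) (h' : FreeGroup.IsReduced L')
    (e : FreeGroup.mk L = FreeGroup.mk L') : L = L' := by
  classical
  rw [← h.reduce_eq, ← h'.reduce_eq]
  exact FreeGroup.reduce.sound e

theorem exists_isReduced (h : FreeGroup γ) : ∃ L, FreeGroup.IsReduced L ∧ FreeGroup.mk L = h := by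
  classical
  exact ⟨h.toWord, FreeGroup.isReduced_toWord, FreeGroup.mk_toWord⟩

theorem isReduced_append_iff {L M : List (γ × Bool)} :
    FreeGroup.IsReduced (L ++ M) ↔ FreeGroup.IsReduced L ∧ FreeGroup.IsReduced M ∧
      ∀ x ∈ L.getLast?, ∀ y ∈ M.head?, x.1 = y.1 → x.2 = y.2 :=
  List.isChain_append

theorem isReduced_map_of_injective {δ : Type*} {f : γ → δ} (hf : Function.Injective f)
    {L : List (γ × Bool)} (h : FreeGroup.IsReduced L) : FreeGroup.IsReduced (L.map fun x => (f x.1, x.2)) := by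
  unfold FreeGroup.IsReduced at *
  rw [List.isChain_map]
  exact h.imp fun a b hab e => hab (hf e)

end Words

variable {α β : Type*}

/-- The letter `e⁻¹`. -/
def flip (e : β × Bool) : β × Bool := (e.1, !e.2)

@[simp] theorem flip_flip (e : β × Bool) : flip (flip e) = e := by simp [flip]

theorem flip_ne (e : β × Bool) : flip e ≠ e := by
  rcases e with ⟨y, b⟩; cases b <;> simp [flip]

/-- The letter `e` of the second factor, as an element of the free group. -/
def lt (α : Type*) (e : β × Bool) : FreeGroup (α ⊕ β) := FreeGroup.mk [(Sum.inr e.1, e.2)]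

/-- The inclusion of the first factor. -/
def inA (α β : Type*) : FreeGroup α →* FreeGroup (α ⊕ β) := FreeGroup.map Sum.inl

theorem inA_injective : Function.Injective (inA α β) := FreeGroup.map_injective Sum.inl_injective

theorem lt_flip (e : β × Bool) : lt α (flip e) = (lt α e)⁻¹ := by
  simp [lt, flip, FreeGroup.invRev]

/-- The elements whose reduced word starts with the letter `e` of the second factor. -/
def branch (α : Type*) (e : β × Bool) : Set (FreeGroup (α ⊕ β)) :=
  {h | ∃ t, FreeGroup.IsReduced ((Sum.inr e.1, e.2) :: t) ∧ FreeGroup.mk ((Sum.inr e.1, e.2) :: t) = h}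

theorem mul_mem_branch_of_notMem {e : β × Bool} {h : FreeGroup (α ⊕ β)}
    (hh : h ∉ branch α (flip e)) : lt α e * h ∈ branch α e := by
  obtain ⟨L, hL, rfl⟩ := exists_isReduced h
  refine ⟨L, ?_, by simp [lt]⟩
  cases L with
  | nil => exact FreeGroup.IsReduced.singleton
  | cons x t =>
    rw [FreeGroup.isReduced_cons_cons]
    refine ⟨fun h1 => ?_, hL⟩
    by_contra h2
    refine hh ⟨t, ?_, ?_⟩
    all_goals
      have : x = (Sum.inr (flip e).1, (flip e).2) := by
        rcases x with ⟨x1, x2⟩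
        simp only at h1 h2
        subst h1
        simp only [flip, Prod.mk.injEq, true_and]
        cases x2 <;> cases h : e.2 <;> simp_all
      rw [← this]
    exact hL

theorem notMem_branch_of_mem {e : β × Bool} {h : FreeGroup (α ⊕ β)}
    (hh : h ∈ branch α e) : (lt α e)⁻¹ * h ∉ branch α (flip e) := by
  obtain ⟨t, ht, rfl⟩ := hh
  rintro ⟨t', ht', h'⟩
  have : FreeGroup.mk ((Sum.inr e.1, e.2) :: t) = lt α e * FreeGroup.mk t := by simp [lt]
  rw [this, inv_mul_cancel_left] at h'
  have := mk_inj_of_isReduced ht' (List.IsChain.tail ht) h'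
  rw [List.tail_cons] at this
  rw [← this, FreeGroup.isReduced_cons_cons] at ht
  have := ht.1 rfl
  simp [flip] at this

theorem lt_mul_mem_branch {e : β × Bool} {h : FreeGroup (α ⊕ β)} :
    lt α e * h ∈ branch α e ↔ h ∉ branch α (flip e) := by
  refine ⟨fun hh => ?_, mul_mem_branch_of_notMem⟩
  simpa using notMem_branch_of_mem hh

theorem one_notMem_branch (e : β × Bool) : (1 : FreeGroup (α ⊕ β)) ∉ branch α e := by
  rintro ⟨t, ht, h⟩
  have := mk_inj_of_isReduced ht FreeGroup.IsReduced.nil (h.trans FreeGroup.one_eq_mk)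
  simp at this

theorem lt_mem_branch (e : β × Bool) : lt α e ∈ branch α e := by
  rw [← mul_one (lt α e), lt_mul_mem_branch]
  exact one_notMem_branch _

theorem mul_letter_mem_branch {e : β × Bool} {h : FreeGroup (α ⊕ β)} (hh : h ∈ branch α e)
    (x : (α ⊕ β) × Bool) (hx : h * FreeGroup.mk [x] ≠ 1) :
    h * FreeGroup.mk [x] ∈ branch α e := by
  obtain ⟨t, ht, rfl⟩ := hh
  by_cases hr : FreeGroup.IsReduced (((Sum.inr e.1, e.2) :: t) ++ [x])
  · exact ⟨t ++ [x], hr, by simp⟩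
  · rcases List.eq_nil_or_concat' ((Sum.inr e.1, e.2) :: t) with h0 | ⟨t', y, h0⟩
    · simp at h0
    · have hxy : y = (x.1, !x.2) := by
        by_contra hne
        apply hr
        rw [isReduced_append_iff]
        refine ⟨ht, FreeGroup.IsReduced.singleton, ?_⟩
        intro a ha b hb h1
        simp only [h0, List.getLast?_append, List.getLast?_singleton, Option.mem_def,
          Option.some_or, Option.some.injEq, List.head?_cons] at ha hb
        subst ha hb
        by_contra h2
        apply hne
        ext
        · exact h1
        · cases hy : y.2 <;> cases hxx : x.2 <;> simp_all
      have hm : FreeGroup.mk ((Sum.inr e.1, e.2) :: t) * FreeGroup.mk [x] = FreeGroup.mk t' := by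
        rw [h0, hxy, ← FreeGroup.mul_mk, mul_assoc]
        have : (FreeGroup.mk [(x.1, !x.2)] : FreeGroup (α ⊕ β)) = (FreeGroup.mk [x])⁻¹ := by
          simp [FreeGroup.invRev]
        rw [this, inv_mul_cancel, mul_one]
      rw [hm] at hx ⊢
      cases t' with
      | nil => exact absurd FreeGroup.one_eq_mk.symm hx
      | cons z t'' =>
        simp only [List.cons_append, List.cons.injEq] at h0
        refine ⟨t'', ?_, by rw [h0.1]⟩
        have := ht
        rw [h0.1, h0.2, ← List.cons_append] at this
        rw [h0.1]
        exact (isReduced_append_iff.1 this).1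

theorem isReduced_inA_append {a : List (α × Bool)} (ha : FreeGroup.IsReduced a)
    {e : β × Bool} {t : List ((α ⊕ β) × Bool)} (ht : FreeGroup.IsReduced ((Sum.inr e.1, e.2) :: t)) :
    FreeGroup.IsReduced ((a.map fun x => ((Sum.inl x.1 : α ⊕ β), x.2)) ++ (Sum.inr e.1, e.2) :: t) := by
  rw [isReduced_append_iff]
  refine ⟨isReduced_map_of_injective Sum.inl_injective ha, ht, ?_⟩
  intro x hx y hy h
  simp only [List.head?_cons, Option.mem_def, Option.some.injEq] at hy
  subst hy
  have := List.mem_of_getLast? hx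
  simp only [List.mem_map] at this
  obtain ⟨z, -, rfl⟩ := this
  simp at h

theorem eq_of_mul_mem_branch {e e' : β × Bool} {a : FreeGroup α} {h : FreeGroup (α ⊕ β)}
    (hh : h ∈ branch α e) (ha : inA α β a * h ∈ branch α e') : a = 1 ∧ e = e' := by
  obtain ⟨L, hL, rfl⟩ := exists_isReduced a
  obtain ⟨t, ht, rfl⟩ := hh
  obtain ⟨t', ht', h'⟩ := ha
  rw [inA, FreeGroup.map.mk, FreeGroup.mul_mk] at h'
  have := mk_inj_of_isReduced ht' (isReduced_inA_append hL ht) h'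
  cases L with
  | nil =>
    simp only [List.map_nil, List.nil_append, List.cons.injEq, Prod.mk.injEq, Sum.inr.injEq] at this
    exact ⟨FreeGroup.one_eq_mk.symm, Prod.ext this.1.1.symm this.1.2.symm⟩
  | cons x L => simp at this

theorem inA_notMem_branch (e : β × Bool) (a : FreeGroup α) : inA α β a ∉ branch α e := by
  obtain ⟨L, hL, rfl⟩ := exists_isReduced a
  rintro ⟨t, ht, h⟩
  have := mk_inj_of_isReduced ht (isReduced_map_of_injective Sum.inl_injective hL)
    (h.trans FreeGroup.map.mk)
  cases L <;> simp at this

theorem mul_inA_mem_branch {e : β × Bool} {h : FreeGroup (α ⊕ β)} (a : FreeGroup α) :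
    h * inA α β a ∈ branch α e ↔ h ∈ branch α e := by
  have key : ∀ (L : List (α × Bool)) (h : FreeGroup (α ⊕ β)), h ∈ branch α e →
      h * inA α β (FreeGroup.mk L) ∈ branch α e := by
    intro L
    induction L with
    | nil => intro h hh; rw [← FreeGroup.one_eq_mk]; simpa using hh
    | cons x L ih =>
      intro h hh
      have h1 : inA α β (FreeGroup.mk (x :: L)) =
          FreeGroup.mk [(Sum.inl x.1, x.2)] * inA α β (FreeGroup.mk L) := by
        simp [inA]
      rw [h1, ← mul_assoc]
      apply ih
      apply mul_letter_mem_branch hh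
      intro h2
      have h3 : h = inA α β (FreeGroup.mk [x])⁻¹ := by
        rw [map_inv, eq_inv_iff_mul_eq_one, ← h2]
        simp [inA]
      exact inA_notMem_branch e _ (h3 ▸ hh)
  obtain ⟨L, rfl⟩ : ∃ L, FreeGroup.mk L = a := ⟨_, (exists_isReduced a).choose_spec.2⟩
  refine ⟨fun hh => ?_, key L h⟩
  have := key (FreeGroup.invRev L) _ hh
  rwa [← FreeGroup.inv_mk, map_inv, mul_inv_cancel_right] at this

theorem exists_inA_or_branch (h : FreeGroup (α ⊕ β)) :
    (∃ a, h = inA α β a) ∨ ∃ a e, (inA α β a)⁻¹ * h ∈ branch α e := by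
  obtain ⟨L, hL, rfl⟩ := exists_isReduced h
  induction L with
  | nil => exact Or.inl ⟨1, by rw [← FreeGroup.one_eq_mk, map_one]⟩
  | cons x L ih =>
    rcases x with ⟨i | y, b⟩
    · have h1 : (FreeGroup.mk ((Sum.inl i, b) :: L) : FreeGroup (α ⊕ β)) =
        inA α β (FreeGroup.mk [(i, b)]) * FreeGroup.mk L := by simp [inA]
      rcases ih (List.IsChain.tail hL) with ⟨a, ha⟩ | ⟨a, e, ha⟩
      · exact Or.inl ⟨FreeGroup.mk [(i, b)] * a, by rw [h1, ha, map_mul]⟩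
      · exact Or.inr ⟨FreeGroup.mk [(i, b)] * a, e, by
          rw [h1, map_mul]; simpa [mul_assoc] using ha⟩
    · exact Or.inr ⟨1, (y, b), L, hL, by simp⟩

end GradedAntipode

namespace GradedAntipode

section FiniteCoboundary

variable {G : Type*} [Group G] {X : Type*}

/-- A function on a group has finite coboundary if each right translation changes only finitely
many of its values. -/
def FinCob (c : G → X) : Prop := ∀ s : G, {h | c (h * s) ≠ c h}.Finite

theorem FinCob.left {c : G → X} (hc : FinCob c) (g : G) : FinCob fun h => c (g * h) := by
  intro s
  have := (hc s).preimage ((mul_right_injective g).injOn)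
  refine this.subset ?_
  intro h hh
  simpa [mul_assoc] using hh

theorem FinCob.comp {c : G → X} (hc : FinCob c) {H : Type*} [Group H] {f : H →* G}
    (hf : Function.Injective f) : FinCob (c ∘ f) := by
  intro s
  refine ((hc (f s)).preimage hf.injOn).subset ?_
  intro h hh
  simpa using hh

theorem FinCob.of_free {γ : Type*} {c : FreeGroup γ → X}
    (h : ∀ i, {h | c (h * FreeGroup.of i) ≠ c h}.Finite) : FinCob c := by
  intro s
  have hinv : ∀ s : FreeGroup γ, {h | c (h * s) ≠ c h}.Finite →
      {h | c (h * s⁻¹) ≠ c h}.Finite := by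
    intro s hs
    refine (hs.image (· * s)).subset ?_
    intro h hh
    exact ⟨h * s⁻¹, by simpa using Ne.symm hh, by simp⟩
  induction s using FreeGroup.induction_on with
  | C1 => simp
  | of i => exact h i
  | inv_of i hi => exact hinv _ hi
  | mul x y hx hy =>
    refine ((hy.preimage ((mul_left_injective x).injOn)).union hx).subset ?_
    intro h hh
    by_contra hcon
    simp only [Set.mem_union, Set.mem_preimage, Set.mem_ofPred_eq, not_or, not_not] at hcon
    apply hh
    rw [← mul_assoc, hcon.1, hcon.2]

end FiniteCoboundary

variable {α β : Type*} {X : Type*}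

theorem finCob_branch (e : β × Bool) : FinCob fun h : FreeGroup (α ⊕ β) => h ∈ branch α e := by
  apply FinCob.of_free
  have key : ∀ (h : FreeGroup (α ⊕ β)) (x : (α ⊕ β) × Bool),
      h ≠ 1 → h * FreeGroup.mk [x] ≠ 1 →
      (h * FreeGroup.mk [x] ∈ branch α e ↔ h ∈ branch α e) := by
    intro h x h1 hx
    refine ⟨fun hh => ?_, fun hh => mul_letter_mem_branch hh x hx⟩
    have h2 : (FreeGroup.mk [(x.1, !x.2)] : FreeGroup (α ⊕ β)) = (FreeGroup.mk [x])⁻¹ := by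
      simp [FreeGroup.invRev]
    have := mul_letter_mem_branch hh (x.1, !x.2)
      (by rw [h2, mul_inv_cancel_right]; exact h1)
    rwa [h2, mul_inv_cancel_right] at this
  intro i
  refine (Set.toFinite {1, (FreeGroup.of i)⁻¹}).subset ?_
  intro h hh
  by_contra hcon
  simp only [Set.mem_insert_iff, Set.mem_singleton_iff, not_or] at hcon
  apply hh
  refine propext (key h (i, true) hcon.1 fun h2 => hcon.2 ?_)
  exact mul_eq_one_iff_eq_inv.1 h2

/-- The elements whose reduced word has `L` as a prefix. -/
def cone (L : List ((α ⊕ β) × Bool)) : Set (FreeGroup (α ⊕ β)) :=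
  {h | ∃ t, FreeGroup.IsReduced (L ++ t) ∧ FreeGroup.mk (L ++ t) = h}

theorem exists_coboundary_of_cone {c : FreeGroup (α ⊕ β) → X} {L : List ((α ⊕ β) × Bool)}
    {h : FreeGroup (α ⊕ β)} (hh : h ∈ cone L)
    (hne : c h ≠ c (FreeGroup.mk L)) :
    ∃ t x, FreeGroup.IsReduced (L ++ t) ∧
      c (FreeGroup.mk (L ++ t) * FreeGroup.mk [x]) ≠ c (FreeGroup.mk (L ++ t)) := by
  obtain ⟨t, ht, rfl⟩ := hh
  induction t using List.reverseRecOn with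
  | nil => simp at hne
  | append_singleton t x ih =>
    rw [← List.append_assoc] at ht hne
    by_cases h1 : c (FreeGroup.mk (L ++ t)) = c (FreeGroup.mk L)
    · refine ⟨t, x, (isReduced_append_iff.1 ht).1, ?_⟩
      rw [FreeGroup.mul_mk, h1]
      exact hne
    · exact ih (isReduced_append_iff.1 ht).1 h1

/-- The part of the group seen from `g` when the branch in the direction `f` is removed. -/
def region (g : FreeGroup (α ⊕ β)) (f : Option (β × Bool)) : Set (FreeGroup (α ⊕ β)) :=
  {h | ∀ e, f = some e → g⁻¹ * h ∉ branch α e}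

theorem exists_extremal [Finite α] [Finite β] {c : FreeGroup (α ⊕ β) → X} (hc : FinCob c)
    {h₁ h₂ : FreeGroup (α ⊕ β)} (hne : c h₁ ≠ c h₂) :
    ∃ (g : FreeGroup (α ⊕ β)) (f : Option (β × Bool)),
      (∃ h ∈ region g f, ∃ h' ∈ region g f, c h ≠ c h') ∧
      (∀ a e, ¬ (a = 1 ∧ some e = f) → ∀ h ∈ branch α e, ∀ h' ∈ branch α e,
        c (g * inA α β a * h) = c (g * inA α β a * h')) ∧
      (∀ e, f = some e → g⁻¹ ∈ branch α e) ∧ (f = none → g = 1) := by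
  classical
  let good : List ((α ⊕ β) × Bool) → Prop := fun L =>
    FreeGroup.IsReduced L ∧ (L = [] ∨ ∃ L' e, L = L' ++ [(Sum.inr (Prod.fst e), Prod.snd e)]) ∧
    ∃ h ∈ cone L, ∃ h' ∈ cone L, c h ≠ c h'
  have hT : {h | ∃ x : (α ⊕ β) × Bool, c (h * FreeGroup.mk [x]) ≠ c h}.Finite := by
    have : {h | ∃ x : (α ⊕ β) × Bool, c (h * FreeGroup.mk [x]) ≠ c h} =
        ⋃ x : (α ⊕ β) × Bool, {h | c (h * FreeGroup.mk [x]) ≠ c h} := by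
      ext; simp
    rw [this]
    exact Set.finite_iUnion fun x => hc _
  obtain ⟨M, hM⟩ := (hT.image fun h => h.toWord.length).bddAbove
  have hbound : ∀ L, good L → L.length ≤ M := by
    rintro L ⟨hL, -, h, hh, h', hh', hne'⟩
    have : ∃ h ∈ cone L, c h ≠ c (FreeGroup.mk L) := by
      by_contra hcon
      push Not at hcon
      exact hne' ((hcon h hh).trans (hcon h' hh').symm)
    obtain ⟨h, hh, hne'⟩ := this
    obtain ⟨t, x, ht, hx⟩ := exists_coboundary_of_cone hh hne'
    have := hM ⟨FreeGroup.mk (L ++ t), ⟨x, hx⟩, rfl⟩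
    simp only [FreeGroup.toWord_mk, ht.reduce_eq, List.length_append] at this
    omega
  have h0 : good [] := by
    refine ⟨FreeGroup.IsReduced.nil, Or.inl rfl, h₁, ?_, h₂, ?_, hne⟩
    · exact exists_isReduced h₁
    · exact exists_isReduced h₂
  obtain ⟨L, hL, hmax⟩ : ∃ L, good L ∧ ∀ L', good L' → L'.length ≤ L.length := by
    let P : ℕ → Prop := fun n => ∃ L, good L ∧ L.length = n
    have hP : P (Nat.findGreatest P M) :=
      Nat.findGreatest_spec (P := P) (m := 0) (Nat.zero_le _) ⟨[], h0, rfl⟩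
    obtain ⟨L, hL, hlen⟩ := hP
    refine ⟨L, hL, fun L' hL' => ?_⟩
    rw [hlen]
    exact Nat.le_findGreatest (hbound L' hL') ⟨L', hL', rfl⟩
  obtain ⟨hred, hform, hnc⟩ := hL
  have hchild : ∀ (f : Option (β × Bool)) a e, ¬ (a = 1 ∧ some e = f) →
      (L = [] ∨ ∃ L' e', L = L' ++ [(Sum.inr (Prod.fst e'), Prod.snd e')] ∧ f = some (flip e')) →
      ∀ h ∈ branch α e, ∀ h' ∈ branch α e,
        c (FreeGroup.mk L * inA α β a * h) = c (FreeGroup.mk L * inA α β a * h') := by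
    intro f a e hae hf h hh h' hh'
    by_contra hcon
    obtain ⟨La, hLa, rfl⟩ := exists_isReduced a
    set m : List ((α ⊕ β) × Bool) := La.map fun x => (Sum.inl x.1, x.2) with hm
    have hsub : ∀ t, FreeGroup.IsReduced ((Sum.inr e.1, e.2) :: t) →
        FreeGroup.IsReduced (L ++ (m ++ (Sum.inr e.1, e.2) :: t)) := by
      intro t ht
      rw [isReduced_append_iff]
      refine ⟨hred, isReduced_inA_append hLa ht, ?_⟩
      intro x hx y hy hxy
      rcases hf with rfl | ⟨L', e', rfl, rfl⟩
      · simp at hx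
      · simp only [List.getLast?_append, List.getLast?_singleton, Option.some_or,
          Option.mem_def, Option.some.injEq] at hx
        subst hx
        cases hLa' : La with
        | cons z La' =>
          simp only [hm, hLa', List.map_cons, List.cons_append, List.head?_cons, Option.mem_def,
            Option.some.injEq] at hy
          subst hy
          simp at hxy
        | nil =>
          simp only [hm, hLa', List.map_nil, List.nil_append, List.head?_cons, Option.mem_def,
            Option.some.injEq] at hy
          subst hy
          simp only [Sum.inr.injEq] at hxy
          by_contra h2
          apply hae
          refine ⟨by rw [hLa', FreeGroup.one_eq_mk], ?_⟩
          rw [Option.some.injEq]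
          ext
          · exact hxy.symm
          · simp only [flip]
            cases h3 : e.2 <;> cases h4 : e'.2 <;> simp_all
    have hmem : ∀ h ∈ branch α e, FreeGroup.mk L * inA α β (FreeGroup.mk La) * h ∈
        cone (L ++ (m ++ [(Sum.inr e.1, e.2)])) := by
      rintro h ⟨t, ht, rfl⟩
      refine ⟨t, ?_, ?_⟩
      · simpa using hsub t ht
      · simp [inA, hm]
    have := hmax (L ++ (m ++ [(Sum.inr e.1, e.2)]))
      ⟨by simpa using hsub [] FreeGroup.IsReduced.singleton,
        Or.inr ⟨L ++ m, e, by simp⟩, _, hmem h hh, _, hmem h' hh', hcon⟩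
    simp at this
  rcases hform with rfl | ⟨L', e, rfl⟩
  · refine ⟨1, none, ?_, ?_, by simp, by simp⟩
    · obtain ⟨h, -, h', -, hne'⟩ := hnc
      exact ⟨h, by simp [region], h', by simp [region], hne'⟩
    · have := hchild none
      simpa [← FreeGroup.one_eq_mk] using this
  · refine ⟨FreeGroup.mk (L' ++ [(Sum.inr e.1, e.2)]), some (flip e), ?_, ?_, ?_, by simp⟩
    · obtain ⟨h, hh, h', hh', hne'⟩ := hnc
      have hreg : ∀ h ∈ cone (L' ++ [(Sum.inr e.1, e.2)]),
          h ∈ region (FreeGroup.mk (L' ++ [(Sum.inr e.1, e.2)])) (some (flip e)) := by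
        rintro h ⟨t, ht, rfl⟩ e' he'
        simp only [Option.some.injEq] at he'
        subst he'
        rw [← FreeGroup.mul_mk (L₂ := t), inv_mul_cancel_left]
        rw [List.append_assoc] at ht
        have h1 := (isReduced_append_iff.1 ht).2.1
        have h2 : FreeGroup.mk ((Sum.inr e.1, e.2) :: t) ∈ branch α e := ⟨t, h1, rfl⟩
        have h3 := notMem_branch_of_mem h2
        rwa [show FreeGroup.mk ((Sum.inr e.1, e.2) :: t) = lt α e * FreeGroup.mk t by simp [lt],
          inv_mul_cancel_left] at h3
      exact ⟨h, hreg h hh, h', hreg h' hh', hne'⟩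
    · intro a e' hae
      exact hchild (some (flip e)) a e' hae (Or.inr ⟨L', e, rfl, rfl⟩)
    · intro e' he'
      simp only [Option.some.injEq] at he'
      subst he'
      rw [← FreeGroup.mul_mk, mul_inv_rev]
      change (lt α e)⁻¹ * _ ∈ _
      rw [← lt_flip, lt_mul_mem_branch, flip_flip]
      rintro ⟨t, ht, h⟩
      rw [FreeGroup.inv_mk] at h
      have h1 : FreeGroup.mk (FreeGroup.invRev ((Sum.inr e.1, e.2) :: t)) =
          (FreeGroup.mk L' : FreeGroup (α ⊕ β)) := by
        rw [← FreeGroup.inv_mk, h, FreeGroup.inv_mk, FreeGroup.invRev_invRev]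
      have h2 : FreeGroup.IsReduced (FreeGroup.invRev ((Sum.inr e.1, e.2) :: t)) := by
        rw [FreeGroup.isReduced_iff_reduce_eq, FreeGroup.reduce_invRev, ht.reduce_eq]
      have h3 := mk_inj_of_isReduced h2 (isReduced_append_iff.1 hred).1 h1
      rw [← h3, FreeGroup.invRev_cons] at hred
      have h4 := (isReduced_append_iff.1 hred).2.2
      have := h4 (Sum.inr e.1, !e.2) (by simp [FreeGroup.invRev]) (Sum.inr e.1, e.2) (by simp) rfl
      simp at this

/-- If the function is constant at the vertex `g`, then it changes along only finitely many
of the edges at that vertex. -/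
theorem finite_changes [Finite β] {c : FreeGroup (α ⊕ β) → X} (hc : FinCob c)
    (g : FreeGroup (α ⊕ β)) :
    {p : FreeGroup α × (β × Bool) | c (g * inA α β p.1 * lt α p.2) ≠ c (g * inA α β p.1)}.Finite
    := by
  have : {p : FreeGroup α × (β × Bool) |
      c (g * inA α β p.1 * lt α p.2) ≠ c (g * inA α β p.1)} =
      ⋃ e : β × Bool, (fun a => (a, e)) '' {a | c (g * inA α β a * lt α e) ≠ c (g * inA α β a)} := by
    ext ⟨a, e⟩
    simp
  rw [this]
  refine Set.finite_iUnion fun e => Set.Finite.image _ ?_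
  refine ((hc (lt α e)).preimage (f := fun a => g * inA α β a) ?_).subset fun a ha => ha
  intro a _ b _ h
  exact inA_injective (mul_left_cancel h)

section NormalForm

variable (a : ℕ → FreeGroup α) (e : ℕ → β × Bool)

/-- The product `a₀ e₀ a₁ e₁ ⋯` of the first `n` syllables. -/
def prodSyl : ℕ → FreeGroup (α ⊕ β)
  | 0 => 1
  | n + 1 => prodSyl n * inA α β (a n) * lt α (e n)

variable {a e}

theorem inv_prodSyl_mem_branch {n : ℕ}
    (hred : ∀ j, j + 1 < n → ¬ (a (j + 1) = 1 ∧ e (j + 1) = flip (e j))) :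
    ∀ j, j < n → (prodSyl a e (j + 1))⁻¹ ∈ branch α (flip (e j)) := by
  intro j
  induction j with
  | zero =>
    intro _
    simp only [prodSyl, one_mul, mul_inv_rev, ← lt_flip, ← map_inv]
    rw [lt_mul_mem_branch]
    exact inA_notMem_branch _ _
  | succ j ih =>
    intro hj
    rw [prodSyl, mul_inv_rev, mul_inv_rev, ← lt_flip, lt_mul_mem_branch, flip_flip]
    intro h
    rw [← map_inv] at h
    have := eq_of_mul_mem_branch (ih (by omega)) h
    exact hred j hj ⟨by simpa using this.1, this.2.symm⟩

theorem prodSyl_suffix_mem_branch {n : ℕ}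
    (hred : ∀ j, j + 1 < n → ¬ (a (j + 1) = 1 ∧ e (j + 1) = flip (e j))) :
    ∀ m i, i + m < n →
      (inA α β (a i))⁻¹ * ((prodSyl a e i)⁻¹ * prodSyl a e (i + m + 1)) ∈ branch α (e i) := by
  intro m
  induction m with
  | zero =>
    intro i _
    simp only [prodSyl]
    simpa [mul_assoc] using lt_mem_branch (α := α) (e i)
  | succ m ih =>
    intro i hi
    have h1 := ih (i + 1) (by omega)
    rw [show i + 1 + m + 1 = i + (m + 1) + 1 by ring] at h1
    set Q := prodSyl a e (i + (m + 1) + 1)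
    have h2 : (inA α β (a i))⁻¹ * ((prodSyl a e i)⁻¹ * Q) =
        lt α (e i) * ((prodSyl a e (i + 1))⁻¹ * Q) := by
      simp only [prodSyl]; group
    rw [h2, lt_mul_mem_branch]
    intro h3
    have h4 := eq_of_mul_mem_branch (a := a (i + 1)) h1 (by simpa using h3)
    exact hred i (by omega) h4

end NormalForm

end GradedAntipode

namespace GradedAntipode

theorem zpow_injective_of_ne_one {γ : Type*} {x : FreeGroup γ} (hx : x ≠ 1) :
    Function.Injective fun n : ℤ => x ^ n :=
  injective_zpow_iff_not_isOfFinOrder.2 (not_isOfFinOrder_of_isMulTorsionFree hx)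

theorem not_mem_of_line {Ω : Type*} {K : Set Ω} (hK : K.Finite) {z : ℤ → Ω}
    (hz : Function.Injective z) {f : Ω}
    (hstep : ∀ i, z i ≠ f → z (i + 1) ≠ f → (z i ∈ K ↔ z (i + 1) ∈ K)) (hf : f ∉ K) (k : ℤ) :
    z k ∉ K := by
  intro hk
  by_cases h : ∃ i, k ≤ i ∧ z i = f
  · obtain ⟨i₀, hi₀, rfl⟩ := h
    have hlt : k < i₀ := lt_of_le_of_ne hi₀ (by rintro rfl; exact hf hk)
    have : ∀ n : ℕ, z (k - n) ∈ K := by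
      intro n
      induction n with
      | zero => simpa using hk
      | succ n ih =>
        refine (hstep _ (fun h => ?_) (fun h => ?_)).2 ?_
        · have := hz h; omega
        · have := hz h; omega
        · rwa [show k - ((n + 1 : ℕ) : ℤ) + 1 = k - n by push_cast; ring]
    refine Set.infinite_of_injective_forall_mem (f := fun n : ℕ => z (k - n)) ?_ this hK
    intro m n h
    have := hz h
    omega
  · push Not at h
    have : ∀ n : ℕ, z (k + n) ∈ K := by
      intro n
      induction n with
      | zero => simpa using hk
      | succ n ih =>
        have := (hstep _ (h _ (by omega)) (h (k + n + 1) (by omega))).1 ih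
        rw [Nat.cast_succ, ← add_assoc]
        exact this
    refine Set.infinite_of_injective_forall_mem (f := fun n : ℕ => z (k + n)) ?_ this hK
    intro m n h
    have := hz h
    omega

section Periodic

variable {α β : Type*} {a : ℕ → FreeGroup α} {e : ℕ → β × Bool} {N : ℕ}

theorem prodSyl_add_mul (ha : ∀ j, a (j + N) = a j) (he : ∀ j, e (j + N) = e j) (n m : ℕ) :
    prodSyl a e (n * N + m) = prodSyl a e N ^ n * prodSyl a e m := by
  have hper : ∀ m, prodSyl a e (N + m) = prodSyl a e N * prodSyl a e m := by
    intro m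
    induction m with
    | zero => simp [prodSyl]
    | succ m ih =>
      rw [← add_assoc, prodSyl, ih, prodSyl, add_comm N m, ha, he]
      simp [mul_assoc]
  induction n with
  | zero => simp
  | succ n ih =>
    rw [show (n + 1) * N + m = N + (n * N + m) by ring, hper, ih, pow_succ', mul_assoc]

theorem periodic_mul (he : ∀ j, e (j + N) = e j) (n j : ℕ) : e (n * N + j) = e j := by
  induction n with
  | zero => simp
  | succ n ih => rw [show (n + 1) * N + j = n * N + j + N by ring, he, ih]

end Periodic

section Filling

variable {ι : Type*} {X : Type*}

/-- A cyclically reduced form of an element, in which the last generator occurs often enough. -/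
structure IsFillingForm (N : ℕ) (a : ℕ → FreeGroup ι) (e : ℕ → Unit × Bool) : Prop where
  pos : 0 < N
  per_a : ∀ j, a (j + N) = a j
  per_e : ∀ j, e (j + N) = e j
  red : ∀ j, ¬ (a (j + 1) = 1 ∧ e (j + 1) = flip (e j))
  full : (∃ i j, e i = e (i + 1) ∧ e j = e i ∧ e (j + 1) = e i ∧ a (i + 1) ≠ a (j + 1)) ∨
    ∃ i j, e (i + 1) = flip (e i) ∧ e j = flip (e i) ∧ e (j + 1) = e i

namespace IsFillingForm

variable {N : ℕ} {a : ℕ → FreeGroup ι} {e : ℕ → Unit × Bool}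

theorem pow_notMem (hf : IsFillingForm N a e) {n : ℕ} (hn : 0 < n) (s : FreeGroup ι) :
    prodSyl a e N ^ n ≠ inA ι Unit s := by
  intro h
  have h1 := prodSyl_add_mul hf.per_a hf.per_e n 0
  rw [prodSyl, mul_one] at h1
  have hpos : 0 < n * N := Nat.mul_pos hn hf.pos
  have h2 := prodSyl_suffix_mem_branch (n := n * N) (fun j _ => hf.red j) (n * N - 1) 0 (by omega)
  rw [show 0 + (n * N - 1) + 1 = n * N + 0 by omega, h1, h, prodSyl, inv_one, one_mul,
    ← map_inv, ← map_mul] at h2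
  exact inA_notMem_branch _ _ h2

theorem line_back (hf : IsFillingForm N a e) (J n : ℕ) :
    (prodSyl a e (J + 1))⁻¹ * (prodSyl a e N ^ n)⁻¹ ∈ branch ι (flip (e J)) := by
  have h := inv_prodSyl_mem_branch (n := n * N + J + 1) (fun j _ => hf.red j) (n * N + J) (by omega)
  rw [periodic_mul hf.per_e, add_assoc, prodSyl_add_mul hf.per_a hf.per_e, mul_inv_rev] at h
  exact h

theorem line_forward (hf : IsFillingForm N a e) (J n : ℕ) (hn : J + 1 < n * N) :
    (inA ι Unit (a (J + 1)))⁻¹ * ((prodSyl a e (J + 1))⁻¹ * prodSyl a e N ^ n) ∈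
      branch ι (e (J + 1)) := by
  have h1 := prodSyl_add_mul hf.per_a hf.per_e n 0
  rw [prodSyl, mul_one] at h1
  have h := prodSyl_suffix_mem_branch (n := n * N) (fun j _ => hf.red j) (n * N - J - 2) (J + 1)
    (by omega)
  rwa [show J + 1 + (n * N - J - 2) + 1 = n * N + 0 by omega, h1] at h

theorem line_cases (hf : IsFillingForm N a e) (J : ℕ) (i : ℤ) :
    (prodSyl a e (J + 1))⁻¹ * prodSyl a e N ^ i ∈ branch ι (flip (e J)) ∨
    (inA ι Unit (a (J + 1)))⁻¹ * ((prodSyl a e (J + 1))⁻¹ * prodSyl a e N ^ i) ∈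
      branch ι (e (J + 1)) ∨ (prodSyl a e (J + 1))⁻¹ * prodSyl a e N ^ i = 1 := by
  rcases Int.eq_nat_or_neg i with ⟨n, rfl | rfl⟩
  · rw [zpow_natCast]
    rcases lt_trichotomy (J + 1) (n * N) with h | h | h
    · exact Or.inr (Or.inl (hf.line_forward J n h))
    · have h1 := prodSyl_add_mul hf.per_a hf.per_e n 0
      rw [prodSyl, mul_one, add_zero, ← h] at h1
      rw [← h1]
      simp
    · left
      obtain ⟨m, rfl⟩ : ∃ m, J = n * N + m := ⟨J - n * N, by omega⟩
      rw [periodic_mul hf.per_e, add_assoc, prodSyl_add_mul hf.per_a hf.per_e, mul_inv_rev,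
        inv_mul_cancel_right]
      simpa using hf.line_back m 0
  · left
    rw [zpow_neg, zpow_natCast]
    exact hf.line_back J n

theorem const_of_rooted [Finite ι] (hf : IsFillingForm N a e) {c : FreeGroup (ι ⊕ Unit) → X}
    (hc : FinCob c) (hinv : ∀ h s, c (h * inA ι Unit s) = c h)
    (hroot : ∀ s x, c (inA ι Unit s * lt ι x) = c (inA ι Unit s))
    (hline : ∀ d, (∀ i : ℤ, d ≠ prodSyl a e N ^ i) → ∃ M : ℕ, ∀ n ≥ M,
      c (d * prodSyl a e N ^ n) = c (d * (prodSyl a e N ^ n)⁻¹))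
    (h₁ h₂ : FreeGroup (ι ⊕ Unit)) : c h₁ = c h₂ := by
  by_contra hne
  obtain ⟨g, f, ⟨h, hh, h', hh', hne'⟩, hchild, hsome, hnone⟩ := exists_extremal hc hne
  set b := prodSyl a e N with hb
  have hval : ∀ v x, ¬ (v = 1 ∧ some x = f) → ∀ h, (inA ι Unit v)⁻¹ * h ∈ branch ι x →
      c (g * h) = c (g * inA ι Unit v * lt ι x) := by
    intro v x hvx h hh
    have := hchild v x hvx _ hh _ (lt_mem_branch x)
    rwa [show g * inA ι Unit v * ((inA ι Unit v)⁻¹ * h) = g * h by group] at this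
  let K : Set (FreeGroup ι × (Unit × Bool)) :=
    {p | ¬ (p.1 = 1 ∧ some p.2 = f) ∧ c (g * inA ι Unit p.1 * lt ι p.2) ≠ c g}
  have hKfin : K.Finite := by
    refine (finite_changes hc g).subset fun p hp => ?_
    rw [Set.mem_ofPred_eq, hinv]
    exact hp.2
  have hKne : K.Nonempty := by
    obtain ⟨h, hh, hhg⟩ : ∃ h ∈ region g f, c h ≠ c g := by
      by_contra hcon
      push Not at hcon
      exact hne' ((hcon h hh).trans (hcon h' hh').symm)
    rcases exists_inA_or_branch (g⁻¹ * h) with ⟨s, hs⟩ | ⟨s, x, hs⟩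
    · rw [inv_mul_eq_iff_eq_mul] at hs
      rw [hs, hinv] at hhg
      exact absurd rfl hhg
    · have hsx : ¬ (s = 1 ∧ some x = f) := by
        rintro ⟨rfl, hx⟩
        exact hh x hx.symm (by simpa using hs)
      refine ⟨(s, x), hsx, ?_⟩
      rw [← hval s x hsx _ hs, mul_inv_cancel_left]
      exact hhg
  obtain ⟨f₀, rfl⟩ : ∃ f₀, f = some f₀ := by
    cases f with
    | some f₀ => exact ⟨f₀, rfl⟩
    | none =>
      obtain ⟨⟨s, x⟩, -, hs⟩ := hKne
      have hg := hnone rfl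
      subst hg
      rw [one_mul, hroot, ← one_mul (inA ι Unit s), hinv] at hs
      exact absurd rfl hs
  have hgf := hsome f₀ rfl
  have hrule : ∀ J v, (v, flip (e J)) ≠ ((1 : FreeGroup ι), f₀) →
      (v * a (J + 1), e (J + 1)) ≠ (1, f₀) →
      ((v, flip (e J)) ∈ K ↔ (v * a (J + 1), e (J + 1)) ∈ K) := by
    intro J v h1 h2
    have h1' : ¬ (v = 1 ∧ some (flip (e J)) = some f₀) := by
      rintro ⟨rfl, h⟩; exact h1 (by rw [Option.some.inj h])
    have h2' : ¬ (v * a (J + 1) = 1 ∧ some (e (J + 1)) = some f₀) := by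
      rintro ⟨h, h'⟩; exact h2 (by rw [h, Option.some.inj h'])
    have hd : ∀ i : ℤ, g * inA ι Unit v * (prodSyl a e (J + 1))⁻¹ ≠ b ^ i := by
      intro i hi
      have hg : g⁻¹ = inA ι Unit v * ((prodSyl a e (J + 1))⁻¹ * b ^ (-i)) := by
        rw [zpow_neg, ← hi]; group
      rw [hg] at hgf
      rcases hf.line_cases J (-i) with h | h | h
      · have := eq_of_mul_mem_branch h hgf
        exact h1' ⟨this.1, by rw [this.2]⟩
      · have := eq_of_mul_mem_branch (a := v * a (J + 1)) h (by
          simpa only [map_mul, mul_assoc, mul_inv_cancel_left] using hgf)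
        exact h2' ⟨this.1, by rw [this.2]⟩
      · rw [h, mul_one] at hgf
        exact inA_notMem_branch _ _ hgf
    obtain ⟨M, hM⟩ := hline _ hd
    obtain ⟨n, hnM, hnJ⟩ : ∃ n, M ≤ n ∧ J + 1 < n * N := by
      refine ⟨M + J + 2, by omega, ?_⟩
      have := hf.pos
      nlinarith
    have h3 := hM n hnM
    have h4 := hval v _ h1' (inA ι Unit v * ((prodSyl a e (J + 1))⁻¹ * (b ^ n)⁻¹))
      (by simpa using hf.line_back J n)
    have h5 := hval _ _ h2' (inA ι Unit v * ((prodSyl a e (J + 1))⁻¹ * b ^ n))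
      (by
        have := hf.line_forward J n hnJ
        simpa only [map_mul, mul_inv_rev, mul_assoc, inv_mul_cancel_left] using this)
    simp only [mul_assoc] at h3 h4 h5
    rw [h4, h5] at h3
    simp only [K, Set.mem_ofPred_eq, h1', h2', not_false_eq_true, true_and, mul_assoc, h3]
  have hfK : ((1 : FreeGroup ι), f₀) ∉ K := fun h => h.1 ⟨rfl, rfl⟩
  obtain ⟨⟨v, p⟩, hp⟩ := hKne
  have hletter : ∀ x y : Unit × Bool, y = x ∨ y = flip x := by
    rintro ⟨⟨⟩, x⟩ ⟨⟨⟩, y⟩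
    cases x <;> cases y <;> simp [flip]
  rcases hf.full with ⟨i, j, hi, hj, hj', hij⟩ | ⟨i, j, hi, hj, hj'⟩
  · set x := e i with hx
    set d := (a (i + 1))⁻¹ * a (j + 1) with hd
    have hd1 : d ≠ 1 := by rwa [hd, Ne, inv_mul_eq_one]
    have hpow : Function.Injective fun n : ℤ => d ^ n := zpow_injective_of_ne_one hd1
    have E1 := fun v => hrule i v
    have E2 := fun v => hrule j v
    rw [← hi] at E1
    rw [hj, hj'] at E2
    let z : FreeGroup ι → ℤ → FreeGroup ι × (Unit × Bool) := fun u n =>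
      if Even n then (u * d ^ (n / 2), x) else (u * d ^ (n / 2) * (a (i + 1))⁻¹, flip x)
    have zeven : ∀ u n, z u (2 * n) = (u * d ^ n, x) := by
      intro u n
      simp only [z, even_two_mul, if_true]
      rw [Int.mul_ediv_cancel_left _ (by norm_num)]
    have zodd : ∀ u n, z u (2 * n + 1) = (u * d ^ n * (a (i + 1))⁻¹, flip x) := by
      intro u n
      have : ¬ Even (2 * n + 1) := by simp
      simp only [z, this, if_false]
      rw [show (2 * n + 1) / 2 = n by omega]
    have hzinj : ∀ u, Function.Injective (z u) := by
      intro u m n h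
      rcases Int.even_or_odd' m with ⟨m', rfl | rfl⟩ <;> rcases Int.even_or_odd' n with ⟨n', rfl | rfl⟩
      · rw [zeven, zeven, Prod.mk.injEq, mul_right_inj] at h
        rw [hpow h.1]
      · rw [zeven, zodd, Prod.mk.injEq] at h
        exact absurd h.2.symm (flip_ne x)
      · rw [zeven, zodd, Prod.mk.injEq] at h
        exact absurd h.2 (flip_ne x)
      · rw [zodd, zodd, Prod.mk.injEq, mul_left_inj, mul_right_inj] at h
        rw [hpow h.1]
    have hno : ∀ u k, z u k ∉ K := by
      intro u
      refine not_mem_of_line hKfin (hzinj u) (f := (1, f₀)) ?_ hfK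
      intro n
      rcases Int.even_or_odd' n with ⟨n, rfl | rfl⟩
      · rw [zeven, zodd]
        intro h1 h2
        have := E1 (u * d ^ n * (a (i + 1))⁻¹) h2
        rw [inv_mul_cancel_right] at this
        exact (this h1).symm
      · rw [show 2 * n + 1 + 1 = 2 * (n + 1) by ring, zeven, zodd]
        intro h1 h2
        have := E2 (u * d ^ n * (a (i + 1))⁻¹) h1
        rw [mul_assoc _ _ (a (j + 1)), ← hd, mul_assoc, ← zpow_add_one] at this
        exact this h2
    rcases hletter x p with rfl | rfl
    · exact hno v (2 * 0) (by rw [zeven]; simpa using hp)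
    · exact hno (v * a (i + 1)) (2 * 0 + 1) (by rw [zodd]; simpa using hp)
  · have key : ∀ (s : FreeGroup ι) (p : Unit × Bool), s ≠ 1 →
        (∀ v, (v, p) ≠ (1, f₀) → (v * s, p) ≠ (1, f₀) → ((v, p) ∈ K ↔ (v * s, p) ∈ K)) →
        ∀ v, (v, p) ∉ K := by
      intro s p hs hstep v
      have hpow : Function.Injective fun n : ℤ => s ^ n := zpow_injective_of_ne_one hs
      have := not_mem_of_line hKfin (z := fun n : ℤ => (v * s ^ n, p)) (f := (1, f₀))
        (fun m n h => hpow (by simpa using h))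
        (fun n h1 h2 => by
          have := hstep (v * s ^ n) h1
          rw [mul_assoc, ← zpow_add_one] at this
          exact this h2) hfK 0
      simpa using this
    have E1 := fun v => hrule i v
    have E2 := fun v => hrule j v
    rw [hi] at E1
    rw [hj, flip_flip, hj'] at E2
    rcases hletter (e i) p with rfl | rfl
    · refine key _ _ (fun h => hf.red j ⟨h, by rw [hj, flip_flip, hj']⟩) E2 v hp
    · exact key _ _ (fun h => hf.red i ⟨h, hi⟩) E1 v hp

theorem const [Finite ι] (hf : IsFillingForm N a e) {c : FreeGroup (ι ⊕ Unit) → X}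
    (hc : FinCob c) (hinv : ∀ h s, c (h * inA ι Unit s) = c h) (d₀ : FreeGroup (ι ⊕ Unit))
    (hline : ∀ d, (∀ i : ℤ, d ≠ d₀ * prodSyl a e N ^ i) → ∃ M : ℕ, ∀ n ≥ M,
      c (d * prodSyl a e N ^ n) = c (d * (prodSyl a e N ^ n)⁻¹))
    (h₁ h₂ : FreeGroup (ι ⊕ Unit)) : c h₁ = c h₂ := by
  set b := prodSyl a e N with hb
  obtain ⟨k, hk⟩ : ∃ k : ℕ, ∀ s x, c (d₀ * b ^ k * (inA ι Unit s * lt ι x)) =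
      c (d₀ * b ^ k * inA ι Unit s) := by
    by_contra hcon
    push Not at hcon
    choose s x hsx using hcon
    have hB : {h | ∃ x, c (h * lt ι x) ≠ c h}.Finite := by
      have : {h | ∃ x, c (h * lt ι x) ≠ c h} = ⋃ x : Unit × Bool, {h | c (h * lt ι x) ≠ c h} := by
        ext; simp
      rw [this]
      exact Set.finite_iUnion fun x => hc _
    refine Set.infinite_of_injective_forall_mem (f := fun k : ℕ => d₀ * b ^ k * inA ι Unit (s k))
      ?_ (fun k => (⟨x k, ?_⟩ : ∃ x, _)) hB
    · have key : ∀ m n, m < n → d₀ * b ^ m * inA ι Unit (s m) ≠ d₀ * b ^ n * inA ι Unit (s n) := by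
        intro m n hmn h
        obtain ⟨l, rfl⟩ := Nat.exists_eq_add_of_lt hmn
        rw [show m + l + 1 = m + (l + 1) by ring, pow_add, mul_assoc, mul_assoc, mul_assoc,
          mul_right_inj, mul_right_inj, ← mul_inv_eq_iff_eq_mul, ← map_inv, ← map_mul] at h
        exact hf.pow_notMem (Nat.succ_pos l) _ h.symm
      intro m n h
      rcases lt_trichotomy m n with h' | h' | h'
      · exact absurd h (key _ _ h')
      · exact h'
      · exact absurd h.symm (key _ _ h')
    · simpa only [mul_assoc] using hsx k
  have := hf.const_of_rooted (hc.left (d₀ * b ^ k)) (fun h s => by rw [← mul_assoc, hinv]) hk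
    (fun d hd => by
      simp only [← mul_assoc]
      refine hline (d₀ * b ^ k * d) (fun i hi => hd (-k + i) ?_)
      rw [mul_assoc, mul_right_inj] at hi
      rw [zpow_add, zpow_neg, zpow_natCast, ← hi, inv_mul_cancel_left])
    ((d₀ * b ^ k)⁻¹ * h₁) ((d₀ * b ^ k)⁻¹ * h₂)
  simpa only [mul_inv_cancel_left] using this

end IsFillingForm

end Filling

end GradedAntipode

namespace GradedAntipode

section

variable {α β : Type*}

theorem prodSyl_congr {a a' : ℕ → FreeGroup α} {e e' : ℕ → β × Bool} {n : ℕ}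
    (ha : ∀ j < n, a j = a' j) (he : ∀ j < n, e j = e' j) : prodSyl a e n = prodSyl a' e' n := by
  induction n with
  | zero => rfl
  | succ n ih =>
    rw [prodSyl, prodSyl, ih (fun j hj => ha j (by omega)) (fun j hj => he j (by omega)),
      ha n (by omega), he n (by omega)]

theorem exists_prodSyl [DecidableEq α] [Nonempty β] (w : List ((α ⊕ β) × Bool)) :
    ∃ (n : ℕ) (a : ℕ → FreeGroup α) (e : ℕ → β × Bool) (v : FreeGroup α),
      FreeGroup.mk w = prodSyl a e n * inA α β v ∧
      (∑ j ∈ Finset.range n, ((a j).norm + 1)) + v.norm ≤ w.length ∧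
      ∀ w' x, w = w' ++ [(Sum.inr (Prod.fst x), Prod.snd x)] → 0 < n ∧ v = 1 := by
  induction w using List.reverseRecOn with
  | nil =>
    exact ⟨0, fun _ => 1, fun _ => (Classical.arbitrary β, true), 1,
      by simp [prodSyl, ← FreeGroup.one_eq_mk], by simp, by simp⟩
  | append_singleton w x ih =>
    obtain ⟨n, a, e, v, h1, h2, -⟩ := ih
    rcases x with ⟨i | y, s⟩
    · refine ⟨n, a, e, v * FreeGroup.mk [(i, s)], ?_, ?_, ?_⟩
      · rw [← FreeGroup.mul_mk, h1, map_mul, ← mul_assoc]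
        rfl
      · have h3 := FreeGroup.norm_mul_le v (FreeGroup.mk [(i, s)])
        have h4 : (FreeGroup.mk [(i, s)]).norm ≤ 1 := FreeGroup.norm_mk_le
        rw [List.length_append, List.length_singleton]
        omega
      · intro w' x' h
        have := List.append_inj_right' h rfl
        simp at this
    · refine ⟨n + 1, fun j => if j < n then a j else v, fun j => if j < n then e j else (y, s), 1,
        ?_, ?_, fun _ _ _ => ⟨by omega, rfl⟩⟩
      · rw [← FreeGroup.mul_mk, h1, map_one, mul_one, prodSyl]
        have h5 : prodSyl (fun j => if j < n then a j else v) (fun j => if j < n then e j else (y, s))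
            n = prodSyl a e n := prodSyl_congr (fun j hj => by simp [hj]) (fun j hj => by simp [hj])
        rw [h5]
        simp [lt]
      · rw [Finset.sum_range_succ, List.length_append, List.length_singleton]
        have : ∑ j ∈ Finset.range n, ((if j < n then a j else v).norm + 1) =
            ∑ j ∈ Finset.range n, ((a j).norm + 1) :=
          Finset.sum_congr rfl fun j hj => by simp [Finset.mem_range.1 hj]
        rw [this]
        simp
        omega

theorem norm_syl_le [DecidableEq (α ⊕ β)] [DecidableEq α] (a : FreeGroup α) (x : β × Bool) :
    (inA α β a * lt α x).norm ≤ a.norm + 1 := by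
  have h1 := FreeGroup.norm_mul_le (inA α β a) (lt α x)
  have h2 : (lt α x).norm ≤ 1 := FreeGroup.norm_mk_le
  have h3 : (inA α β a).norm ≤ a.norm := by
    conv_lhs => rw [← FreeGroup.mk_toWord (x := a)]
    rw [inA, FreeGroup.map.mk]
    exact FreeGroup.norm_mk_le.trans (by simp [FreeGroup.norm])
  omega

theorem norm_segment_le [DecidableEq (α ⊕ β)] [DecidableEq α] (a : ℕ → FreeGroup α)
    (e : ℕ → β × Bool) (s n : ℕ) :
    ((prodSyl a e s)⁻¹ * prodSyl a e (s + n)).norm ≤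
      ∑ j ∈ Finset.range n, ((a (s + j)).norm + 1) := by
  induction n with
  | zero => simp
  | succ n ih =>
    rw [Finset.sum_range_succ, ← add_assoc, prodSyl, mul_assoc, ← mul_assoc]
    have h1 := FreeGroup.norm_mul_le ((prodSyl a e s)⁻¹ * prodSyl a e (s + n))
      (inA α β (a (s + n)) * lt α (e (s + n)))
    have h2 := norm_syl_le (a (s + n)) (e (s + n))
    omega

theorem sum_periodic_shift {f : ℕ → ℕ} {N : ℕ} (hf : ∀ j, f (j + N) = f j) (s : ℕ) :
    ∑ j ∈ Finset.range N, f (s + j) = ∑ j ∈ Finset.range N, f j := by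
  induction s with
  | zero => simp
  | succ s ih =>
    rw [← ih]
    have h1 := Finset.sum_range_succ (fun j => f (s + j)) N
    have h2 := Finset.sum_range_succ' (fun j => f (s + j)) N
    rw [h1, hf, add_zero] at h2
    have h3 : ∀ j, f (s + 1 + j) = f (s + (j + 1)) := fun j => by congr 1; ring
    simp only [h3]
    omega

end

section Existence

variable {ι : Type*}

theorem exists_reduced_periodic (b : FreeGroup (ι ⊕ Unit)) (hb : b ≠ 1) :
    ∃ (ψ : FreeGroup (ι ⊕ Unit) ≃* FreeGroup (ι ⊕ Unit)) (N : ℕ) (a : ℕ → FreeGroup ι)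
      (e : ℕ → Unit × Bool), 0 < N ∧ (∀ j, a (j + N) = a j) ∧ (∀ j, e (j + N) = e j) ∧
      (∀ j, ¬ (a (j + 1) = 1 ∧ e (j + 1) = flip (e j))) ∧ ψ (prodSyl a e N) = b := by
  classical
  let P : ℕ → Prop := fun n => ∃ ψ : FreeGroup (ι ⊕ Unit) ≃* FreeGroup (ι ⊕ Unit),
    (ψ.symm b).norm = n
  have hP : ∃ n, P n := ⟨_, MulEquiv.refl _, rfl⟩
  obtain ⟨ψ, hψ⟩ := Nat.find_spec hP
  have hmin : ∀ φ : FreeGroup (ι ⊕ Unit) ≃* FreeGroup (ι ⊕ Unit), Nat.find hP ≤ (φ.symm b).norm :=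
    fun φ => Nat.find_min' hP ⟨φ, rfl⟩
  set m := Nat.find hP
  set w := (ψ.symm b).toWord with hw
  have hw0 : w ≠ [] := by
    rw [hw, Ne, FreeGroup.toWord_eq_nil_iff]
    simpa using hb
  obtain ⟨w', x, hwx⟩ := (List.eq_nil_or_concat' w).resolve_left hw0
  -- permute the generators so that the last letter of the word is the last generator
  let π : Equiv.Perm (ι ⊕ Unit) := Equiv.swap x.1 (Sum.inr ())
  let W : List ((ι ⊕ Unit) × Bool) := w.map fun y => (π y.1, y.2)
  have hWlast : W = w'.map (fun y => (π y.1, y.2)) ++ [(Sum.inr (), x.2)] := by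
    simp [W, hwx, π]
  obtain ⟨N, a, e, v, h1, h2, h3⟩ := exists_prodSyl (β := Unit) W
  obtain ⟨hN, rfl⟩ := h3 _ ((), x.2) hWlast
  rw [map_one, mul_one] at h1
  have hWlen : W.length = m := by rw [List.length_map]; exact hψ
  rw [FreeGroup.norm_one, add_zero, hWlen] at h2
  let θ := (FreeGroup.freeGroupCongr π).symm.trans ψ
  have hθ : θ (FreeGroup.mk W) = b := by
    have hW : FreeGroup.mk W = FreeGroup.freeGroupCongr π (FreeGroup.mk w) := by
      simp [W, FreeGroup.freeGroupCongr]
    have hmk : FreeGroup.mk w = ψ.symm b := FreeGroup.mk_toWord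
    rw [MulEquiv.trans_apply, hW, MulEquiv.symm_apply_apply, hmk, MulEquiv.apply_symm_apply]
  set a' : ℕ → FreeGroup ι := fun j => a (j % N) with ha'
  set e' : ℕ → Unit × Bool := fun j => e (j % N) with he'
  have hper : ∀ j, a' (j + N) = a' j := fun j => by simp [ha']
  have hper' : ∀ j, e' (j + N) = e' j := fun j => by simp [he']
  have hprod : prodSyl a' e' N = FreeGroup.mk W := by
    rw [h1]
    exact prodSyl_congr (fun j hj => by simp [ha', Nat.mod_eq_of_lt hj])
      (fun j hj => by simp [he', Nat.mod_eq_of_lt hj])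
  have hsum : ∀ s, ∑ j ∈ Finset.range N, ((a' (s + j)).norm + 1) ≤ m := by
    intro s
    rw [sum_periodic_shift (f := fun j => (a' j).norm + 1) (fun j => by rw [hper])]
    refine le_trans (le_of_eq (Finset.sum_congr rfl fun j hj => ?_)) h2
    simp [ha', Nat.mod_eq_of_lt (Finset.mem_range.1 hj)]
  refine ⟨θ, N, a', e', hN, hper, hper', ?_, by rw [hprod, hθ]⟩
  rintro s ⟨hs1, hs2⟩
  obtain ⟨n, rfl⟩ : ∃ n, N = n + 2 := by
    rcases N with _ | _ | n
    · omega
    · have h1 := hper' s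
      rw [hs2] at h1
      exact absurd h1 (flip_ne _)
    · exact ⟨n, rfl⟩
  have hconj : (prodSyl a' e' s)⁻¹ * prodSyl a' e' (s + (n + 2)) =
      (prodSyl a' e' s)⁻¹ * FreeGroup.mk W * prodSyl a' e' s := by
    have := prodSyl_add_mul hper hper' 1 s
    rw [one_mul, pow_one, hprod, add_comm (n + 2) s] at this
    rw [this, mul_assoc]
  have hle := hmin ((MulAut.conj (prodSyl a' e' s)).trans θ)
  have hconj' : ((MulAut.conj (prodSyl a' e' s)).trans θ).symm b =
      (prodSyl a' e' s)⁻¹ * FreeGroup.mk W * prodSyl a' e' s := by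
    rw [MulEquiv.symm_trans_apply, ← hθ, MulEquiv.symm_apply_apply, MulAut.conj_symm_apply]
  rw [hconj', ← hconj] at hle
  have hcancel : (prodSyl a' e' s)⁻¹ * prodSyl a' e' (s + (n + 2)) =
      inA ι Unit (a' s) * ((prodSyl a' e' (s + 2))⁻¹ * prodSyl a' e' (s + 2 + n)) := by
    rw [show s + (n + 2) = s + 2 + n by ring]
    have : prodSyl a' e' (s + 2) = prodSyl a' e' s * inA ι Unit (a' s) := by
      simp only [prodSyl, hs1, hs2, map_one, mul_one, lt_flip, mul_inv_cancel_right]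
    rw [this]; group
  have h4 := FreeGroup.norm_mul_le (inA ι Unit (a' s))
    ((prodSyl a' e' (s + 2))⁻¹ * prodSyl a' e' (s + 2 + n))
  have h5 := norm_segment_le a' e' (s + 2) n
  have h6 : (inA ι Unit (a' s)).norm ≤ (a' s).norm := by
    conv_lhs => rw [← FreeGroup.mk_toWord (x := a' s)]
    rw [inA, FreeGroup.map.mk]
    exact FreeGroup.norm_mk_le.trans (by simp [FreeGroup.norm])
  have h7 := hsum s
  rw [Finset.sum_range_succ', Finset.sum_range_succ'] at h7
  have h8 : ∑ j ∈ Finset.range n, ((a' (s + 2 + j)).norm + 1) =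
      ∑ j ∈ Finset.range n, ((a' (s + (j + 1 + 1))).norm + 1) :=
    Finset.sum_congr rfl fun j _ => by rw [show s + 2 + j = s + (j + 1 + 1) by ring]
  rw [hcancel] at hle
  simp only [add_zero, zero_add] at h7
  omega

/-- The automorphism that multiplies the letter `x` of the last generator by `s` on the left. -/
theorem exists_transvection (s : FreeGroup ι) (x : Unit × Bool) :
    ∃ ψ : FreeGroup (ι ⊕ Unit) ≃* FreeGroup (ι ⊕ Unit),
      ψ (lt ι x) = inA ι Unit s * lt ι x := by
  let F : FreeGroup ι → FreeGroup (ι ⊕ Unit) →* FreeGroup (ι ⊕ Unit) := fun s =>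
    FreeGroup.lift (Sum.elim (fun i => FreeGroup.of (Sum.inl i)) fun _ =>
      if x.2 then inA ι Unit s * FreeGroup.of (Sum.inr ()) else
        FreeGroup.of (Sum.inr ()) * (inA ι Unit s)⁻¹)
  have hA : ∀ s t, F s (inA ι Unit t) = inA ι Unit t := by
    intro s t
    have : (F s).comp (inA ι Unit) = inA ι Unit := by
      ext i; simp [F, inA]
    exact DFunLike.congr_fun this t
  have hcomp : ∀ s, (F s⁻¹).comp (F s) = MonoidHom.id _ := by
    intro s
    ext i
    rcases i with i | u
    · simp [F]
    · have := hA s⁻¹ s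
      cases hx : x.2
      · have h1 : F s (FreeGroup.of (Sum.inr u)) =
          FreeGroup.of (Sum.inr ()) * (inA ι Unit s)⁻¹ := by simp [F, hx]
        rw [MonoidHom.comp_apply, h1, map_mul, map_inv, this]
        simp [F, hx]
      · have h1 : F s (FreeGroup.of (Sum.inr u)) =
          inA ι Unit s * FreeGroup.of (Sum.inr ()) := by simp [F, hx]
        rw [MonoidHom.comp_apply, h1, map_mul, this]
        simp [F, hx]
  refine ⟨MonoidHom.toMulEquiv (F s) (F s⁻¹) (hcomp s) (by simpa using hcomp s⁻¹), ?_⟩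
  rw [MonoidHom.toMulEquiv_apply]
  rcases x with ⟨⟨⟩, _ | _⟩ <;> simp [F, lt] <;> simp [FreeGroup.of, FreeGroup.invRev]

theorem exists_spread (i₀ : ι) :
    ∃ ψ : FreeGroup (ι ⊕ Unit) ≃* FreeGroup (ι ⊕ Unit),
      ψ (FreeGroup.of (Sum.inr ()) * FreeGroup.of (Sum.inl i₀) * FreeGroup.of (Sum.inr ())) =
        FreeGroup.of (Sum.inr ()) := by
  classical
  let x : FreeGroup (ι ⊕ Unit) := FreeGroup.of (Sum.inr ())
  let y : FreeGroup (ι ⊕ Unit) := FreeGroup.of (Sum.inl i₀)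
  let F : FreeGroup (ι ⊕ Unit) →* FreeGroup (ι ⊕ Unit) := FreeGroup.lift (Sum.elim
    (fun i => if i = i₀ then y * y * x⁻¹ else FreeGroup.of (Sum.inl i)) fun _ => x * y⁻¹)
  let G : FreeGroup (ι ⊕ Unit) →* FreeGroup (ι ⊕ Unit) := FreeGroup.lift (Sum.elim
    (fun i => if i = i₀ then y * x else FreeGroup.of (Sum.inl i)) fun _ => x * y * x)
  have hFx : F x = x * y⁻¹ := by simp [F, x]
  have hFy : F y = y * y * x⁻¹ := by simp [F, y]
  have hGx : G x = x * y * x := by simp [G, x]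
  have hGy : G y = y * x := by simp [G, y]
  have hFi : ∀ i, i ≠ i₀ → F (FreeGroup.of (Sum.inl i)) = FreeGroup.of (Sum.inl i) := by
    intro i hi; simp [F, hi]
  have hGi : ∀ i, i ≠ i₀ → G (FreeGroup.of (Sum.inl i)) = FreeGroup.of (Sum.inl i) := by
    intro i hi; simp [G, hi]
  refine ⟨MonoidHom.toMulEquiv F G ?_ ?_, ?_⟩
  · ext i
    rcases i with i | u
    · by_cases hi : i = i₀
      · subst hi
        change G (F y) = y
        simp only [hFy, map_mul, map_inv, hGx, hGy]; group
      · simp [hFi i hi, hGi i hi]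
    · change G (F x) = x
      simp only [hFx, map_mul, map_inv, hGx, hGy]; group
  · ext i
    rcases i with i | u
    · by_cases hi : i = i₀
      · subst hi
        change F (G y) = y
        simp only [hGy, map_mul, hFx, hFy]; group
      · simp [hFi i hi, hGi i hi]
    · change F (G x) = x
      simp only [hGx, map_mul, hFx, hFy]; group
  · change F (x * y * x) = x
    simp only [map_mul, hFx, hFy]; group

theorem prodSyl_const {α β : Type*} (s : FreeGroup α) (x : β × Bool) (n : ℕ) :
    prodSyl (fun _ => s) (fun _ => x) n = (inA α β s * lt α x) ^ n := by
  induction n with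
  | zero => rfl
  | succ n ih => rw [prodSyl, ih, pow_succ, mul_assoc]

theorem exists_fillingForm [Nonempty ι] (b : FreeGroup (ι ⊕ Unit)) (hb : b ≠ 1) :
    ∃ (ψ : FreeGroup (ι ⊕ Unit) ≃* FreeGroup (ι ⊕ Unit)) (N : ℕ) (a : ℕ → FreeGroup ι)
      (e : ℕ → Unit × Bool), IsFillingForm N a e ∧ ψ (prodSyl a e N) = b := by
  obtain ⟨ψ, N, a, e, hN, ha, he, hred, rfl⟩ := exists_reduced_periodic b hb
  have hletter : ∀ x y : Unit × Bool, y = x ∨ y = flip x := by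
    rintro ⟨⟨⟩, x⟩ ⟨⟨⟩, y⟩
    cases x <;> cases y <;> simp [flip]
  by_cases hsign : ∃ i, e (i + 1) = flip (e i)
  · obtain ⟨i, hi⟩ := hsign
    refine ⟨ψ, N, a, e, ⟨hN, ha, he, hred, Or.inr ⟨i, ?_⟩⟩, rfl⟩
    by_contra hcon
    push Not at hcon
    have : ∀ n, e (i + 1 + n) = flip (e i) := by
      intro n
      induction n with
      | zero => exact hi
      | succ n ih =>
        exact (hletter (e i) (e (i + 1 + (n + 1)))).resolve_left (hcon _ hi ih)
    have h1 := this (N - 1)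
    rw [show i + 1 + (N - 1) = i + N by omega, he] at h1
    exact flip_ne _ h1.symm
  · push Not at hsign
    have hconst : ∀ j, e j = e 0 := by
      intro j
      induction j with
      | zero => rfl
      | succ j ih => rw [← ih]; exact (hletter (e j) _).resolve_right (hsign j)
    by_cases hdiff : ∃ i j, a (i + 1) ≠ a (j + 1)
    · obtain ⟨i, j, hij⟩ := hdiff
      exact ⟨ψ, N, a, e, ⟨hN, ha, he, hred, Or.inl ⟨i, j, by simp only [hconst], by simp only [hconst],
        by simp only [hconst], hij⟩⟩, rfl⟩
    · push Not at hdiff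
      have haconst : ∀ j, a j = a 1 := by
        intro j
        cases j with
        | zero =>
          rw [← ha 0, zero_add]
          obtain ⟨n, rfl⟩ : ∃ n, N = n + 1 := ⟨N - 1, by omega⟩
          exact hdiff n 0
        | succ j => exact hdiff j 0
      set s := a 1
      set x := e 0
      have hprod : prodSyl a e N = (inA ι Unit s * lt ι x) ^ N := by
        rw [← prodSyl_const]
        exact prodSyl_congr (fun j _ => haconst j) (fun j _ => hconst j)
      obtain ⟨ψ₁, h₁⟩ := exists_transvection s x
      obtain ⟨i₀⟩ := ‹Nonempty ι›
      obtain ⟨ψ₂, h₂⟩ := exists_spread i₀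
      set a' : ℕ → FreeGroup ι := fun j => if Even j then 1 else FreeGroup.mk [(i₀, x.2)] with ha'
      have hodd : ∀ j, ¬ Even (2 * j + 1) := fun j => by simp
      refine ⟨(ψ₂.trans ψ₁).trans ψ, N * 2, a', fun _ => x, ⟨by omega, ?_, by simp, ?_, ?_⟩, ?_⟩
      · intro j
        have : Even (j + N * 2) ↔ Even j := by simp [Nat.even_add]
        simp only [ha', this]
      · rintro j ⟨-, h⟩
        exact flip_ne _ h.symm
      · refine Or.inl ⟨0, 1, rfl, rfl, rfl, ?_⟩
        have h1 : ¬ Even (0 + 1) := by decide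
        have h2 : Even (1 + 1) := by decide
        simp only [ha', h1, h2, if_true, if_false]
        intro h
        have := mk_inj_of_isReduced FreeGroup.IsReduced.singleton FreeGroup.IsReduced.nil
          (h.trans FreeGroup.one_eq_mk)
        simp at this
      · have hpow := prodSyl_add_mul (a := a') (e := fun _ : ℕ => x) (N := 2)
          (fun j => by simp only [ha', Nat.even_add, even_two, iff_true]) (fun _ => rfl) N 0
        rw [add_zero] at hpow
        have h1 : ¬ Even 1 := by decide
        have hword : ψ₂ (prodSyl a' (fun _ => x) 2) = lt ι x := by
          have hx : x = ((), x.2) := rfl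
          simp only [prodSyl, ha', Even.zero, if_true, h1, if_false, map_one, one_mul]
          cases hx2 : x.2
          · have hx3 : x = ((), false) := by rw [hx, hx2]
            have h3 := congrArg (·⁻¹) h₂
            simp only [← map_inv, mul_inv_rev] at h3
            rw [hx3]
            refine Eq.trans (congrArg ψ₂ ?_) (h3.trans ?_)
            · simp [lt, inA, FreeGroup.of, FreeGroup.invRev]
            · simp [lt, FreeGroup.of, FreeGroup.invRev]
          · have hx3 : x = ((), true) := by rw [hx, hx2]
            rw [hx3]
            refine Eq.trans (congrArg ψ₂ ?_) h₂
            simp [lt, inA, FreeGroup.of]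
        rw [hpow, prodSyl, mul_one, map_pow, MulEquiv.trans_apply, MulEquiv.trans_apply, hword, h₁,
          hprod, map_pow]

/-- A nontrivial element `b` of a free group of rank at least two and some free factor of corank
one fill the group: no nonconstant function with finite coboundary is invariant under the factor
and takes the same values at both ends of all lines of `b` but one. -/
theorem exists_filling [Finite ι] [Nonempty ι] (b : FreeGroup (ι ⊕ Unit)) (hb : b ≠ 1) :
    ∃ ψ : FreeGroup (ι ⊕ Unit) ≃* FreeGroup (ι ⊕ Unit),
      ∀ {X : Type*} (c : FreeGroup (ι ⊕ Unit) → X), FinCob c →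
        (∀ h i, c (h * ψ (FreeGroup.of (Sum.inl i))) = c h) →
        ∀ d₀, (∀ d, (∀ i : ℤ, d ≠ d₀ * b ^ i) → ∃ M : ℕ, ∀ n ≥ M,
          c (d * b ^ n) = c (d * (b ^ n)⁻¹)) → ∀ h₁ h₂, c h₁ = c h₂ := by
  obtain ⟨ψ, N, a, e, hf, rfl⟩ := exists_fillingForm b hb
  refine ⟨ψ, fun c hc hinv d₀ hline h₁ h₂ => ?_⟩
  have hc' : FinCob (c ∘ ψ.toMonoidHom) := hc.comp ψ.injective
  have hinv' : ∀ h s, (c ∘ ψ.toMonoidHom) (h * inA ι Unit s) = (c ∘ ψ.toMonoidHom) h := by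
    intro h s
    have key : ∀ (h : FreeGroup (ι ⊕ Unit)) i, (c ∘ ψ.toMonoidHom) (h * FreeGroup.of (Sum.inl i)) =
        (c ∘ ψ.toMonoidHom) h := fun h i => by simpa using hinv (ψ h) i
    induction s using FreeGroup.induction_on generalizing h with
    | C1 => simp
    | of i => simpa [inA] using key h i
    | inv_of i _ =>
      have := key (h * (FreeGroup.of (Sum.inl i))⁻¹) i
      rw [inv_mul_cancel_right] at this
      simpa [inA] using this.symm
    | mul s t hs ht => rw [map_mul, ← mul_assoc, ht, hs]
  have := hf.const hc' hinv' (ψ.symm d₀) (fun d hd => ?_) (ψ.symm h₁) (ψ.symm h₂)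
  · simpa using this
  · obtain ⟨M, hM⟩ := hline (ψ d) (fun i hi => hd i (by
      apply ψ.injective; rw [hi]; simp))
    exact ⟨M, fun n hn => by simpa using hM n hn⟩

end Existence

end GradedAntipode

namespace GradedAntipode

open scoped Classical in
theorem exists_letterwise_conj {α β : Type*} (p : β → Prop) (s : β × Bool → FreeGroup (α ⊕ β))
    (hs : ∀ z, s z ∈ Subgroup.closure
      (Set.range (inA α β) ∪ {h | ∃ y, p y ∧ h = FreeGroup.of (Sum.inr y)})) :
    ∃ σ : FreeGroup (α ⊕ β) ≃* FreeGroup (α ⊕ β), (∀ v, σ (inA α β v) = inA α β v) ∧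
      (∀ x, p (Prod.fst x) → σ (lt α x) = lt α x) ∧
      ∀ x, ¬ p (Prod.fst x) → σ (lt α x) = s x * lt α x * (s (flip x))⁻¹ := by
  let T : (β × Bool → FreeGroup (α ⊕ β)) → FreeGroup (α ⊕ β) →* FreeGroup (α ⊕ β) := fun s =>
    FreeGroup.lift (Sum.elim (fun i => FreeGroup.of (Sum.inl i)) fun y =>
      if p y then FreeGroup.of (Sum.inr y) else
        s (y, true) * FreeGroup.of (Sum.inr y) * (s (y, false))⁻¹)
  have hA : ∀ s v, T s (inA α β v) = inA α β v := by
    intro s v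
    have : (T s).comp (inA α β) = inA α β := by
      ext i; simp [T, inA]
    exact DFunLike.congr_fun this v
  have hp : ∀ s y, p y → T s (FreeGroup.of (Sum.inr y)) = FreeGroup.of (Sum.inr y) := by
    intro s y hy; simp [T, hy]
  have hnp : ∀ s y, ¬ p y → T s (FreeGroup.of (Sum.inr y)) =
      s (y, true) * FreeGroup.of (Sum.inr y) * (s (y, false))⁻¹ := by
    intro s y hy; simp [T, hy]
  have hfix : ∀ (s' : β × Bool → FreeGroup (α ⊕ β)) (g : FreeGroup (α ⊕ β)),
      g ∈ Subgroup.closure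
        (Set.range (inA α β) ∪ {h | ∃ y, p y ∧ h = FreeGroup.of (Sum.inr y)}) → T s' g = g := by
    intro s' g hg
    induction hg using Subgroup.closure_induction with
    | mem x hx =>
      rcases hx with ⟨v, rfl⟩ | ⟨y, hy, rfl⟩
      · exact hA _ _
      · exact hp _ _ hy
    | one => exact map_one _
    | mul x y _ _ hx hy => rw [map_mul, hx, hy]
    | inv x _ hx => rw [map_inv, hx]
  have hcomp : ∀ s s' : β × Bool → FreeGroup (α ⊕ β), (∀ z, s' z = (s z)⁻¹) →
      (∀ z, T s (s' z) = s' z) → (T s).comp (T s') = MonoidHom.id _ := by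
    intro s s' h1 h2
    ext i
    rcases i with i | y
    · simp [T]
    · by_cases hy : p y
      · rw [MonoidHom.comp_apply, hp _ y hy, hp _ y hy]
        rfl
      · rw [MonoidHom.comp_apply, hnp _ y hy, map_mul, map_mul, map_inv, h2, h2, hnp _ y hy, h1, h1]
        simp [mul_assoc]
  have hfs : ∀ s' z, T s' (s z) = s z := fun s' z => hfix s' _ (hs z)
  have h12 : (T fun z => (s z)⁻¹).comp (T s) = MonoidHom.id _ :=
    hcomp (fun z => (s z)⁻¹) s (fun z => (inv_inv (s z)).symm) (hfs fun z => (s z)⁻¹)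
  have h21 : (T s).comp (T fun z => (s z)⁻¹) = MonoidHom.id _ :=
    hcomp s (fun z => (s z)⁻¹) (fun _ => rfl) fun z => by
      rw [map_inv, hfs]
  clear_value T
  refine ⟨MonoidHom.toMulEquiv (T s) (T fun z => (s z)⁻¹) ?_ ?_, hA s, ?_, ?_⟩
  · exact h12
  · exact h21
  · rintro ⟨y, _ | _⟩ hy
    · have : lt α (y, false) = (FreeGroup.of (Sum.inr y))⁻¹ := by
        simp [lt, FreeGroup.of, FreeGroup.invRev]
      rw [this, map_inv]
      exact congrArg _ (hp s y hy)
    · exact hp s y hy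
  · rintro ⟨y, _ | _⟩ hy
    · have : lt α (y, false) = (FreeGroup.of (Sum.inr y))⁻¹ := by
        simp [lt, FreeGroup.of, FreeGroup.invRev]
      rw [this, map_inv]
      refine (congrArg _ (hnp s y hy)).trans ?_
      simp [flip, mul_assoc]
    · exact hnp s y hy

section SyllableLength

variable {α β : Type*}

/-- `h` is a product with at most `m` letters of the second factor. -/
def SylLe (h : FreeGroup (α ⊕ β)) (m : ℕ) : Prop :=
  ∃ n ≤ m, ∃ (a : ℕ → FreeGroup α) (e : ℕ → β × Bool), h = prodSyl a e n * inA α β (a n)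

theorem SylLe.mono {h : FreeGroup (α ⊕ β)} {m m' : ℕ} (hh : SylLe h m) (hm : m ≤ m') :
    SylLe h m' := by
  obtain ⟨n, hn, a, e, rfl⟩ := hh
  exact ⟨n, hn.trans hm, a, e, rfl⟩

theorem SylLe.mul_inA {h : FreeGroup (α ⊕ β)} {m : ℕ} (hh : SylLe h m) (v : FreeGroup α) :
    SylLe (h * inA α β v) m := by
  obtain ⟨n, hn, a, e, rfl⟩ := hh
  refine ⟨n, hn, Function.update a n (a n * v), e, ?_⟩
  have h1 : prodSyl (Function.update a n (a n * v)) e n = prodSyl a e n :=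
    prodSyl_congr (fun j hj => Function.update_of_ne (by omega : j ≠ n) _ _) (fun _ _ => rfl)
  rw [h1]
  simp [mul_assoc]

theorem SylLe.mul_lt {h : FreeGroup (α ⊕ β)} {m : ℕ} (hh : SylLe h m) (x : β × Bool) :
    SylLe (h * lt α x) (m + 1) := by
  obtain ⟨n, hn, a, e, rfl⟩ := hh
  refine ⟨n + 1, by omega, Function.update a (n + 1) 1, Function.update e n x, ?_⟩
  have h1 : prodSyl (Function.update a (n + 1) 1) (Function.update e n x) n = prodSyl a e n :=
    prodSyl_congr (fun j hj => Function.update_of_ne (by omega) _ _)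
      (fun j hj => Function.update_of_ne (by omega) _ _)
  rw [prodSyl, h1, Function.update_of_ne (by omega : n ≠ n + 1)]
  simp

theorem sylLe_one : SylLe (1 : FreeGroup (α ⊕ β)) 0 ∨ IsEmpty β := by
  rcases isEmpty_or_nonempty β with h | ⟨⟨y⟩⟩
  · exact Or.inr h
  · exact Or.inl ⟨0, le_rfl, fun _ => 1, fun _ => (y, true), by simp [prodSyl]⟩

end SyllableLength

section Turns

variable {α β : Type*}

/-- The letter through which the `j`-th syllable is entered. -/
def entry (e : ℕ → β × Bool) : ℕ → Option (β × Bool)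
  | 0 => none
  | j + 1 => some (flip (e j))

open scoped Classical in
/-- The letter through which the `j`-th syllable of a product with `n` letters is left. -/
noncomputable def exit (e : ℕ → β × Bool) (n j : ℕ) : Option (β × Bool) :=
  if j < n then some (e j) else none

variable (a : ℕ → FreeGroup α) (e : ℕ → β × Bool) (n : ℕ)

open scoped Classical in
/-- The number of letters that the `j`-th turn needs after a Whitehead move. -/
noncomputable def cost (S : Set (Option (β × Bool))) (l : Option (β × Bool) → FreeGroup α)
    (j : ℕ) : ℕ :=
  if entry e j ∈ S ∧ exit e n j ∈ S then
    if a j = (l (entry e j))⁻¹ * l (exit e n j) then 0 else 2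
  else if entry e j ∈ S ∨ exit e n j ∈ S then 1 else 0

open scoped Classical in
/-- The number of occurrences of `x` or its inverse. -/
noncomputable def occ (x : β × Bool) : ℕ :=
  ((Finset.range n).filter fun j => e j = x ∨ e j = flip x).card

/-- The number of letters of a product is minimal under automorphisms fixing the first factor. -/
def IsMinimal : Prop :=
  ∀ σ : FreeGroup (α ⊕ β) ≃* FreeGroup (α ⊕ β), (∀ v, σ (inA α β v) = inA α β v) →
    ∀ m, SylLe (σ (prodSyl a e n * inA α β (a n))) m → n ≤ m

variable {a e n}

open scoped Classical in
theorem IsMinimal.occ_le (hmin : IsMinimal a e n) {S : Set (Option (β × Bool))}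
    (l : Option (β × Bool) → FreeGroup α) (h0 : none ∉ S) {x : β × Bool} (hx : some x ∈ S)
    (hx' : some (flip x) ∉ S) : occ e n x ≤ ∑ j ∈ Finset.range (n + 1), cost a e n S l j := by
  let s : Option (β × Bool) → FreeGroup (α ⊕ β) := fun z =>
    if z ∈ S then inA α β ((l z)⁻¹ * l (some x)) * lt α x else 1
  have hxmem : lt α x ∈ Subgroup.closure (Set.range (inA α β) ∪
      {h | ∃ y, y = x.1 ∧ h = FreeGroup.of (Sum.inr y)}) := by
    have : FreeGroup.of (Sum.inr x.1) ∈ Subgroup.closure (Set.range (inA α β) ∪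
        {h | ∃ y, y = x.1 ∧ h = FreeGroup.of (Sum.inr y)}) :=
      Subgroup.subset_closure (Or.inr ⟨x.1, rfl, rfl⟩)
    rcases x with ⟨y, _ | _⟩
    · have h1 : lt α (y, false) = (FreeGroup.of (Sum.inr y))⁻¹ := by
        simp [lt, FreeGroup.of, FreeGroup.invRev]
      rw [h1]
      exact inv_mem this
    · exact this
  obtain ⟨σ, hσA, hσp, hσn⟩ := exists_letterwise_conj (· = x.1) (fun z => s (some z)) (by
    intro z
    simp only [s]
    split_ifs
    · exact mul_mem (Subgroup.subset_closure (Or.inl ⟨_, rfl⟩)) hxmem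
    · exact one_mem _)
  have hfst : ∀ z : β × Bool, z.1 = x.1 ↔ z = x ∨ z = flip x := by
    rintro ⟨y, b⟩
    rcases x with ⟨y', b'⟩
    simp only [flip, Prod.mk.injEq]
    cases b <;> cases b' <;> simp
  let m : β × Bool → FreeGroup (α ⊕ β) := fun z => if z.1 = x.1 then 1 else lt α z
  have hσ : ∀ z, σ (lt α z) = s (some z) * m z * (s (some (flip z)))⁻¹ := by
    intro z
    by_cases hz : z.1 = x.1
    · rw [hσp z hz]
      rcases (hfst z).1 hz with rfl | rfl
      · simp [m, s, hx, hx']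
      · simp only [m, s, hx, hx', flip_flip, hz, if_true, if_false, inv_mul_cancel, map_one,
          one_mul, lt_flip]
    · rw [hσn z hz]
      simp [m, hz]
  have hmid : ∀ (h : FreeGroup (α ⊕ β)) (N j : ℕ), SylLe h N →
      SylLe (h * ((s (entry e j))⁻¹ * inA α β (a j) * s (exit e n j)))
        (N + cost a e n S l j) := by
    intro h N j hh
    simp only [s, cost]
    by_cases hL : entry e j ∈ S <;> by_cases hR : exit e n j ∈ S
    · simp only [hL, hR, and_self, if_true]
      have : (inA α β ((l (entry e j))⁻¹ * l (some x)) * lt α x)⁻¹ * inA α β (a j) *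
          (inA α β ((l (exit e n j))⁻¹ * l (some x)) * lt α x) =
          lt α (flip x) * inA α β ((l (some x))⁻¹ * l (entry e j) * a j *
            (l (exit e n j))⁻¹ * l (some x)) * lt α x := by
        simp only [lt_flip, map_mul, map_inv, mul_inv_rev, mul_assoc, inv_inv]
      rw [this]
      split_ifs with hok
      · have h1 : (l (some x))⁻¹ * l (entry e j) * a j * (l (exit e n j))⁻¹ * l (some x) = 1 := by
          rw [hok]; group
        rw [h1, map_one, mul_one, lt_flip, inv_mul_cancel, mul_one]
        exact hh
      · rw [← mul_assoc, ← mul_assoc]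
        exact ((hh.mul_lt _).mul_inA _).mul_lt _
    · simp only [hL, hR, and_false, if_false, if_true, or_false, mul_one]
      have : h * ((inA α β ((l (entry e j))⁻¹ * l (some x)) * lt α x)⁻¹ * inA α β (a j)) =
          h * lt α (flip x) * inA α β (((l (entry e j))⁻¹ * l (some x))⁻¹ * a j) := by
        simp only [lt_flip, map_mul, map_inv, mul_inv_rev, mul_assoc, inv_inv]
      rw [this]
      exact (hh.mul_lt _).mul_inA _
    · simp only [hL, hR, false_and, if_false, if_true, or_true, inv_one, one_mul]
      have : h * (inA α β (a j) * (inA α β ((l (exit e n j))⁻¹ * l (some x)) * lt α x)) =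
          h * inA α β (a j * ((l (exit e n j))⁻¹ * l (some x))) * lt α x := by
        simp only [map_mul, mul_assoc]
      rw [this]
      exact (hh.mul_inA _).mul_lt _
    · simp only [hL, hR, false_and, if_false, or_false, inv_one, one_mul, mul_one, add_zero]
      exact hh.mul_inA _
  have hone : SylLe (1 : FreeGroup (α ⊕ β)) 0 :=
    sylLe_one.resolve_right fun h => h.elim x.1
  have hind : ∀ j ≤ n, SylLe (σ (prodSyl a e j) * s (entry e j))
      (∑ i ∈ Finset.range j, cost a e n S l i +
        ((Finset.range j).filter fun i => ¬ (e i = x ∨ e i = flip x)).card) := by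
    intro j
    induction j with
    | zero =>
      intro _
      simpa [prodSyl, entry, s, h0] using hone
    | succ j ih =>
      intro hj
      have h1 := hmid _ _ j (ih (by omega))
      have hexit : exit e n j = some (e j) := by simp [exit, show j < n by omega]
      have h2 : σ (prodSyl a e (j + 1)) * s (entry e (j + 1)) =
          σ (prodSyl a e j) * s (entry e j) *
            ((s (entry e j))⁻¹ * inA α β (a j) * s (exit e n j)) * m (e j) := by
        rw [prodSyl, map_mul, map_mul, hσA, hσ, hexit, entry]
        group
      rw [h2, Finset.sum_range_succ, Finset.range_add_one, Finset.filter_insert]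
      by_cases hxj : e j = x ∨ e j = flip x
      · have hm : m (e j) = 1 := by simp [m, (hfst _).2 hxj]
        rw [hm, mul_one]
        refine h1.mono ?_
        simp only [hxj, not_true_eq_false, if_false]
        omega
      · have hm : m (e j) = lt α (e j) := if_neg fun h => hxj ((hfst _).1 h)
        rw [hm]
        refine (h1.mul_lt _).mono ?_
        simp only [hxj, not_false_eq_true, if_true]
        rw [Finset.card_insert_of_notMem (by simp)]
        omega
  have hend := hmid _ _ n (hind n le_rfl)
  have hexit : exit e n n = none := by simp [exit]
  have hsn : s none = 1 := by simp [s, h0]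
  have h3 : σ (prodSyl a e n) * s (entry e n) *
      ((s (entry e n))⁻¹ * inA α β (a n) * s (exit e n n)) =
      σ (prodSyl a e n * inA α β (a n)) := by
    rw [map_mul, hσA, hexit, hsn]; group
  rw [h3] at hend
  have h4 := hmin σ hσA _ hend
  have h5 := Finset.card_filter_add_card_filter_not (s := Finset.range n)
    (fun i => e i = x ∨ e i = flip x)
  rw [Finset.card_range] at h5
  rw [Finset.sum_range_succ]
  unfold occ
  omega

theorem IsMinimal.eq_empty_of_cost (hmin : IsMinimal a e n)
    (hocc : ∀ x, ∃ j < n, e j = x ∨ e j = flip x) {S : Set (Option (β × Bool))}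
    (l : Option (β × Bool) → FreeGroup α) (h0 : none ∉ S)
    (hcost : ∀ j ≤ n, cost a e n S l j = 0) : S = ∅ := by
  classical
  by_contra hne
  obtain ⟨z, hz⟩ := Set.nonempty_iff_ne_empty.2 hne
  have hflip : ∀ x, some x ∈ S → some (flip x) ∈ S := by
    intro x hx
    by_contra hx'
    have h1 := hmin.occ_le l h0 hx hx'
    rw [Finset.sum_eq_zero fun j hj => hcost j (by simpa [Nat.lt_succ_iff] using hj)] at h1
    obtain ⟨j, hj, hjx⟩ := hocc x
    have : 0 < occ e n x := Finset.card_pos.2 ⟨j, by simp [hj, hjx]⟩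
    omega
  have hstep : ∀ j ≤ n, entry e j ∉ S → exit e n j ∉ S := by
    intro j hj hL hR
    have := hcost j hj
    simp [cost, hL, hR] at this
  have hall : ∀ j ≤ n, entry e j ∉ S := by
    intro j
    induction j with
    | zero => intro _; exact h0
    | succ j ih =>
      intro hj h
      apply hstep j (by omega) (ih (by omega))
      have := hflip _ h
      rw [flip_flip] at this
      simpa [exit, show j < n by omega] using this
  rcases z with _ | x
  · exact h0 hz
  · obtain ⟨j, hj, h | h⟩ := hocc x
    · apply hstep j hj.le (hall j hj.le)
      simpa [exit, hj, h] using hz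
    · apply hall (j + 1) (by omega)
      simpa [entry, h] using hz

open scoped Classical in
theorem IsMinimal.eq_empty_of_cut (hmin : IsMinimal a e n)
    (hocc : ∀ x, ∃ j < n, e j = x ∨ e j = flip x) {S : Set (Option (β × Bool))}
    (l : Option (β × Bool) → FreeGroup α) (h0 : none ∉ S) {y : β × Bool} (hy : some y ∉ S)
    (hLR : ∀ j ≤ n, entry e j ∈ S → (exit e n j ∈ S ∨ exit e n j = some y) ∧
      a j = (l (entry e j))⁻¹ * l (exit e n j))
    (hRL : ∀ j ≤ n, exit e n j ∈ S → (entry e j ∈ S ∨ entry e j = some y) ∧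
      a j = (l (entry e j))⁻¹ * l (exit e n j)) : S = ∅ := by
  set S' := insert (some y) S with hS'
  have h0' : none ∉ S' := by simp [hS', h0]
  have hle : ∀ j ≤ n, cost a e n S' l j + cost a e n S l j ≤
      (if entry e j = some y then 1 else 0) + (if exit e n j = some y then 1 else 0) := by
    intro j hj
    by_cases hL : entry e j ∈ S
    · obtain ⟨h1 | h1, h2⟩ := hLR j hj hL
      · simp [cost, hS', hL, h1, ← h2]
      · have h3 : exit e n j ∉ S := by rwa [h1]
        have h4 : exit e n j ∈ S' := by rw [h1]; exact Set.mem_insert _ _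
        have h5 : entry e j ∈ S' := Set.mem_insert_of_mem _ hL
        have h6 : cost a e n S' l j = 0 := by
          rw [cost, if_pos ⟨h5, h4⟩, if_pos h2]
        have h7 : cost a e n S l j = 1 := by
          rw [cost, if_neg (fun h => h3 h.2), if_pos (Or.inl hL)]
        rw [h6, h7, if_pos h1]
        omega
    · by_cases hR : exit e n j ∈ S
      · obtain ⟨h1 | h1, h2⟩ := hRL j hj hR
        · exact absurd h1 hL
        · have h4 : entry e j ∈ S' := by rw [h1]; exact Set.mem_insert _ _
          have h5 : exit e n j ∈ S' := Set.mem_insert_of_mem _ hR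
          have h6 : cost a e n S' l j = 0 := by
            rw [cost, if_pos ⟨h4, h5⟩, if_pos h2]
          have h7 : cost a e n S l j = 1 := by
            rw [cost, if_neg (fun h => hL h.1), if_pos (Or.inr hR)]
          rw [h6, h7, if_pos h1]
          omega
      · have h7 : cost a e n S l j = 0 := by
          rw [cost, if_neg (fun h => hL h.1), if_neg (by tauto)]
        have h8 : entry e j ∈ S' ↔ entry e j = some y := by simp [hS', hL]
        have h9 : exit e n j ∈ S' ↔ exit e n j = some y := by simp [hS', hR]
        rw [h7, cost]
        simp only [h8, h9]
        split_ifs <;> simp_all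
  have hsum : ∑ j ∈ Finset.range (n + 1), ((if entry e j = some y then 1 else 0) +
      (if exit e n j = some y then 1 else 0)) = occ e n y := by
    rw [Finset.sum_add_distrib, Finset.sum_range_succ', Finset.sum_range_succ _ n]
    have h1 : (if exit e n n = some y then 1 else 0) = 0 := by simp [exit]
    have h2 : (if entry e 0 = some y then 1 else 0) = 0 := by simp [entry]
    have h3 : ∀ j ∈ Finset.range n, (if exit e n j = some y then 1 else 0) =
        if e j = y then 1 else 0 := fun j hj => by simp [exit, Finset.mem_range.1 hj]
    have h4 : ∀ j ∈ Finset.range n, (if entry e (j + 1) = some y then 1 else 0) =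
        if e j = flip y then 1 else 0 := fun j hj => by
      have : flip (e j) = y ↔ e j = flip y :=
        ⟨fun h => by rw [← h, flip_flip], fun h => by rw [h, flip_flip]⟩
      simp [entry, this]
    rw [h1, h2, Finset.sum_congr rfl h3, Finset.sum_congr rfl h4, add_zero, add_zero,
      ← Finset.sum_add_distrib, occ, Finset.card_filter]
    refine Finset.sum_congr rfl fun j _ => ?_
    by_cases h5 : e j = y
    · simp [h5, (flip_ne y).symm]
    · simp [h5]
  have hle' : ∑ j ∈ Finset.range (n + 1), cost a e n S' l j +
      ∑ j ∈ Finset.range (n + 1), cost a e n S l j ≤ occ e n y := by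
    rw [← hsum, ← Finset.sum_add_distrib]
    exact Finset.sum_le_sum fun j hj => hle j (by simpa [Nat.lt_succ_iff] using hj)
  by_cases hfy : some (flip y) ∈ S
  · have h1 := hmin.occ_le l h0 hfy (by rwa [flip_flip])
    have h2 : occ e n (flip y) = occ e n y := by
      simp only [occ, flip_flip, or_comm]
    have h3 : ∑ j ∈ Finset.range (n + 1), cost a e n S' l j = 0 := by omega
    have h4 := hmin.eq_empty_of_cost hocc l h0' fun j hj =>
      Finset.sum_eq_zero_iff.1 h3 j (by simpa [Nat.lt_succ_iff] using hj)
    exact absurd h4 (Set.insert_nonempty _ _).ne_empty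
  · have h1 := hmin.occ_le (S := S') l h0' (Set.mem_insert _ _)
      (by simp [hS', hfy, flip_ne])
    have h3 : ∑ j ∈ Finset.range (n + 1), cost a e n S l j = 0 := by omega
    exact hmin.eq_empty_of_cost hocc l h0 fun j hj =>
      Finset.sum_eq_zero_iff.1 h3 j (by simpa [Nat.lt_succ_iff] using hj)

end Turns

end GradedAntipode

namespace GradedAntipode

section LinkGraph

variable {α β : Type*} (a : ℕ → FreeGroup α) (e : ℕ → β × Bool) (n : ℕ)

/-- Two vertices of the link of the first factor are adjacent if they are joined by a translate
of a turn of the product. -/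
def Adj (p q : FreeGroup α × Option (β × Bool)) : Prop :=
  ∃ j ≤ n, (p.2 = entry e j ∧ q.2 = exit e n j ∧ q.1 = p.1 * a j) ∨
    (q.2 = entry e j ∧ p.2 = exit e n j ∧ p.1 = q.1 * a j)

variable {a e n}

theorem Adj.symm {p q : FreeGroup α × Option (β × Bool)} (h : Adj a e n p q) :
    Adj a e n q p := by
  obtain ⟨j, hj, h⟩ := h
  exact ⟨j, hj, h.symm⟩

theorem Adj.mul_left {v v' : FreeGroup α} {z z' : Option (β × Bool)}
    (h : Adj a e n (v, z) (v', z')) (t : FreeGroup α) : Adj a e n (t * v, z) (t * v', z') := by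
  obtain ⟨j, hj, h⟩ := h
  refine ⟨j, hj, h.imp ?_ ?_⟩
  · rintro ⟨h1, h2, h3⟩
    exact ⟨h1, h2, by simp only at h3 ⊢; rw [h3, mul_assoc]⟩
  · rintro ⟨h1, h2, h3⟩
    exact ⟨h1, h2, by simp only at h3 ⊢; rw [h3, mul_assoc]⟩

theorem adj_turn (v : FreeGroup α) {j : ℕ} (hj : j ≤ n) :
    Adj a e n (v, entry e j) (v * a j, exit e n j) :=
  ⟨j, hj, Or.inl ⟨rfl, rfl, rfl⟩⟩

variable (a e n) in
/-- Two vertices are linked by a path all of whose vertices have allowed letters. -/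
def Linked (P : Option (β × Bool) → Prop) :
    FreeGroup α × Option (β × Bool) → FreeGroup α × Option (β × Bool) → Prop :=
  Relation.ReflTransGen fun p q => Adj a e n p q ∧ P p.2 ∧ P q.2

variable {P : Option (β × Bool) → Prop}

theorem Linked.symm {p q : FreeGroup α × Option (β × Bool)} (h : Linked a e n P p q) :
    Linked a e n P q p := by
  induction h with
  | refl => exact Relation.ReflTransGen.refl
  | tail _ h ih => exact Relation.ReflTransGen.head ⟨h.1.symm, h.2.2, h.2.1⟩ ih

theorem Linked.mul_left {v v' : FreeGroup α} {z z' : Option (β × Bool)}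
    (h : Linked a e n P (v, z) (v', z')) (t : FreeGroup α) :
    Linked a e n P (t * v, z) (t * v', z') := by
  have key : ∀ q, Linked a e n P (v, z) q → Linked a e n P (t * v, z) (t * q.1, q.2) := by
    intro q h
    induction h with
    | refl => exact Relation.ReflTransGen.refl
    | tail _ h ih => exact Relation.ReflTransGen.tail ih ⟨h.1.mul_left t, h.2⟩
  exact key _ h

theorem Adj.linked {p q : FreeGroup α × Option (β × Bool)} (h : Adj a e n p q) (hp : P p.2)
    (hq : P q.2) : Linked a e n P p q :=
  Relation.ReflTransGen.single ⟨h, hp, hq⟩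

theorem Linked.trans {p q r : FreeGroup α × Option (β × Bool)} (h : Linked a e n P p q)
    (h' : Linked a e n P q r) : Linked a e n P p r :=
  Relation.ReflTransGen.trans h h'

theorem eq_one_of_translates {X : Set (FreeGroup α)} (hX : X.Finite) {x t : FreeGroup α}
    (h : ∀ i : ℕ, x * t ^ i ∈ X) : t = 1 := by
  by_contra ht
  refine Set.infinite_of_injective_forall_mem (f := fun i : ℕ => x * t ^ i) ?_ h hX
  intro i j hij
  have := zpow_injective_of_ne_one ht (a₁ := (i : ℤ)) (a₂ := j) (by simpa using hij)
  exact_mod_cast this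

theorem eq_one_of_chain {X : Set (FreeGroup α)} (hX : X.Finite) (hne : X.Nonempty)
    {t : FreeGroup α} (h1 : ∀ x ∈ X, x * t ∈ X ∨ x * t = 1)
    (h2 : ∀ x ∈ X, x * t⁻¹ ∈ X ∨ x * t⁻¹ = 1) : t = 1 := by
  obtain ⟨x, hx⟩ := hne
  have key : ∀ s : FreeGroup α, (∀ x ∈ X, x * s ∈ X ∨ x * s = 1) →
      s = 1 ∨ ∃ i : ℕ, 0 < i ∧ x * s ^ i = 1 := by
    intro s hs
    by_cases hi : ∃ i : ℕ, 0 < i ∧ x * s ^ i = 1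
    · exact Or.inr hi
    · refine Or.inl (eq_one_of_translates hX (x := x) (t := s) fun i => ?_)
      induction i with
      | zero => simpa using hx
      | succ i ih =>
        rcases hs _ ih with h | h
        · rwa [pow_succ, ← mul_assoc]
        · exact absurd ⟨i + 1, by omega, by rw [pow_succ, ← mul_assoc, h]⟩ hi
  rcases key t h1 with h | ⟨i, hi, h⟩
  · exact h
  rcases key t⁻¹ h2 with h' | ⟨j, hj, h'⟩
  · simpa using h'
  have h3 : t ^ (i + j) = 1 := by
    rw [pow_add]
    have e1 : t ^ i = x⁻¹ := (inv_eq_of_mul_eq_one_right h).symm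
    have e2 : t ^ j = x := by rw [inv_pow, mul_inv_eq_one] at h'; exact h'.symm
    rw [e1, e2, inv_mul_cancel]
  by_contra ht
  have := zpow_injective_of_ne_one ht (a₁ := ((i + j : ℕ) : ℤ)) (a₂ := 0) (by
    simpa only [zpow_natCast, zpow_zero] using h3)
  omega

/-- A finite set of vertices cannot be closed under turns, except at one vertex. -/
theorem IsMinimal.not_finite_of_closed (hmin : IsMinimal a e n)
    (hocc : ∀ x, ∃ j < n, e j = x ∨ e j = flip x)
    {K : Set (FreeGroup α × Option (β × Bool))} (hK : K.Finite) (hne : K.Nonempty)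
    (hnone : ∀ v, (v, none) ∉ K) (f : Option (β × Bool)) (hf : (1, f) ∉ K)
    (hclosed : ∀ p ∈ K, ∀ q, Adj a e n p q → q ∈ K ∨ (q = (1, f) ∧ f ≠ none)) : False := by
  classical
  have hclosed' : ∀ p ∈ K, ∀ q, q.2 ≠ f → Adj a e n p q → q ∈ K := by
    intro p hp q hq h
    rcases hclosed p hp q h with h | ⟨rfl, _⟩
    · exact h
    · exact absurd rfl hq
  have hXfin : {x | (x, f) ∈ K}.Finite :=
    hK.preimage (f := fun x : FreeGroup α => (x, f)) (fun _ _ _ _ h => by simpa using h)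
  by_cases hall : ∀ p ∈ K, p.2 = f
  · obtain ⟨⟨v, z⟩, hv⟩ := hne
    obtain rfl : z = f := hall _ hv
    have hz : z ≠ none := fun h => hnone v (h ▸ hv)
    have hturn : ∀ j ≤ n, (entry e j = z ↔ exit e n j = z) ∧ (entry e j = z → a j = 1) := by
      intro j hj
      have h1 : entry e j = z → exit e n j = z := by
        intro h
        rcases hclosed _ hv _ (h ▸ adj_turn v hj) with h' | ⟨h', _⟩
        · exact hall _ h'
        · exact congrArg Prod.snd h'
      have h2 : exit e n j = z → entry e j = z := by
        intro h
        have : Adj a e n (v, z) (v * (a j)⁻¹, entry e j) := by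
          have := (adj_turn (a := a) (e := e) (v * (a j)⁻¹) hj).symm
          rwa [inv_mul_cancel_right, h] at this
        rcases hclosed _ hv _ this with h' | ⟨h', _⟩
        · exact hall _ h'
        · exact congrArg Prod.snd h'
      refine ⟨⟨h1, h2⟩, fun h => eq_one_of_chain hXfin ⟨v, hv⟩ ?_ ?_⟩
      · intro x hx
        have := adj_turn (a := a) (e := e) x hj
        rw [h, h1 h] at this
        rcases hclosed _ hx _ this with h' | ⟨h', _⟩
        · exact Or.inl h'
        · exact Or.inr (congrArg Prod.fst h')
      · intro x hx
        have := (adj_turn (a := a) (e := e) (x * (a j)⁻¹) hj).symm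
        rw [inv_mul_cancel_right, h, h1 h] at this
        rcases hclosed _ hx _ this with h' | ⟨h', _⟩
        · exact Or.inl h'
        · exact Or.inr (congrArg Prod.fst h')
    have := hmin.eq_empty_of_cost hocc (S := {z}) (fun _ => 1) (by simpa using hz.symm)
      fun j hj => by
        obtain ⟨h1, h2⟩ := hturn j hj
        by_cases h : entry e j = z
        · simp [cost, h, h1.1 h, h2 h]
        · have h' : exit e n j ≠ z := fun h' => h (h1.2 h')
          simp [cost, h, h']
    exact (Set.singleton_nonempty z).ne_empty this
  · push Not at hall
    obtain ⟨⟨v₀, z₀⟩, hp₀, hz₀⟩ := hall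
    have hLK : ∀ p q, p ∈ K → Linked a e n (· ≠ f) p q → q ∈ K := by
      intro p q hp h
      induction h with
      | refl => exact hp
      | tail _ h ih => exact hclosed' _ ih _ h.2.2 h.1
    have huniq : ∀ v v' z, Linked a e n (· ≠ f) (v₀, z₀) (v, z) →
        Linked a e n (· ≠ f) (v₀, z₀) (v', z) → v = v' := by
      intro v v' z h h'
      have h1 := (h.symm.trans h')
      have h2 : ∀ i : ℕ, (v * (v⁻¹ * v') ^ i, z) ∈ K := by
        intro i
        induction i with
        | zero => simpa using hLK _ _ hp₀ h
        | succ i ih =>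
          refine hLK _ _ ih ?_
          have := h1.mul_left (v * (v⁻¹ * v') ^ i * v⁻¹)
          simpa [pow_succ, mul_assoc] using this
      have h3 : {x | (x, z) ∈ K}.Finite :=
        hK.preimage (f := fun x : FreeGroup α => (x, z)) (fun _ _ _ _ h => by simpa using h)
      exact (inv_mul_eq_one.1 (eq_one_of_translates h3 h2))
    let R : Set (Option (β × Bool)) := {z | ∃ v, Linked a e n (· ≠ f) (v₀, z₀) (v, z)}
    have hRf : f ∉ R := by
      rintro ⟨v, h⟩
      rcases Relation.ReflTransGen.cases_tail h with h | ⟨_, _, h⟩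
      · exact hz₀ (congrArg Prod.snd h).symm
      · exact h.2.2 rfl
    have hRne : ∀ z ∈ R, z ≠ f := fun z hz h => hRf (h ▸ hz)
    choose! l hl using fun z (hz : z ∈ R) => hz
    have hadj : ∀ z ∈ R, ∀ v' z', z' ≠ f → Adj a e n (l z, z) (v', z') → z' ∈ R ∧ l z' = v' := by
      intro z hz v' z' hz' h
      have h1 := (hl z hz).trans (h.linked (hRne z hz) hz')
      have h2 : z' ∈ R := ⟨v', h1⟩
      exact ⟨h2, huniq _ _ _ (hl z' h2) h1⟩
    have hμ : ∀ z ∈ R, ∀ z' ∈ R, ∀ μ μ', Adj a e n (l z, z) (μ, f) →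
        Adj a e n (l z', z') (μ', f) → μ = μ' := by
      have hstep : ∀ z ∈ R, ∀ z' ∈ R, ∀ μ μ', Adj a e n (l z, z) (μ, f) →
          Adj a e n (l z', z') (μ', f) → ∀ x, (x, f) ∈ K →
          (x * (μ⁻¹ * μ'), f) ∈ K ∨ x * (μ⁻¹ * μ') = 1 := by
        intro z hz z' hz' μ μ' h h' x hx
        have h1 : Adj a e n (x, f) (x * μ⁻¹ * l z, z) := by
          simpa [mul_assoc] using (h.mul_left (x * μ⁻¹)).symm
        have h2 := hclosed' _ hx _ (hRne z hz) h1
        have h3 := hLK _ _ h2 (((hl z hz).symm.trans (hl z' hz')).mul_left (x * μ⁻¹))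
        have h4 := h'.mul_left (x * μ⁻¹)
        rw [mul_assoc x μ⁻¹ μ'] at h4
        rcases hclosed _ h3 _ h4 with h | ⟨h, _⟩
        · exact Or.inl h
        · exact Or.inr (congrArg Prod.fst h)
      intro z hz z' hz' μ μ' h h'
      by_contra hne
      have hX : ({x | (x, f) ∈ K} : Set _).Nonempty := by
        rcases hclosed _ (hLK _ _ hp₀ (hl z hz)) _ h with h1 | ⟨h1, _⟩
        · exact ⟨_, h1⟩
        rcases hclosed _ (hLK _ _ hp₀ (hl z' hz')) _ h' with h2 | ⟨h2, _⟩
        · exact ⟨_, h2⟩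
        exact absurd ((congrArg Prod.fst h1).trans (congrArg Prod.fst h2).symm) hne
      have := eq_one_of_chain hXfin hX (t := μ⁻¹ * μ')
        (fun x hx => hstep z hz z' hz' μ μ' h h' x hx) (fun x hx => by
          rw [mul_inv_rev, inv_inv]
          exact hstep z' hz' z hz μ' μ h' h x hx)
      exact hne (inv_mul_eq_one.1 this)
    obtain ⟨μ, hμ⟩ : ∃ μ, ∀ z ∈ R, ∀ μ', Adj a e n (l z, z) (μ', f) → μ' = μ := by
      by_cases hex : ∃ z ∈ R, ∃ μ, Adj a e n (l z, z) (μ, f)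
      · obtain ⟨z, hz, μ, h⟩ := hex
        exact ⟨μ, fun z' hz' μ' h' => hμ z' hz' z hz μ' μ h' h⟩
      · push Not at hex
        exact ⟨1, fun z hz μ' h => absurd h (hex z hz μ')⟩
    let l' : Option (β × Bool) → FreeGroup α := fun z => if z = f then μ else l z
    have hl' : ∀ z ∈ R, l' z = l z := fun z hz => if_neg (hRne z hz)
    have hadj' : ∀ z ∈ R, ∀ v' z', Adj a e n (l z, z) (v', z') →
        (z' ∈ R ∨ (z' = f ∧ f ≠ none)) ∧ v' = l' z' := by
      intro z hz v' z' h
      by_cases hz' : z' = f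
      · subst hz'
        have h1 : z' ≠ none := by
          rcases hclosed _ (hLK _ _ hp₀ (hl z hz)) _ h with h1 | ⟨_, h1⟩
          · rintro rfl; exact hnone _ h1
          · exact h1
        exact ⟨Or.inr ⟨rfl, h1⟩, by simp only [l', if_true]; exact hμ z hz _ h⟩
      · obtain ⟨h1, h2⟩ := hadj z hz _ _ hz' h
        exact ⟨Or.inl h1, by rw [hl' _ h1, h2]⟩
    have hLR : ∀ j ≤ n, entry e j ∈ R → (exit e n j ∈ R ∨ (exit e n j = f ∧ f ≠ none)) ∧
        a j = (l' (entry e j))⁻¹ * l' (exit e n j) := by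
      intro j hj h
      obtain ⟨h1, h2⟩ := hadj' _ h _ _ (adj_turn _ hj)
      exact ⟨h1, by rw [← h2, hl' _ h, inv_mul_cancel_left]⟩
    have hRL : ∀ j ≤ n, exit e n j ∈ R → (entry e j ∈ R ∨ (entry e j = f ∧ f ≠ none)) ∧
        a j = (l' (entry e j))⁻¹ * l' (exit e n j) := by
      intro j hj h
      have h0 : Adj a e n (l (exit e n j), exit e n j) (l (exit e n j) * (a j)⁻¹, entry e j) := by
        have := (adj_turn (a := a) (e := e) (l (exit e n j) * (a j)⁻¹) hj).symm
        rwa [inv_mul_cancel_right] at this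
      obtain ⟨h1, h2⟩ := hadj' _ h _ _ h0
      exact ⟨h1, by rw [← h2, hl' _ h, mul_inv_rev, inv_inv, inv_mul_cancel_right]⟩
    have hR0 : none ∉ R := fun h => hnone _ (hLK _ _ hp₀ (hl _ h))
    have hRempty : R = ∅ := by
      rcases f with _ | y
      · refine hmin.eq_empty_of_cost hocc l' hR0 fun j hj => ?_
        by_cases h : entry e j ∈ R
        · obtain ⟨h1 | h1, h2⟩ := hLR j hj h
          · simp [cost, h, h1, ← h2]
          · exact absurd rfl h1.2
        · by_cases h' : exit e n j ∈ R
          · obtain ⟨h1 | h1, h2⟩ := hRL j hj h'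
            · exact absurd h1 h
            · exact absurd rfl h1.2
          · simp [cost, h, h']
      · exact hmin.eq_empty_of_cut hocc l' hR0 hRf
          (fun j hj h => ⟨(hLR j hj h).1.imp_right And.left, (hLR j hj h).2⟩)
          (fun j hj h => ⟨(hRL j hj h).1.imp_right And.left, (hRL j hj h).2⟩)
    have : z₀ ∈ R := ⟨v₀, Relation.ReflTransGen.refl⟩
    rw [hRempty] at this
    exact this

/-- If the link graph has no holonomy, then the product is a product of letters alone, up to an
automorphism fixing the first factor. -/
theorem IsMinimal.exists_letters_of_linked (hmin : IsMinimal a e n)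
    (hocc : ∀ x, ∃ j < n, e j = x ∨ e j = flip x)
    (hhol : ∀ z b, Linked a e n (fun _ => True) (1, z) (b, z) → b = 1) :
    ∃ (σ : FreeGroup (α ⊕ β) ≃* FreeGroup (α ⊕ β)), (∀ v, σ (inA α β v) = inA α β v) ∧
      ∃ w : FreeGroup β, σ (FreeGroup.map Sum.inr w) = prodSyl a e n * inA α β (a n) := by
  classical
  let S : Setoid (Option (β × Bool)) :=
    { r := fun z z' => ∃ b, Linked a e n (fun _ => True) (1, z) (b, z')
      iseqv :=
        { refl := fun z => ⟨1, Relation.ReflTransGen.refl⟩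
          symm := by
            rintro z z' ⟨b, h⟩
            exact ⟨b⁻¹, by simpa using (h.mul_left b⁻¹).symm⟩
          trans := by
            rintro z z' z'' ⟨b, h⟩ ⟨b', h'⟩
            exact ⟨b * b', h.trans (by simpa using h'.mul_left b)⟩ } }
  let rep : Option (β × Bool) → Option (β × Bool) := fun z => (Quotient.mk S z).out
  have hrep : ∀ z, ∃ b, Linked a e n (fun _ => True) (1, rep z) (b, z) := fun z =>
    Quotient.mk_out (s := S) z
  choose l hl using hrep
  have hturn : ∀ j ≤ n, rep (entry e j) = rep (exit e n j) ∧
      a j = (l (entry e j))⁻¹ * l (exit e n j) := by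
    intro j hj
    have h0 : Linked a e n (fun _ => True) (l (entry e j), entry e j)
      (l (entry e j) * a j, exit e n j) := (adj_turn _ hj).linked trivial trivial
    have h1 : rep (entry e j) = rep (exit e n j) := by
      have : S.r (entry e j) (exit e n j) :=
        ⟨a j, by simpa using ((adj_turn (a := a) (e := e) 1 hj).linked (P := fun _ => True)
          trivial trivial)⟩
      exact congrArg Quotient.out (Quotient.sound (s := S) this)
    have h2 := (hl (entry e j)).trans h0
    have h3 := hl (exit e n j)
    rw [← h1] at h3
    have h5 := ((h3.symm.trans h2).mul_left (l (exit e n j))⁻¹)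
    rw [inv_mul_cancel] at h5
    have h6 := hhol _ _ h5
    refine ⟨h1, ?_⟩
    rw [inv_mul_eq_one] at h6
    rw [h6, inv_mul_cancel_left]
  have hrepnone : ∀ z, rep z = rep none := by
    have := hmin.eq_empty_of_cost hocc (S := {z | rep z ≠ rep none}) l (by simp) fun j hj => by
      obtain ⟨h1, h2⟩ := hturn j hj
      by_cases h : rep (entry e j) = rep none
      · have h' : rep (exit e n j) = rep none := h1 ▸ h
        simp [cost, h, h']
      · have h' : rep (exit e n j) ≠ rep none := h1 ▸ h
        rw [cost, if_pos ⟨h, h'⟩, if_pos h2]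
    intro z
    by_contra h
    have h' : z ∈ ({z | rep z ≠ rep none} : Set _) := h
    rw [this] at h'
    exact h'
  let s : β × Bool → FreeGroup (α ⊕ β) := fun z => inA α β ((l none)⁻¹ * l (some z))
  obtain ⟨σ, hσ, -, hσ'⟩ := exists_letterwise_conj (fun _ : β => False) s
    (fun z => Subgroup.subset_closure (Or.inl ⟨_, rfl⟩))
  refine ⟨σ, hσ, ?_⟩
  have hlt : ∀ x : β × Bool, ∃ w : FreeGroup β, FreeGroup.map Sum.inr w = lt α x := fun x =>
    ⟨FreeGroup.mk [x], by simp [lt]⟩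
  have hind : ∀ j ≤ n, ∃ w : FreeGroup β, σ (FreeGroup.map Sum.inr w) =
      prodSyl a e j * inA α β ((l (entry e j))⁻¹ * l none) := by
    intro j
    induction j with
    | zero =>
      intro _
      exact ⟨1, by simp [prodSyl, entry]⟩
    | succ j ih =>
      intro hj
      obtain ⟨w, hw⟩ := ih (by omega)
      obtain ⟨x, hx⟩ := hlt (e j)
      refine ⟨w * x, ?_⟩
      have hexit : exit e n j = some (e j) := by simp [exit, show j < n by omega]
      rw [map_mul, map_mul, hw, hx, hσ' _ not_false, prodSyl, (hturn j (by omega)).2, hexit, entry]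
      simp only [s, map_mul, map_inv, mul_inv_rev, inv_inv]
      group
  obtain ⟨w, hw⟩ := hind n le_rfl
  refine ⟨w, ?_⟩
  rw [hw, (hturn n le_rfl).2]
  simp [exit]

end LinkGraph

end GradedAntipode

namespace GradedAntipode

section Holonomy

variable {α β : Type*} {a : ℕ → FreeGroup α} {e : ℕ → β × Bool} {n : ℕ}

theorem exists_seq_of_linked {P : Option (β × Bool) → Prop}
    {p q : FreeGroup α × Option (β × Bool)} (h : Linked a e n P p q) :
    ∃ (m : ℕ) (s : ℕ → FreeGroup α × Option (β × Bool)), s 0 = p ∧ s m = q ∧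
      ∀ i < m, Adj a e n (s i) (s (i + 1)) := by
  induction h with
  | refl => exact ⟨0, fun _ => p, rfl, rfl, by simp⟩
  | @tail q r _ h ih =>
    obtain ⟨m, s, h0, hm, hs⟩ := ih
    refine ⟨m + 1, fun i => if i ≤ m then s i else r, by simpa using h0, by simp, fun i hi => ?_⟩
    rcases Nat.lt_succ_iff_lt_or_eq.1 hi with hi | rfl
    · simpa [show i ≤ m by omega, show i + 1 ≤ m by omega] using hs i hi
    · simpa [hm] using h.1

/-- A nontrivial holonomy element can be realized by a path which has any letter at most once,
hence whose translates along the corresponding axis avoid a given vertex up to one coset. -/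
theorem exists_line {z : Option (β × Bool)} {b : FreeGroup α} (hb : b ≠ 1)
    (h : Linked a e n (fun _ => True) (1, z) (b, z)) :
    ∃ (z : Option (β × Bool)) (b : FreeGroup α), b ≠ 1 ∧ ∀ f : Option (β × Bool), ∃ d₀ : FreeGroup α,
      ∀ {X : Type*} (κ : FreeGroup α × Option (β × Bool) → X),
        (∀ p q, Adj a e n p q → p ≠ (1, f) → q ≠ (1, f) → κ p = κ q) →
        ∀ d, (∀ i : ℤ, d ≠ d₀ * b ^ i) → ∀ k : ℕ, κ (d * b ^ k, z) = κ (d * (b ^ k)⁻¹, z) := by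
  classical
  have hex : ∃ m : ℕ, ∃ s : ℕ → FreeGroup α × Option (β × Bool), (s 0).2 = (s m).2 ∧
      (s 0).1 ≠ (s m).1 ∧ ∀ i < m, Adj a e n (s i) (s (i + 1)) := by
    obtain ⟨m, s, h0, hm, hs⟩ := exists_seq_of_linked h
    exact ⟨m, s, by rw [h0, hm], by rw [h0, hm]; exact hb.symm, hs⟩
  obtain ⟨s, hs2, hs1, hs⟩ := Nat.find_spec hex
  have hmin : ∀ m' < Nat.find hex, _ := fun m' h => Nat.find_min hex h
  generalize Nat.find hex = m at *
  have hdist : ∀ i j, i < j → j < m → (s i).2 ≠ (s j).2 := by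
    intro i j hij hj hz
    by_cases hv : (s i).1 = (s j).1
    · refine hmin (m - (j - i)) (by omega)
        ⟨fun k => if k ≤ i then s k else s (k + (j - i)), ?_, ?_, ?_⟩
      · simp only [Nat.zero_le, if_true, show ¬ m - (j - i) ≤ i by omega, if_false]
        rw [show m - (j - i) + (j - i) = m by omega]
        exact hs2
      · simp only [Nat.zero_le, if_true, show ¬ m - (j - i) ≤ i by omega, if_false]
        rw [show m - (j - i) + (j - i) = m by omega]
        exact hs1
      · intro k hk
        rcases lt_trichotomy k i with h | h | h
        · simpa [h.le, Nat.succ_le_of_lt h] using hs k (by omega)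
        · subst h
          simp only [le_refl, if_true, show ¬ k + 1 ≤ k by omega, if_false]
          rw [show k + 1 + (j - k) = j + 1 by omega, show s k = s j from Prod.ext hv hz]
          exact hs j hj
        · simp only [show ¬ k ≤ i by omega, show ¬ k + 1 ≤ i by omega, if_false]
          rw [show k + 1 + (j - i) = k + (j - i) + 1 by omega]
          exact hs _ (by omega)
    · refine hmin (j - i) (by omega) ⟨fun k => s (i + k), ?_, ?_, ?_⟩
      · simpa [show i + (j - i) = j by omega] using hz
      · simpa [show i + (j - i) = j by omega] using hv
      · intro k hk
        exact hs (i + k) (by omega)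
  have hm0 : 0 < m := by
    rcases Nat.eq_zero_or_pos m with rfl | h
    · exact absurd rfl hs1
    · exact h
  set v₀ := (s 0).1 with hv₀
  set b' := v₀⁻¹ * (s m).1 with hb'
  refine ⟨(s 0).2, b', fun h => hs1 (inv_mul_eq_one.1 h), fun f => ?_⟩
  obtain ⟨d₀, hd₀⟩ : ∃ d₀ : FreeGroup α, ∀ i < m, ∀ t : FreeGroup α,
      (t * v₀⁻¹ * (s i).1, (s i).2) = (1, f) → t = d₀ := by
    by_cases hi : ∃ i < m, (s i).2 = f
    · obtain ⟨i, hi, hif⟩ := hi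
      refine ⟨(v₀⁻¹ * (s i).1)⁻¹, fun j hj t ht => ?_⟩
      have hjf : (s j).2 = f := congrArg Prod.snd ht
      have hij : i = j := by
        rcases lt_trichotomy i j with h | h | h
        · exact absurd (hif.trans hjf.symm) (hdist i j h hj)
        · exact h
        · exact absurd (hjf.trans hif.symm) (hdist j i h hi)
      subst hij
      have := congrArg Prod.fst ht
      simp only at this
      rw [mul_assoc] at this
      exact eq_inv_of_mul_eq_one_left this
    · push Not at hi
      exact ⟨1, fun i h t ht => absurd (congrArg Prod.snd ht) (hi i h)⟩
  refine ⟨d₀, fun κ hκ d hd => ?_⟩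
  have havoid : ∀ k : ℤ, ∀ i ≤ m, (d * b' ^ k * v₀⁻¹ * (s i).1, (s i).2) ≠ (1, f) := by
    have h1 : ∀ k : ℤ, ∀ i < m, (d * b' ^ k * v₀⁻¹ * (s i).1, (s i).2) ≠ (1, f) := by
      intro k i hi h
      refine hd (-k) ?_
      rw [← hd₀ i hi _ h]
      simp
    intro k i hi
    rcases hi.lt_or_eq with hi | rfl
    · exact h1 k i hi
    · have := h1 (k + 1) 0 hm0
      rwa [zpow_add_one, ← mul_assoc, hb', ← hv₀, hs2, inv_mul_cancel_right, ← mul_assoc] at this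
  have hper : ∀ k : ℤ, κ (d * b' ^ k, (s 0).2) = κ (d * b' ^ (k + 1), (s 0).2) := by
    intro k
    have h1 : ∀ i ≤ m, κ (d * b' ^ k * v₀⁻¹ * (s 0).1, (s 0).2) =
        κ (d * b' ^ k * v₀⁻¹ * (s i).1, (s i).2) := by
      intro i
      induction i with
      | zero => intro _; rfl
      | succ i ih =>
        intro hi
        rw [ih (by omega)]
        exact hκ _ _ ((hs i (by omega)).mul_left _) (havoid k i (by omega)) (havoid k _ hi)
    have h2 := h1 m le_rfl
    rw [← hv₀, inv_mul_cancel_right, ← hs2] at h2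
    rw [h2, zpow_add_one, hb', ← mul_assoc, ← mul_assoc]
  have hconst : ∀ k : ℤ, κ (d * b' ^ k, (s 0).2) = κ (d * b' ^ (0 : ℤ), (s 0).2) := by
    intro k
    induction k using Int.induction_on with
    | zero => rfl
    | succ k ih => rw [← hper, ih]
    | pred k ih => rw [← ih, hper (-k - 1), sub_add_cancel]
  intro k
  have h1 := hconst k
  have h2 := hconst (-k)
  rw [zpow_natCast] at h1
  rw [zpow_neg, zpow_natCast] at h2
  rw [h1, h2]

end Holonomy

section Dichotomy

variable {ι β : Type*} {a : ℕ → FreeGroup (ι ⊕ Unit)} {e : ℕ → β × Bool} {n : ℕ}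

/-- The letter element of a vertex of the link. -/
def optLt (α : Type*) {β : Type*} : Option (β × Bool) → FreeGroup (α ⊕ β)
  | none => 1
  | some x => lt α x

/-- The values of an invariant function on the link of a translate of the first factor are
compatible with turns. -/
theorem turn_rule {α : Type*} {X : Type*} {a : ℕ → FreeGroup α}
    (hred : ∀ j, j + 1 < n → ¬ (a (j + 1) = 1 ∧ e (j + 1) = flip (e j)))
    {c : FreeGroup (α ⊕ β) → X} (hinv : ∀ h, c (h * (prodSyl a e n * inA α β (a n))) = c h)
    {g : FreeGroup (α ⊕ β)} {f : Option (β × Bool)}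
    (hbr : ∀ a e, ¬ (a = 1 ∧ some e = f) → ∀ h ∈ branch α e, ∀ h' ∈ branch α e,
        c (g * inA α β a * h) = c (g * inA α β a * h'))
    {j : ℕ} (hj : j ≤ n) (v : FreeGroup α) (h1 : (v, entry e j) ≠ (1, f) ∨ f = none)
    (h2 : (v * a j, exit e n j) ≠ (1, f) ∨ f = none) :
    c (g * inA α β v * optLt α (entry e j)) = c (g * inA α β (v * a j) * optLt α (exit e n j)) := by
  have hL : c (g * inA α β v * optLt α (entry e j)) = c (g * inA α β v * (prodSyl a e j)⁻¹) := by
    rcases j with _ | j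
    · simp [entry, optLt, prodSyl]
    · refine hbr v _ ?_ _ (lt_mem_branch _) _ (inv_prodSyl_mem_branch hred j (by omega))
      rintro ⟨rfl, rfl⟩
      simp [entry] at h1
  have hR : c (g * inA α β (v * a j) * optLt α (exit e n j)) =
      c (g * inA α β (v * a j) * ((inA α β (a j))⁻¹ * ((prodSyl a e j)⁻¹ *
        (prodSyl a e n * inA α β (a n))))) := by
    rcases hj.lt_or_eq with hj | rfl
    · have hx : exit e n j = some (e j) := by simp [exit, hj]
      rw [hx]
      refine hbr _ _ ?_ _ (lt_mem_branch _) _ ?_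
      · rintro ⟨h3, h4⟩
        rw [hx, h3, h4] at h2
        simp [← h4] at h2
      · have := prodSyl_suffix_mem_branch hred (n - 1 - j) j (by omega)
        rw [show j + (n - 1 - j) + 1 = n by omega, ← mul_inA_mem_branch (a n)] at this
        simpa only [mul_assoc] using this
    · simp [exit, optLt]
  rw [hL, hR, ← hinv (g * inA α β v * (prodSyl a e j)⁻¹)]
  congr 1
  simp only [map_mul]
  group

theorem turn_rule_adj {α : Type*} {X : Type*} {a : ℕ → FreeGroup α}
    (hred : ∀ j, j + 1 < n → ¬ (a (j + 1) = 1 ∧ e (j + 1) = flip (e j)))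
    {c : FreeGroup (α ⊕ β) → X} (hinv : ∀ h, c (h * (prodSyl a e n * inA α β (a n))) = c h)
    {g : FreeGroup (α ⊕ β)} {f : Option (β × Bool)}
    (hbr : ∀ a e, ¬ (a = 1 ∧ some e = f) → ∀ h ∈ branch α e, ∀ h' ∈ branch α e,
        c (g * inA α β a * h) = c (g * inA α β a * h'))
    (p q : FreeGroup α × Option (β × Bool)) (hpq : Adj a e n p q)
    (hp : p ≠ (1, f) ∨ f = none) (hq : q ≠ (1, f) ∨ f = none) :
    c (g * inA α β p.1 * optLt α p.2) = c (g * inA α β q.1 * optLt α q.2) := by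
  rcases p with ⟨v, L⟩
  rcases q with ⟨v', R⟩
  obtain ⟨j, hj, ⟨h1, h2, h3⟩ | ⟨h1, h2, h3⟩⟩ := hpq
  · simp only at h1 h2 h3
    subst h1 h2 h3
    exact turn_rule hred hinv hbr hj v hp hq
  · simp only at h1 h2 h3
    subst h1 h2 h3
    exact (turn_rule hred hinv hbr hj v' hq hp).symm

/-- The link of a translate of the first factor at which an invariant function is constant cannot
be extremal. -/
theorem IsMinimal.false_of_extremal {α : Type*} {X : Type*} {a : ℕ → FreeGroup α} [Finite β]
    (hmin : IsMinimal a e n) (hocc : ∀ x, ∃ j < n, e j = x ∨ e j = flip x)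
    (hred : ∀ j, j + 1 < n → ¬ (a (j + 1) = 1 ∧ e (j + 1) = flip (e j)))
    {c : FreeGroup (α ⊕ β) → X} (hc : FinCob c)
    (hcu : ∀ h, c (h * (prodSyl a e n * inA α β (a n))) = c h)
    {g : FreeGroup (α ⊕ β)} {f : Option (β × Bool)}
    (hx : ∃ h ∈ region g f, ∃ h' ∈ region g f, c h ≠ c h')
    (hbr : ∀ a e, ¬ (a = 1 ∧ some e = f) → ∀ h ∈ branch α e, ∀ h' ∈ branch α e,
        c (g * inA α β a * h) = c (g * inA α β a * h'))
    (hconst : ∀ v, c (g * inA α β v) = c g) : False := by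
  obtain ⟨x₁, hx₁, x₂, hx₂, hx⟩ := hx
  let κ : FreeGroup α × Option (β × Bool) → _ := fun p =>
    c (g * inA α β p.1 * optLt α p.2)
  have hκ : ∀ p q, Adj a e n p q → (p ≠ (1, f) ∨ f = none) → (q ≠ (1, f) ∨ f = none) →
      κ p = κ q := turn_rule_adj hred hcu hbr
  let K : Set (FreeGroup α × Option (β × Bool)) := {p | p ≠ (1, f) ∧ κ p ≠ c g}
  have hnone : ∀ v, κ (v, none) = c g := by
    intro v
    simpa only [κ, optLt, mul_one] using hconst v
  refine hmin.not_finite_of_closed hocc (K := K) ?_ ?_ ?_ f ?_ ?_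
  · have hfin := (finite_changes hc g).image fun p => (p.1, some p.2)
    refine hfin.subset ?_
    rintro ⟨v, _ | x⟩ ⟨_, h⟩
    · exact absurd (hnone v) h
    · refine ⟨(v, x), ?_, rfl⟩
      simp only [κ, optLt] at h
      rw [Set.mem_ofPred_eq, hconst]
      exact h
  · by_contra hK
    rw [Set.not_nonempty_iff_eq_empty] at hK
    have key : ∀ x ∈ region g f, c x = c g := by
      intro x hx
      rcases exists_inA_or_branch (g⁻¹ * x) with ⟨v, hv⟩ | ⟨v, y, hv⟩
      · rw [inv_mul_eq_iff_eq_mul] at hv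
        rw [hv, hconst]
      · have hvy : ¬ (v = 1 ∧ some y = f) := by
          rintro ⟨rfl, h⟩
          exact hx y h.symm (by simpa using hv)
        have h1 := hbr v y hvy _ hv _ (lt_mem_branch y)
        have h2 : g * inA α β v * ((inA α β v)⁻¹ * (g⁻¹ * x)) = x := by group
        rw [h2] at h1
        rw [h1]
        by_contra hcon
        have : (v, some y) ∈ K := ⟨fun h => hvy ⟨congrArg Prod.fst h, congrArg Prod.snd h⟩, hcon⟩
        rw [hK] at this
        exact this
    exact hx ((key _ hx₁).trans (key _ hx₂).symm)
  · exact fun v h => h.2 (hnone v)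
  · exact fun h => h.1 rfl
  · rintro p ⟨hp, hpc⟩ q hpq
    by_cases hq : q = (1, f)
    · subst hq
      by_cases hf : f = none
      · subst hf
        exact absurd ((hκ _ _ hpq (Or.inr rfl) (Or.inr rfl)).trans (hnone 1)) hpc
      · exact Or.inr ⟨rfl, hf⟩
    · refine Or.inl ⟨hq, ?_⟩
      rwa [← hκ _ _ hpq (Or.inl hp) (Or.inl hq)]

/-- Either the product involves letters alone up to an automorphism fixing the first factor,
or for some basis of the first factor all but one of its elements do not lie in a common proper
free factor with the product. -/
theorem IsMinimal.dichotomy [Finite ι] [Nonempty ι] [Finite β] (hmin : IsMinimal a e n)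
    (hocc : ∀ x, ∃ j < n, e j = x ∨ e j = flip x)
    (hred : ∀ j, j + 1 < n → ¬ (a (j + 1) = 1 ∧ e (j + 1) = flip (e j))) :
    (∃ (σ : FreeGroup ((ι ⊕ Unit) ⊕ β) ≃* FreeGroup ((ι ⊕ Unit) ⊕ β)),
      (∀ v, σ (inA (ι ⊕ Unit) β v) = inA (ι ⊕ Unit) β v) ∧
      ∃ w : FreeGroup β, σ (FreeGroup.map Sum.inr w) =
        prodSyl a e n * inA (ι ⊕ Unit) β (a n)) ∨
    ∃ ψ : FreeGroup (ι ⊕ Unit) ≃* FreeGroup (ι ⊕ Unit),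
      ∀ {X : Type*} (c : FreeGroup ((ι ⊕ Unit) ⊕ β) → X), FinCob c →
        (∀ h i, c (h * inA (ι ⊕ Unit) β (ψ (FreeGroup.of (Sum.inl i)))) = c h) →
        (∀ h, c (h * (prodSyl a e n * inA (ι ⊕ Unit) β (a n))) = c h) →
        ∀ h₁ h₂, c h₁ = c h₂ := by
  by_cases hhol : ∀ z b, Linked a e n (fun _ => True) (1, z) (b, z) → b = 1
  · exact Or.inl (hmin.exists_letters_of_linked hocc hhol)
  right
  push Not at hhol
  obtain ⟨z, b, h, hb⟩ := hhol
  obtain ⟨z, b, hb, hline⟩ := exists_line hb h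
  obtain ⟨ψ, hψ⟩ := exists_filling b hb
  refine ⟨ψ, fun c hc hcψ hcu h₁ h₂ => ?_⟩
  by_contra hne
  obtain ⟨g, f, hx, hbr, -, -⟩ := exists_extremal hc hne
  obtain ⟨d₀, hd₀⟩ := hline f
  let κ : FreeGroup (ι ⊕ Unit) × Option (β × Bool) → _ := fun p =>
    c (g * inA (ι ⊕ Unit) β p.1 * optLt (ι ⊕ Unit) p.2)
  have hκ : ∀ p q, Adj a e n p q → (p ≠ (1, f) ∨ f = none) → (q ≠ (1, f) ∨ f = none) →
      κ p = κ q := turn_rule_adj hred hcu hbr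
  have hconst : ∀ v, c (g * inA (ι ⊕ Unit) β v) = c g := by
    intro v
    have := hψ (fun v => c (g * inA (ι ⊕ Unit) β v)) ((hc.left g).comp inA_injective)
      (fun h i => by simpa only [map_mul, mul_assoc] using hcψ (g * inA (ι ⊕ Unit) β h) i) d₀
      (fun d hd => ?_) v 1
    · simpa using this
    · have h1 := hd₀ κ (fun p q h hp hq => hκ p q h (Or.inl hp) (Or.inl hq)) d hd
      rcases z with _ | z
      · exact ⟨0, fun k _ => by simpa only [κ, optLt, mul_one] using h1 k⟩
      · have hfin := finite_changes hc g
        have hfin' : {k : ℤ | c (g * inA (ι ⊕ Unit) β (d * b ^ k) * lt (ι ⊕ Unit) z) ≠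
            c (g * inA (ι ⊕ Unit) β (d * b ^ k))}.Finite := by
          refine hfin.preimage (f := fun k : ℤ => (d * b ^ k, z)) ?_
          intro k _ k' _ hk
          exact zpow_injective_of_ne_one hb (mul_left_cancel (congrArg Prod.fst hk))
        obtain ⟨M, hM⟩ := (hfin'.image Int.natAbs).bddAbove
        have hgood : ∀ k : ℤ, M < k.natAbs →
            c (g * inA (ι ⊕ Unit) β (d * b ^ k) * lt (ι ⊕ Unit) z) =
            c (g * inA (ι ⊕ Unit) β (d * b ^ k)) := by
          intro k hk
          by_contra hcon
          exact absurd (hM ⟨k, hcon, rfl⟩) (by omega)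
        refine ⟨M + 1, fun k hk => ?_⟩
        have g1 := hgood k (by simp; omega)
        have g2 := hgood (-k) (by simp; omega)
        have g3 := h1 k
        rw [zpow_natCast] at g1
        rw [zpow_neg, zpow_natCast] at g2
        simp only [κ, optLt] at g3
        rw [← g1, ← g2, g3]
  exact hmin.false_of_extremal hocc hred hc hcu hx hbr hconst

/-- If the first factor is trivial then only constant functions are invariant. -/
theorem IsMinimal.const_of_isEmpty {α : Type*} [IsEmpty α] {X : Type*} {a : ℕ → FreeGroup α}
    [Finite β] (hmin : IsMinimal a e n) (hocc : ∀ x, ∃ j < n, e j = x ∨ e j = flip x)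
    (hred : ∀ j, j + 1 < n → ¬ (a (j + 1) = 1 ∧ e (j + 1) = flip (e j)))
    {c : FreeGroup (α ⊕ β) → X} (hc : FinCob c)
    (hcu : ∀ h, c (h * (prodSyl a e n * inA α β (a n))) = c h) (h₁ h₂) : c h₁ = c h₂ := by
  by_contra hne
  obtain ⟨g, f, hx, hbr, -, -⟩ := exists_extremal hc hne
  refine hmin.false_of_extremal hocc hred hc hcu hx hbr fun v => ?_
  rw [Subsingleton.elim v 1, map_one, mul_one]

end Dichotomy

end GradedAntipode

namespace GradedAntipode

section SumCongr

variable {α α' β β' : Type*}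

/-- The isomorphism of free products induced by isomorphisms of the factors. -/
def sumCongr (f : FreeGroup α ≃* FreeGroup α') (g : FreeGroup β ≃* FreeGroup β') :
    FreeGroup (α ⊕ β) ≃* FreeGroup (α' ⊕ β') :=
  MonoidHom.toMulEquiv
    (FreeGroup.lift (Sum.elim (fun i => FreeGroup.map Sum.inl (f (FreeGroup.of i)))
      fun i => FreeGroup.map Sum.inr (g (FreeGroup.of i))))
    (FreeGroup.lift (Sum.elim (fun i => FreeGroup.map Sum.inl (f.symm (FreeGroup.of i)))
      fun i => FreeGroup.map Sum.inr (g.symm (FreeGroup.of i))))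
    (by
      have h1 : ∀ x, FreeGroup.lift (Sum.elim
          (fun i => FreeGroup.map (Sum.inl : α → α ⊕ β) (f.symm (FreeGroup.of i)))
          fun i => FreeGroup.map Sum.inr (g.symm (FreeGroup.of i))) (FreeGroup.map Sum.inl x) =
          FreeGroup.map Sum.inl (f.symm x) := fun x => DFunLike.congr_fun
        (show (FreeGroup.lift _).comp (FreeGroup.map Sum.inl) =
          (FreeGroup.map Sum.inl).comp f.symm.toMonoidHom by ext; simp) x
      have h2 : ∀ x, FreeGroup.lift (Sum.elim
          (fun i => FreeGroup.map (Sum.inl : α → α ⊕ β) (f.symm (FreeGroup.of i)))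
          fun i => FreeGroup.map Sum.inr (g.symm (FreeGroup.of i))) (FreeGroup.map Sum.inr x) =
          FreeGroup.map Sum.inr (g.symm x) := fun x => DFunLike.congr_fun
        (show (FreeGroup.lift _).comp (FreeGroup.map Sum.inr) =
          (FreeGroup.map Sum.inr).comp g.symm.toMonoidHom by ext; simp) x
      ext (i | i) <;> simp [h1, h2])
    (by
      have h1 : ∀ x, FreeGroup.lift (Sum.elim
          (fun i => FreeGroup.map (Sum.inl : α' → α' ⊕ β') (f (FreeGroup.of i)))
          fun i => FreeGroup.map Sum.inr (g (FreeGroup.of i))) (FreeGroup.map Sum.inl x) =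
          FreeGroup.map Sum.inl (f x) := fun x => DFunLike.congr_fun
        (show (FreeGroup.lift _).comp (FreeGroup.map Sum.inl) =
          (FreeGroup.map Sum.inl).comp f.toMonoidHom by ext; simp) x
      have h2 : ∀ x, FreeGroup.lift (Sum.elim
          (fun i => FreeGroup.map (Sum.inl : α' → α' ⊕ β') (f (FreeGroup.of i)))
          fun i => FreeGroup.map Sum.inr (g (FreeGroup.of i))) (FreeGroup.map Sum.inr x) =
          FreeGroup.map Sum.inr (g x) := fun x => DFunLike.congr_fun
        (show (FreeGroup.lift _).comp (FreeGroup.map Sum.inr) =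
          (FreeGroup.map Sum.inr).comp g.toMonoidHom by ext; simp) x
      ext (i | i) <;> simp [h1, h2])

variable (f : FreeGroup α ≃* FreeGroup α') (g : FreeGroup β ≃* FreeGroup β')

theorem sumCongr_map_inl (x : FreeGroup α) :
    sumCongr f g (FreeGroup.map Sum.inl x) = FreeGroup.map Sum.inl (f x) :=
  DFunLike.congr_fun (show (sumCongr f g).toMonoidHom.comp (FreeGroup.map Sum.inl) =
    (FreeGroup.map Sum.inl).comp f.toMonoidHom by ext; simp [sumCongr]) x

theorem sumCongr_of_inl (i : α) :
    sumCongr f g (FreeGroup.of (Sum.inl i)) = FreeGroup.map Sum.inl (f (FreeGroup.of i)) := by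
  simp [sumCongr]

theorem sumCongr_of_inr (i : β) :
    sumCongr f g (FreeGroup.of (Sum.inr i)) = FreeGroup.map Sum.inr (g (FreeGroup.of i)) := by
  simp [sumCongr]

theorem map_id_inA (φ : β → β') (v : FreeGroup α) :
    FreeGroup.map (Sum.map id φ) (inA α β v) = inA α β' v :=
  DFunLike.congr_fun (show (FreeGroup.map (Sum.map id φ)).comp (inA α β) = inA α β' by
    ext; simp [inA]) v

theorem map_prodSyl (φ : β → β') (a : ℕ → FreeGroup α) (e : ℕ → β × Bool) (n : ℕ) :
    FreeGroup.map (Sum.map id φ) (prodSyl a e n) =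
      prodSyl a (fun j => (φ (e j).1, (e j).2)) n := by
  induction n with
  | zero => simp [prodSyl]
  | succ n ih =>
    rw [prodSyl, prodSyl, map_mul, map_mul, ih, map_id_inA]
    simp [lt]

theorem sylLe_of_backtrack {a : ℕ → FreeGroup α} {e : ℕ → β × Bool} {j : ℕ}
    (ha : a (j + 1) = 1) (he : e (j + 1) = flip (e j)) (k : ℕ) :
    SylLe (prodSyl a e (j + 2 + k) * inA α β (a (j + 2 + k))) (j + k) := by
  have h0 : ∀ k, SylLe (prodSyl a e (j + 2 + k)) (j + k) := by
    intro k
    induction k with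
    | zero =>
      refine ⟨j, le_rfl, a, e, ?_⟩
      simp [prodSyl, ha, he, lt_flip]
    | succ k ih => exact (ih.mul_inA _).mul_lt _
  exact (h0 k).mul_inA _

end SumCongr

section Minimal

variable {α F : Type} [Group F]

/-- The element `u` is the product with the given data in a free factor. -/
structure Presents (w : α → F) (u : F) (β γ : Type) (Θ : FreeGroup ((α ⊕ β) ⊕ γ) ≃* F)
    (a : ℕ → FreeGroup α) (e : ℕ → β × Bool) (n : ℕ) : Prop where
  apply_inl : ∀ i, Θ (FreeGroup.of (Sum.inl (Sum.inl i))) = w i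
  apply_prod : Θ (FreeGroup.map Sum.inl (prodSyl a e n * inA α β (a n))) = u

theorem Presents.apply_inA {w : α → F} {u : F} {β γ : Type} {Θ : FreeGroup ((α ⊕ β) ⊕ γ) ≃* F}
    {a : ℕ → FreeGroup α} {e : ℕ → β × Bool} {n : ℕ} (h : Presents w u β γ Θ a e n)
    (v : FreeGroup α) : Θ (FreeGroup.map Sum.inl (inA α β v)) = FreeGroup.lift w v :=
  DFunLike.congr_fun (show (Θ.toMonoidHom.comp (FreeGroup.map Sum.inl)).comp (inA α β) =
    FreeGroup.lift w by ext i; simp [inA, h.apply_inl]) v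

theorem lift_mem_closure {ι G : Type*} [Group G] (w : ι → G) (v : FreeGroup ι) :
    FreeGroup.lift w v ∈ Subgroup.closure (Set.range w) := by
  rw [← FreeGroup.range_lift_eq_closure]
  exact ⟨v, rfl⟩

theorem basis_repr_symm {ι F : Type*} [Group F] (b : FreeGroupBasis ι F) (x : FreeGroup ι) :
    b.repr.symm x = FreeGroup.lift b x :=
  DFunLike.congr_fun (show b.repr.symm.toMonoidHom = FreeGroup.lift b by ext i; simp; rfl) x

theorem exists_minimal_presents {κ : Type} [Finite κ] (b : FreeGroupBasis (α ⊕ κ) F) (u : F)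
    (hu : u ∉ Subgroup.closure (Set.range fun i => b (Sum.inl i))) :
    ∃ (β γ : Type) (_ : Finite β) (_ : Nonempty β) (Θ : FreeGroup ((α ⊕ β) ⊕ γ) ≃* F)
      (a : ℕ → FreeGroup α) (e : ℕ → β × Bool) (n : ℕ),
      Presents (fun i => b (Sum.inl i)) u β γ Θ a e n ∧ IsMinimal a e n ∧
      (∀ x, ∃ j < n, e j = x ∨ e j = flip x) ∧
      ∀ j, j + 1 < n → ¬ (a (j + 1) = 1 ∧ e (j + 1) = flip (e j)) := by
  classical
  let Q : ℕ → ℕ → Prop := fun m n => ∃ (β γ : Type) (_ : Finite β) (_ : Nonempty β)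
    (Θ : FreeGroup ((α ⊕ β) ⊕ γ) ≃* F) (a : ℕ → FreeGroup α) (e : ℕ → β × Bool),
      Nat.card β = m ∧ Presents (fun i => b (Sum.inl i)) u β γ Θ a e n
  have hex : ∃ m, ∃ n, Q m n := by
    have hκ : Nonempty κ := by
      by_contra hκ
      rw [not_nonempty_iff] at hκ
      refine hu ?_
      have h1 := lift_mem_closure b (b.repr u)
      rw [← basis_repr_symm, MulEquiv.symm_apply_apply] at h1
      refine Subgroup.closure_mono ?_ h1
      rintro _ ⟨i | i, rfl⟩
      · exact ⟨i, rfl⟩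
      · exact hκ.elim i
    obtain ⟨n, a, e, v, h, -⟩ := exists_prodSyl (b.repr u).toWord
    rw [FreeGroup.mk_toWord] at h
    let E : (α ⊕ κ) ⊕ Empty ≃ α ⊕ κ := Equiv.sumEmpty _ _
    let Θ := (FreeGroup.freeGroupCongr E).trans b.repr.symm
    have hΘ : ∀ x, Θ (FreeGroup.map Sum.inl x) = b.repr.symm x := by
      intro x
      have : FreeGroup.map E (FreeGroup.map Sum.inl x) = x := by
        rw [FreeGroup.map.comp]
        exact FreeGroup.map.id x
      simp only [Θ, MulEquiv.trans_apply, FreeGroup.freeGroupCongr_apply, this]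
    refine ⟨Nat.card κ, n, κ, Empty, inferInstance, hκ, Θ, Function.update a n v, e, rfl, ?_, ?_⟩
    · intro i
      exact (hΘ (FreeGroup.of (Sum.inl i)) :)
    · rw [hΘ, Function.update_self, prodSyl_congr (a' := a) (e' := e)
        (fun j hj => Function.update_of_ne (by omega : j ≠ n) _ _) (fun _ _ => rfl), ← h,
        MulEquiv.symm_apply_apply]
  have hm := Nat.find_spec hex
  have hmin : ∀ m' < Nat.find hex, ∀ n, ¬ Q m' n := fun m' h n hQ => Nat.find_min hex h ⟨n, hQ⟩
  generalize Nat.find hex = m at hm hmin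
  have hn := Nat.find_spec hm
  have hnmin : ∀ n', Q m n' → Nat.find hm ≤ n' := fun n' h => Nat.find_min' hm h
  generalize Nat.find hm = n at hn hnmin
  obtain ⟨β, γ, hβ, hβ', Θ, a, e, hcard, hP⟩ := hn
  have hIM : IsMinimal a e n := by
    rintro σ hσ m' ⟨n', hn', a', e', h'⟩
    refine (hnmin n' ⟨β, γ, hβ, hβ', (sumCongr σ.symm (MulEquiv.refl _)).trans Θ, a', e', hcard,
      ?_, ?_⟩).trans hn'
    · intro i
      have h1 : σ.symm (FreeGroup.of (Sum.inl i)) = FreeGroup.of (Sum.inl i) := by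
        rw [MulEquiv.symm_apply_eq]
        have := hσ (FreeGroup.of i)
        simpa [inA] using this.symm
      rw [MulEquiv.trans_apply, sumCongr_of_inl, h1, FreeGroup.map.of, hP.apply_inl]
    · rw [MulEquiv.trans_apply, sumCongr_map_inl, ← h', MulEquiv.symm_apply_apply, hP.apply_prod]
  have hn0 : 0 < n := by
    by_contra hn0
    obtain rfl : n = 0 := by omega
    refine hu ?_
    rw [← hP.apply_prod, prodSyl, one_mul, hP.apply_inA]
    exact lift_mem_closure _ _
  refine ⟨β, γ, hβ, hβ', Θ, a, e, n, hP, hIM, ?_, ?_⟩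
  · intro x
    by_contra hx
    push Not at hx
    have hne : ∀ j < n, (e j).1 ≠ x.1 := by
      intro j hj h
      obtain ⟨h1, h2⟩ := hx j hj
      rcases x with ⟨y, s⟩
      rcases he : e j with ⟨y', s'⟩
      rw [he] at h h1 h2
      simp only at h
      subst h
      cases s <;> cases s' <;> simp [flip] at h1 h2
    let β' := {z : β // z ≠ x.1}
    have hβ'ne : Nonempty β' := ⟨⟨(e 0).1, hne 0 hn0⟩⟩
    let γ' := {z : β // ¬ z ≠ x.1} ⊕ γ
    let E : (α ⊕ β') ⊕ γ' ≃ (α ⊕ β) ⊕ γ :=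
      ((Equiv.sumAssoc (α ⊕ β') {z : β // ¬ z ≠ x.1} γ).symm.trans
        (Equiv.sumCongr (Equiv.sumAssoc α β' {z : β // ¬ z ≠ x.1}) (Equiv.refl γ))).trans
        (Equiv.sumCongr (Equiv.sumCongr (Equiv.refl α) (Equiv.sumCompl fun z => z ≠ x.1))
          (Equiv.refl γ))
    have hE : (E ∘ Sum.inl : α ⊕ β' → _) = Sum.inl ∘ Sum.map id Subtype.val := by
      funext i
      rcases i with i | i <;> rfl
    let e' : ℕ → β' × Bool := fun j =>
      if h : (e j).1 ≠ x.1 then (⟨(e j).1, h⟩, (e j).2) else (⟨(e 0).1, hne 0 hn0⟩, true)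
    have he' : ∀ j < n, (((e' j).1 : β), (e' j).2) = e j := by
      intro j hj
      simp only [e', dif_pos (hne j hj)]
    refine hmin (Nat.card β') (hcard ▸ Finite.card_subtype_lt (x := x.1) (by simp)) n
      ⟨β', γ', inferInstance, hβ'ne, (FreeGroup.freeGroupCongr E).trans Θ, a, e', rfl, ?_, ?_⟩
    · intro i
      rw [← hP.apply_inl i, MulEquiv.trans_apply, FreeGroup.freeGroupCongr_apply,
        FreeGroup.map.of]
      exact congrArg (fun y => Θ (FreeGroup.of y)) (congrFun hE (Sum.inl i))
    · rw [MulEquiv.trans_apply, FreeGroup.freeGroupCongr_apply, FreeGroup.map.comp, hE,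
        ← FreeGroup.map.comp, map_mul, map_prodSyl, map_id_inA,
        prodSyl_congr (fun _ _ => rfl) he', hP.apply_prod]
  · rintro j hj ⟨h1, h2⟩
    have h3 := sylLe_of_backtrack h1 h2 (n - (j + 2))
    rw [show j + 2 + (n - (j + 2)) = n by omega] at h3
    have h4 := hIM (MulEquiv.refl _) (fun _ => rfl) _ h3
    omega

end Minimal

end GradedAntipode

namespace GradedAntipode

/-- A family is a partial basis if it can be completed to a basis. -/
def IsPartialBasis {ι F : Type} [Group F] (w : ι → F) : Prop :=
  ∃ (κ : Type) (b : FreeGroupBasis (ι ⊕ κ) F), ∀ i, b (Sum.inl i) = w i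

theorem basis_symm_inA {α κ F : Type*} [Group F] (b : FreeGroupBasis (α ⊕ κ) F)
    (v : FreeGroup α) : b.repr.symm (inA α κ v) = FreeGroup.lift (fun i => b (Sum.inl i)) v :=
  DFunLike.congr_fun (show b.repr.symm.toMonoidHom.comp (inA α κ) =
    FreeGroup.lift fun i => b (Sum.inl i) by ext i; simp [inA]; rfl) v

theorem repr_mem_range_inA {α κ F : Type*} [Group F] (b : FreeGroupBasis (α ⊕ κ) F) {x : F}
    (hx : x ∈ Subgroup.closure (Set.range fun i => b (Sum.inl i))) :
    ∃ v, b.repr x = inA α κ v := by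
  rw [← FreeGroup.range_lift_eq_closure] at hx
  obtain ⟨v, rfl⟩ := hx
  exact ⟨v, by rw [← basis_symm_inA, MulEquiv.apply_symm_apply]⟩

/-- Invariant functions detect a free factor. -/
theorem mem_closure_of_forall_const {α κ F G : Type*} [Group F] [Group G]
    (b : FreeGroupBasis (α ⊕ κ) F) (Φ : G →* F) (hΦ : Function.Injective Φ)
    (hconst : ∀ c : G → Prop, FinCob c →
      (∀ s, Φ s ∈ Subgroup.closure (Set.range fun i => b (Sum.inl i)) → ∀ h, c (h * s) = c h) →
      ∀ h h', c h = c h') (h : G) :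
    Φ h ∈ Subgroup.closure (Set.range fun i => b (Sum.inl i)) := by
  rcases exists_inA_or_branch (b.repr (Φ h)) with ⟨v, hv⟩ | ⟨v, e, hv⟩
  · rw [← MulEquiv.eq_symm_apply, basis_symm_inA] at hv
    rw [hv]
    exact lift_mem_closure _ _
  · exfalso
    have hc := ((finCob_branch (α := α) (β := κ) e).left (inA α κ v)⁻¹).comp
      (f := b.repr.toMonoidHom.comp Φ) (b.repr.injective.comp hΦ)
    have h1 := hconst _ hc (fun s hs h => ?_) h 1
    · have h2 : (inA α κ v)⁻¹ * b.repr (Φ 1) ∈ branch α e := h1.mp hv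
      rw [map_one, map_one, mul_one, ← map_inv] at h2
      exact inA_notMem_branch _ _ h2
    · obtain ⟨v', hv'⟩ := repr_mem_range_inA b hs
      simp only [Function.comp_apply, MonoidHom.comp_apply, MulEquiv.toMonoidHom_eq_coe,
        MonoidHom.coe_coe, map_mul, hv', ← mul_assoc, mul_inA_mem_branch]

theorem card_le_of_mem_closure {X γ ι F : Type*} [Group F] [Finite X] [Finite ι]
    (Θ : FreeGroup (X ⊕ γ) ≃* F) (v : ι → F)
    (h : ∀ g, Θ (FreeGroup.map Sum.inl g) ∈ Subgroup.closure (Set.range v)) :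
    Nat.card X ≤ Nat.card ι := by
  classical
  let χ : (X → Multiplicative (ZMod 2)) → F →* Multiplicative (ZMod 2) := fun t =>
    (FreeGroup.lift (Sum.elim t fun _ => 1)).comp Θ.symm.toMonoidHom
  have hχ : ∀ t x, χ t (Θ (FreeGroup.of (Sum.inl x))) = t x := by
    intro t x
    simp [χ]
  have hinj : Function.Injective fun (t : X → Multiplicative (ZMod 2)) i => χ t (v i) := by
    intro t t' htt
    have h1 : Set.EqOn (χ t) (χ t') (Subgroup.closure (Set.range v)) := by
      apply MonoidHom.eqOn_closure
      rintro _ ⟨i, rfl⟩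
      exact congrFun htt i
    ext x
    have h2 := h1 (h (FreeGroup.of x))
    rw [FreeGroup.map.of, hχ, hχ] at h2
    rw [h2]
  have h1 := Nat.card_le_card_of_injective _ hinj
  have h2 : Nat.card (Multiplicative (ZMod 2)) = 2 := by
    rw [Nat.card_congr Multiplicative.toAdd, Nat.card_zmod]
  rw [Nat.card_fun, Nat.card_fun, h2] at h1
  exact (Nat.pow_le_pow_iff_right (by norm_num)).1 h1

theorem IsPrimitive.exists_basis {F : Type} [Group F] {u : F} (hu : IsPrimitive u) :
    ∃ (κ : Type) (b : FreeGroupBasis (Unit ⊕ κ) F), b (Sum.inl ()) = u := by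
  classical
  obtain ⟨ι, b, i, rfl⟩ := hu
  let E : {j // j = i} ⊕ {j // ¬ j = i} ≃ ι := Equiv.sumCompl fun j => j = i
  let E' : Unit ⊕ {j // ¬ j = i} ≃ ι :=
    (Equiv.sumCongr (Equiv.ofUnique Unit {j // j = i}) (Equiv.refl _)).trans E
  exact ⟨_, b.reindex E'.symm, rfl⟩

/-- An element of a free factor which is primitive in the whole group is primitive in the
factor. -/
theorem exists_equiv_of_isPrimitive {δ β F : Type} [Group F] [Finite β]
    (Θ₀ : FreeGroup (δ ⊕ β) ≃* F) (p : FreeGroup β)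
    (hp : IsPrimitive (Θ₀ (FreeGroup.map Sum.inr p))) :
    ∃ (γ : Type) (Θ : FreeGroup (Unit ⊕ γ) ≃* FreeGroup β), Θ (FreeGroup.of (Sum.inl ())) = p := by
  obtain ⟨κ, b, hb⟩ := hp.exists_basis
  have hp1 : p ≠ 1 := by
    rintro rfl
    have h1 := congrArg b.repr hb
    rw [FreeGroupBasis.repr_apply_coe, map_one, map_one, map_one] at h1
    exact FreeGroup.of_ne_one _ h1
  obtain ⟨β', γ, hβ', -, Θ, a, e, n, hP, hmin, hocc, hred⟩ := exists_minimal_presents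
    ((FreeGroupBasis.ofFreeGroup β).reindex (Equiv.emptySum Empty β).symm) p (by simpa [Set.range_eq_empty] using hp1)
  set u' := prodSyl a e n * inA Empty β' (a n) with hu'
  let Φ : FreeGroup (Empty ⊕ β') →* F := (Θ₀.toMonoidHom.comp (FreeGroup.map Sum.inr)).comp
    (Θ.toMonoidHom.comp (FreeGroup.map Sum.inl))
  have hΦ : Function.Injective Φ :=
    (Θ₀.injective.comp (FreeGroup.map_injective Sum.inr_injective)).comp
      (Θ.injective.comp (FreeGroup.map_injective Sum.inl_injective))
  have hΦu : Φ u' = b (Sum.inl ()) := by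
    have : Φ u' = Θ₀ (FreeGroup.map Sum.inr (Θ (FreeGroup.map Sum.inl u'))) := rfl
    rw [this, hP.apply_prod, hb]
  have hmem := mem_closure_of_forall_const b Φ hΦ fun c hc hinv =>
    hmin.const_of_isEmpty hocc hred hc (hinv u' (by
      rw [hΦu]; exact Subgroup.subset_closure ⟨(), rfl⟩))
  let f : FreeGroup Unit →* FreeGroup (Empty ⊕ β') := FreeGroup.lift fun _ => u'
  have hf : Φ.comp f = FreeGroup.lift fun i => b (Sum.inl i) := by
    ext i
    simpa [f] using hΦu
  have hfinj : Function.Injective f := by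
    have h1 : Function.Injective (Φ.comp f) := by
      rw [hf]
      intro x y hxy
      rw [← basis_symm_inA, ← basis_symm_inA] at hxy
      exact inA_injective (b.repr.symm.injective hxy)
    exact Function.Injective.of_comp (f := Φ) h1
  have hfsurj : Function.Surjective f := by
    intro h
    have h1 := hmem h
    rw [← FreeGroup.range_lift_eq_closure, ← hf] at h1
    obtain ⟨x, hx⟩ := h1
    exact ⟨x, hΦ hx⟩
  refine ⟨γ, (sumCongr (MulEquiv.ofBijective f ⟨hfinj, hfsurj⟩) (MulEquiv.refl _)).trans Θ, ?_⟩
  rw [MulEquiv.trans_apply, sumCongr_of_inl]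
  have h1 : f (FreeGroup.of ()) = u' := FreeGroup.lift_apply_of
  exact (congrArg (fun x => Θ (FreeGroup.map Sum.inl x)) h1).trans hP.apply_prod

/-- If the factor generated by a partial basis lies, after dropping one element of any of its
bases, in a free factor of the same rank together with a primitive element, then the
primitive element extends the partial basis. -/
theorem IsPartialBasis.extend {ι κ F : Type} [Group F] [Finite ι] [Nonempty ι] [Finite κ]
    (b : FreeGroupBasis ((ι ⊕ Unit) ⊕ κ) F) {u : F} (hu : IsPrimitive u)
    (hnot : u ∉ Subgroup.closure (Set.range fun i => b (Sum.inl i)))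
    (hyp : ∀ ψ : FreeGroup (ι ⊕ Unit) ≃* FreeGroup (ι ⊕ Unit), ∃ v : ι ⊕ Unit → F,
      IsPartialBasis v ∧
      (∀ i, FreeGroup.lift (fun i => b (Sum.inl i)) (ψ (FreeGroup.of (Sum.inl i))) ∈
        Subgroup.closure (Set.range v)) ∧ u ∈ Subgroup.closure (Set.range v)) :
    IsPartialBasis (Sum.elim (fun i => b (Sum.inl i)) fun _ : Unit => u) := by
  obtain ⟨β, γ, hβ, hβne, Θ, a, e, n, hP, hmin, hocc, hred⟩ := exists_minimal_presents b u hnot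
  rcases hmin.dichotomy hocc hred with ⟨σ, hσ, w, hw⟩ | ⟨ψ, hψ⟩
  · let Θ₁ := (sumCongr σ (MulEquiv.refl (FreeGroup γ))).trans Θ
    have hΘ₁ : ∀ x, Θ₁ (FreeGroup.map Sum.inl x) = Θ (FreeGroup.map Sum.inl (σ x)) := by
      intro x
      rw [MulEquiv.trans_apply, sumCongr_map_inl]
    let E : (γ ⊕ (ι ⊕ Unit)) ⊕ β ≃ ((ι ⊕ Unit) ⊕ β) ⊕ γ :=
      (Equiv.sumAssoc γ (ι ⊕ Unit) β).trans (Equiv.sumComm _ _)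
    have hE : (E ∘ Sum.inr : β → _) = Sum.inl ∘ Sum.inr := rfl
    obtain ⟨γ', Θ', hΘ'⟩ := exists_equiv_of_isPrimitive
      ((FreeGroup.freeGroupCongr E).trans Θ₁) w (by
        rw [MulEquiv.trans_apply, FreeGroup.freeGroupCongr_apply, FreeGroup.map.comp, hE,
          ← FreeGroup.map.comp, hΘ₁, hw, hP.apply_prod]
        exact hu)
    let E' : ((ι ⊕ Unit) ⊕ Unit) ⊕ (γ' ⊕ γ) ≃ ((ι ⊕ Unit) ⊕ (Unit ⊕ γ')) ⊕ γ :=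
      (Equiv.sumAssoc _ _ _).symm.trans (Equiv.sumCongr (Equiv.sumAssoc _ _ _) (Equiv.refl _))
    let Θ₂ : FreeGroup (((ι ⊕ Unit) ⊕ Unit) ⊕ (γ' ⊕ γ)) ≃* F :=
      ((FreeGroup.freeGroupCongr E').trans (sumCongr (sumCongr (MulEquiv.refl _) Θ')
        (MulEquiv.refl _))).trans Θ₁
    refine ⟨γ' ⊕ γ, FreeGroupBasis.ofRepr Θ₂.symm, ?_⟩
    have hb : ∀ i, FreeGroupBasis.ofRepr Θ₂.symm i = Θ₂ (FreeGroup.of i) := fun _ => rfl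
    have hval : ∀ i, Θ₂ (FreeGroup.of i) = Θ₁ (sumCongr (sumCongr (MulEquiv.refl _) Θ')
        (MulEquiv.refl _) (FreeGroup.of (E' i))) := by
      intro i
      simp [Θ₂]
    rintro (i | i)
    · rw [hb, hval]
      have : E' (Sum.inl (Sum.inl i)) = Sum.inl (Sum.inl i) := rfl
      rw [this, sumCongr_of_inl, hΘ₁, sumCongr_of_inl]
      have h2 := hσ (FreeGroup.of i)
      simp only [inA] at h2
      rw [MulEquiv.refl_apply, h2, FreeGroup.map.of, FreeGroup.map.of, hP.apply_inl]
      rfl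
    · rw [hb, hval]
      have : E' (Sum.inl (Sum.inr i)) = Sum.inl (Sum.inr (Sum.inl ())) := rfl
      rw [this, sumCongr_of_inl, hΘ₁, sumCongr_of_inr, hΘ', hw, hP.apply_prod]
      rfl
  · exfalso
    obtain ⟨v, ⟨κ', b', hb'⟩, hv, huv⟩ := hyp ψ
    obtain rfl : (fun i => b' (Sum.inl i)) = v := funext hb'
    let Φ : FreeGroup ((ι ⊕ Unit) ⊕ β) →* F := Θ.toMonoidHom.comp (FreeGroup.map Sum.inl)
    have hΦ : Function.Injective Φ :=
      Θ.injective.comp (FreeGroup.map_injective Sum.inl_injective)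
    have hmem := mem_closure_of_forall_const b' Φ hΦ fun c hc hinv =>
      hψ c hc (fun h i => hinv _ (by
        have : Φ (inA (ι ⊕ Unit) β (ψ (FreeGroup.of (Sum.inl i)))) =
          FreeGroup.lift (fun i => b (Sum.inl i)) (ψ (FreeGroup.of (Sum.inl i))) := hP.apply_inA _
        rw [this]
        exact hv i) h) (hinv _ (by
          have : Φ (prodSyl a e n * inA (ι ⊕ Unit) β (a n)) = u := hP.apply_prod
          rw [this]
          exact huv))
    have h1 := card_le_of_mem_closure Θ _ hmem
    rw [Nat.card_sum] at h1
    have h2 : 0 < Nat.card β := Nat.card_pos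
    omega

end GradedAntipode

namespace GradedAntipode

section PartialBasis

variable {ι ι' F F' : Type} [Group F] [Group F']

theorem IsPartialBasis.reindex {w : ι → F} (hw : IsPartialBasis w) (e : ι' ≃ ι) :
    IsPartialBasis fun i => w (e i) := by
  obtain ⟨κ, b, hb⟩ := hw
  exact ⟨κ, b.reindex (Equiv.sumCongr e (Equiv.refl κ)).symm, fun i => hb (e i)⟩

theorem IsPartialBasis.map {w : ι → F} (hw : IsPartialBasis w) (φ : F ≃* F') :
    IsPartialBasis fun i => φ (w i) := by
  obtain ⟨κ, b, hb⟩ := hw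
  exact ⟨κ, b.map φ, fun i => by rw [FreeGroupBasis.map_apply, hb]⟩

theorem IsPartialBasis.restrict {w : ι ⊕ ι' → F} (hw : IsPartialBasis w) :
    IsPartialBasis fun i => w (Sum.inl i) := by
  obtain ⟨κ, b, hb⟩ := hw
  exact ⟨ι' ⊕ κ, b.reindex (Equiv.sumAssoc _ _ _), fun i => hb (Sum.inl i)⟩

/-- A partial basis of the factor generated by a partial basis is a partial basis. -/
theorem IsPartialBasis.trans {w : ι → F} (hw : IsPartialBasis w) {v : ι' → FreeGroup ι}
    (hv : IsPartialBasis v) : IsPartialBasis fun i => FreeGroup.lift w (v i) := by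
  obtain ⟨κ, b, hb⟩ := hw
  obtain ⟨κ', b', hb'⟩ := hv
  obtain rfl : (fun i => b (Sum.inl i)) = w := funext hb
  let Θ : FreeGroup ((ι' ⊕ κ') ⊕ κ) ≃* F :=
    (sumCongr b'.repr.symm (MulEquiv.refl _)).trans b.repr.symm
  refine ⟨κ' ⊕ κ, (FreeGroupBasis.ofRepr Θ.symm).reindex (Equiv.sumAssoc _ _ _), fun i => ?_⟩
  have h1 : (FreeGroupBasis.ofRepr Θ.symm).reindex (Equiv.sumAssoc _ _ _) (Sum.inl i) =
      Θ (FreeGroup.of (Sum.inl (Sum.inl i))) := rfl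
  simp only [h1, Θ, MulEquiv.trans_apply, sumCongr_of_inl, ← hb' i, ← basis_symm_inA]
  rfl

theorem IsPartialBasis.isPrimitive {w : ι → F} (hw : IsPartialBasis w) (i : ι) :
    IsPrimitive (w i) := by
  obtain ⟨κ, b, hb⟩ := hw
  exact ⟨_, b, _, hb i⟩

theorem exists_equiv_extending {f : ι → ι'} (hf : Function.Injective f) :
    ∃ (κ : Type) (e : ι ⊕ κ ≃ ι'), ∀ i, e (Sum.inl i) = f i := by
  classical
  exact ⟨_, (Equiv.sumCongr (Equiv.ofInjective f hf) (Equiv.refl _)).trans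
    (Equiv.Set.sumCompl (Set.range f)), fun i => rfl⟩

/-- A subfamily of a basis is a partial basis. -/
theorem isPartialBasis_of_injective (b : FreeGroupBasis ι' F) {f : ι → ι'}
    (hf : Function.Injective f) : IsPartialBasis fun i => b (f i) := by
  obtain ⟨κ, e, he⟩ := exists_equiv_extending hf
  exact ⟨κ, b.reindex e.symm, fun i => by rw [FreeGroupBasis.reindex_apply, e.symm_symm, he]⟩

theorem finite_of_basis {κ : Type} [Finite ι'] (b : FreeGroupBasis ι' F)
    (b' : FreeGroupBasis κ F) : Finite κ :=
  Finite.of_equiv _ (Equiv.ofFreeGroupEquiv (b.repr.symm.trans b'.repr))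

/-- Two partial bases indexed by the same set are exchanged by an automorphism. -/
theorem exists_aut_of_isPartialBasis [Finite ι'] (b₀ : FreeGroupBasis ι' F) {w w' : ι → F}
    (hw : IsPartialBasis w) (hw' : IsPartialBasis w') : ∃ φ : F ≃* F, ∀ i, φ (w i) = w' i := by
  obtain ⟨κ, b, hb⟩ := hw
  obtain ⟨κ', b', hb'⟩ := hw'
  have h1 := finite_of_basis b₀ b
  have h2 := finite_of_basis b₀ b'
  have h3 : Finite ι := Finite.of_injective (Sum.inl : ι → ι ⊕ κ) Sum.inl_injective
  have h4 : Finite κ := Finite.of_injective (Sum.inr : κ → ι ⊕ κ) Sum.inr_injective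
  have h5 : Finite κ' := Finite.of_injective (Sum.inr : κ' → ι ⊕ κ') Sum.inr_injective
  have h6 := Nat.card_congr (Equiv.ofFreeGroupEquiv (b.repr.symm.trans b'.repr))
  rw [Nat.card_sum, Nat.card_sum, add_left_cancel_iff] at h6
  let e : κ ≃ κ' := (Finite.card_eq.1 h6).some
  refine ⟨(b.repr.trans (FreeGroup.freeGroupCongr (Equiv.sumCongr (Equiv.refl ι) e))).trans
    b'.repr.symm, fun i => ?_⟩
  rw [← hb, ← hb', MulEquiv.trans_apply, MulEquiv.trans_apply, FreeGroupBasis.repr_apply_coe]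
  simp
  rfl

end PartialBasis

section FreeFactor

variable {α κ F : Type} [Group F]

/-- The free product of two subgroups with given bases. -/
def coprodEquiv {H K : Subgroup F} (bH : FreeGroupBasis α H) (bK : FreeGroupBasis κ K) :
    FreeGroup (α ⊕ κ) ≃* Monoid.Coprod H K :=
  MonoidHom.toMulEquiv
    (FreeGroup.lift (Sum.elim (fun i => Monoid.Coprod.inl (bH i)) fun i =>
      Monoid.Coprod.inr (bK i)))
    (Monoid.Coprod.lift ((FreeGroup.map Sum.inl).comp bH.repr.toMonoidHom)
      ((FreeGroup.map Sum.inr).comp bK.repr.toMonoidHom))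
    (by ext (i | i) <;> simp)
    (by
      ext1
      · exact bH.ext_hom _ _ fun i => by simp
      · exact bK.ext_hom _ _ fun i => by simp)

theorem lift_coprodEquiv {H K : Subgroup F} (bH : FreeGroupBasis α H) (bK : FreeGroupBasis κ K)
    (x : FreeGroup (α ⊕ κ)) : Monoid.Coprod.lift H.subtype K.subtype (coprodEquiv bH bK x) =
      FreeGroup.lift (Sum.elim (fun i => (bH i : F)) fun i => (bK i : F)) x :=
  DFunLike.congr_fun (show (Monoid.Coprod.lift H.subtype K.subtype).comp
      (coprodEquiv bH bK).toMonoidHom =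
      FreeGroup.lift (Sum.elim (fun i => (bH i : F)) fun i => (bK i : F)) by
    ext (i | i) <;> simp [coprodEquiv]) x

theorem closure_coe_basis {H : Subgroup F} (b : FreeGroupBasis α H) :
    Subgroup.closure (Set.range fun i => (b i : F)) = H := by
  rw [← FreeGroup.range_lift_eq_closure]
  have h1 : (FreeGroup.lift fun i => (b i : F)) = H.subtype.comp b.repr.symm.toMonoidHom := by
    ext i; simp; rfl
  rw [h1]
  ext y
  constructor
  · rintro ⟨x, rfl⟩
    exact (b.repr.symm x).2
  · intro hy
    exact ⟨b.repr ⟨y, hy⟩, by simp⟩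

/-- A free factor of given rank of a free group is generated by a partial basis. -/
theorem IsFreeFactorOfRank.exists_isPartialBasis [IsFreeGroup F] {r : ℕ} {H : Subgroup F}
    (hH : IsFreeFactorOfRank r H) :
    ∃ v : Fin r → F, IsPartialBasis v ∧ Subgroup.closure (Set.range v) = H := by
  obtain ⟨⟨K, hK⟩, ⟨bH⟩⟩ := hH
  let bK := IsFreeGroup.basis K
  let Θ := (coprodEquiv bH bK).trans (MulEquiv.ofBijective _ hK)
  refine ⟨fun i => bH i, ⟨_, FreeGroupBasis.ofRepr Θ.symm, fun i => ?_⟩, closure_coe_basis bH⟩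
  have h1 : FreeGroupBasis.ofRepr Θ.symm (Sum.inl i) = Θ (FreeGroup.of (Sum.inl i)) := rfl
  rw [h1]
  exact (lift_coprodEquiv bH bK (FreeGroup.of (Sum.inl i))).trans FreeGroup.lift_apply_of

/-- A basis of the subgroup generated by a subfamily of a basis. -/
theorem exists_basis_closure {ι : Type} (b : FreeGroupBasis ι F) {f : α → ι}
    (hf : Function.Injective f) :
    ∃ b' : FreeGroupBasis α (Subgroup.closure (Set.range fun i => b (f i))),
      ∀ i, (b' i : F) = b (f i) := by
  have h1 : FreeGroup.lift (fun i => b (f i)) =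
      b.repr.symm.toMonoidHom.comp (FreeGroup.map f) := by
    ext i; rw [FreeGroup.lift_apply_of]; rfl
  have hinj : Function.Injective (FreeGroup.lift fun i => b (f i)) := by
    rw [h1]
    exact b.repr.symm.injective.comp (FreeGroup.map_injective hf)
  let Θ := (MonoidHom.ofInjective hinj).trans
    (MulEquiv.subgroupCongr (FreeGroup.range_lift_eq_closure (f := fun i => b (f i))))
  refine ⟨FreeGroupBasis.ofRepr Θ.symm, fun i => ?_⟩
  have h2 : FreeGroupBasis.ofRepr Θ.symm i = Θ (FreeGroup.of i) := rfl
  rw [h2]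
  exact FreeGroup.lift_apply_of

/-- A partial basis generates a free factor. -/
theorem IsPartialBasis.isFreeFactorOfRank {r : ℕ} {v : Fin r → F} (hv : IsPartialBasis v) :
    IsFreeFactorOfRank r (Subgroup.closure (Set.range v)) := by
  obtain ⟨κ, b, hb⟩ := hv
  obtain rfl : (fun i => b (Sum.inl i)) = v := funext hb
  obtain ⟨bH, hbH⟩ := exists_basis_closure b (f := (Sum.inl : Fin r → Fin r ⊕ κ))
    Sum.inl_injective
  obtain ⟨bK, hbK⟩ := exists_basis_closure b (f := (Sum.inr : κ → Fin r ⊕ κ)) Sum.inr_injective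
  refine ⟨⟨Subgroup.closure (Set.range fun i => b (Sum.inr i)), ?_⟩, ⟨bH⟩⟩
  · have h1 : ∀ x, Monoid.Coprod.lift (Subgroup.subtype _) (Subgroup.subtype _)
        (coprodEquiv bH bK x) = b.repr.symm x := by
      intro x
      rw [lift_coprodEquiv, basis_repr_symm]
      congr 2
      ext (i | i)
      · exact hbH i
      · exact hbK i
    have h2 := (b.repr.symm.bijective.comp (coprodEquiv bH bK).symm.bijective)
    convert h2 using 1
    ext y
    rw [Function.comp_apply, ← h1, MulEquiv.apply_symm_apply]

end FreeFactor

section Induction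

variable {F : Type} [Group F] {N k : ℕ}

/-- Partial bases of a proper free factor extend by a primitive element outside the factor, if
any two primitive elements of which one is in the factor lie in a free factor of rank two. -/
theorem isPartialBasis_extend_of_pairs (x : FreeGroupBasis (Fin N) F) {y : Fin k → F}
    (hy : IsPartialBasis y) {u : F} (hu : IsPrimitive u)
    (hnot : u ∉ Subgroup.closure (Set.range y))
    (hpair : ∀ p, IsPrimitive p → p ∈ Subgroup.closure (Set.range y) →
      ∃ v : Fin 2 → F, IsPartialBasis v ∧ p ∈ Subgroup.closure (Set.range v) ∧
        u ∈ Subgroup.closure (Set.range v)) (r : ℕ)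
    (w : Fin (r + 2) → FreeGroup (Fin k)) (hw : IsPartialBasis w) :
    IsPartialBasis (Sum.elim (fun i => FreeGroup.lift y (w i)) fun _ : Unit => u) := by
  have step : ∀ r : ℕ, (∀ w : Fin (r + 1) → FreeGroup (Fin k), IsPartialBasis w →
      ∃ v : Fin (r + 1) ⊕ Unit → F, IsPartialBasis v ∧
        (∀ i, FreeGroup.lift y (w i) ∈ Subgroup.closure (Set.range v)) ∧
        u ∈ Subgroup.closure (Set.range v)) →
      ∀ w : Fin (r + 2) → FreeGroup (Fin k), IsPartialBasis w →
        IsPartialBasis (Sum.elim (fun i => FreeGroup.lift y (w i)) fun _ : Unit => u) := by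
    intro r ih w hw
    let E : Fin (r + 1) ⊕ Unit ≃ Fin (r + 2) :=
      (Equiv.sumCongr (Equiv.refl _) (Equiv.ofUnique Unit (Fin 1))).trans finSumFinEquiv
    have hwE := hw.reindex E
    obtain ⟨κ, b, hb⟩ := hy.trans hwE
    have hfin : Finite κ := by
      have := finite_of_basis x b
      exact Finite.of_injective (Sum.inr : κ → (Fin (r + 1) ⊕ Unit) ⊕ κ) Sum.inr_injective
    have hlift : ∀ v, FreeGroup.lift (fun i => b (Sum.inl i)) v =
        FreeGroup.lift y (FreeGroup.lift (fun i => w (E i)) v) := fun v =>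
      DFunLike.congr_fun (show FreeGroup.lift (fun i => b (Sum.inl i)) =
        (FreeGroup.lift y).comp (FreeGroup.lift fun i => w (E i)) by ext i; simp [hb]) v
    have h1 := IsPartialBasis.extend b hu (fun h => hnot ?_) fun ψ => ?_
    · have h2 := h1.reindex (Equiv.sumCongr E.symm (Equiv.refl Unit))
      convert h2 using 1
      ext (i | i)
      · simp [hb]
      · rfl
    · refine (Subgroup.closure_le _).2 ?_ h
      rintro _ ⟨i, rfl⟩
      simp only [hb]
      exact lift_mem_closure _ _
    · have h3 : IsPartialBasis fun i : Fin (r + 1) =>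
          FreeGroup.lift (fun i => w (E i)) (ψ (FreeGroup.of (Sum.inl i))) :=
        hwE.trans (((isPartialBasis_of_injective (FreeGroupBasis.ofFreeGroup _)
          Sum.inl_injective).map ψ))
      obtain ⟨v, hv, hv1, hv2⟩ := ih _ h3
      exact ⟨v, hv, fun i => by rw [hlift]; exact hv1 i, hv2⟩
  induction r with
  | zero =>
    refine step 0 (fun w hw => ?_) w hw
    obtain ⟨v, hv, hp, hu'⟩ := hpair (FreeGroup.lift y (w 0)) ((hy.trans hw).isPrimitive 0)
      (lift_mem_closure _ _)
    let E : Fin 1 ⊕ Unit ≃ Fin 2 :=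
      (Equiv.sumCongr (Equiv.refl _) (Equiv.ofUnique Unit (Fin 1))).trans finSumFinEquiv
    have hr : Set.range (fun i => v (E i)) = Set.range v := E.surjective.range_comp v
    refine ⟨fun i => v (E i), hv.reindex E, fun i => ?_, by rwa [hr]⟩
    rw [hr, show i = 0 from Fin.ext (by omega)]
    exact hp
  | succ r ih =>
    refine step (r + 1) (fun w hw => ?_) w hw
    refine ⟨_, ih w hw, fun i => ?_, ?_⟩
    · exact Subgroup.subset_closure ⟨Sum.inl i, rfl⟩
    · exact Subgroup.subset_closure ⟨Sum.inr (), rfl⟩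

end Induction

end GradedAntipode

namespace GradedAntipode

section Main

variable {N k : ℕ}

/-- The first elements of a basis. -/
def initial {F : Type} [Group F] (hkN : k < N) (x : FreeGroupBasis (Fin N) F) (i : Fin k) : F :=
  x ⟨i, i.2.trans hkN⟩

variable {F : Type} [Group F] (hkN : k < N) (x : FreeGroupBasis (Fin N) F)

theorem range_initial :
    Set.range (initial hkN x) = x '' {i : Fin N | (i : ℕ) < k} := by
  ext g
  constructor
  · rintro ⟨i, rfl⟩
    exact ⟨⟨i, i.2.trans hkN⟩, i.2, rfl⟩
  · rintro ⟨i, hi, rfl⟩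
    exact ⟨⟨i, hi⟩, rfl⟩

theorem isPartialBasis_initial_elim :
    IsPartialBasis (Sum.elim (initial hkN x) fun _ : Unit => x ⟨k, hkN⟩) := by
  have h := isPartialBasis_of_injective x
    (f := Sum.elim (fun i : Fin k => (⟨i, i.2.trans hkN⟩ : Fin N)) fun _ : Unit => ⟨k, hkN⟩) (by
      rintro (i | i) (j | j) h
      · simpa [Fin.ext_iff] using h
      · simp [Fin.ext_iff] at h; omega
      · simp [Fin.ext_iff] at h; omega
      · rfl)
  convert h using 1
  ext (i | i) <;> rfl

theorem isPartialBasis_initial : IsPartialBasis (initial hkN x) :=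
  (isPartialBasis_initial_elim hkN x).restrict

theorem notMem_closure_initial :
    x ⟨k, hkN⟩ ∉ Subgroup.closure (Set.range (initial hkN x)) := by
  intro h
  let χ : F →* Multiplicative ℤ :=
    x.lift fun i => if (i : ℕ) < k then 1 else Multiplicative.ofAdd 1
  have hχ : ∀ i, χ (x i) = if (i : ℕ) < k then 1 else Multiplicative.ofAdd 1 := by
    intro i
    simp [χ]
  have h1 : Subgroup.closure (Set.range (initial hkN x)) ≤ χ.ker := by
    rw [Subgroup.closure_le]
    rintro _ ⟨i, rfl⟩
    simp [MonoidHom.mem_ker, initial, hχ]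
  have h2 := h1 h
  rw [MonoidHom.mem_ker, hχ] at h2
  simp at h2

/-- A primitive element of the factor and the next element of the basis form a partial basis. -/
theorem isPartialBasis_pair {p : F} (hp : IsPrimitive p)
    (hpA : p ∈ Subgroup.closure (Set.range (initial hkN x))) :
    IsPartialBasis ![p, x ⟨k, hkN⟩] := by
  obtain ⟨κ, b, hb⟩ := isPartialBasis_initial_elim hkN x
  rw [← FreeGroup.range_lift_eq_closure] at hpA
  obtain ⟨p, rfl⟩ := hpA
  let E : (Unit ⊕ κ) ⊕ Fin k ≃ (Fin k ⊕ Unit) ⊕ κ :=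
    (Equiv.sumComm _ _).trans (Equiv.sumAssoc _ _ _).symm
  have hΘ₀ : (FreeGroup.freeGroupCongr E).trans b.repr.symm (FreeGroup.map Sum.inr p) =
      FreeGroup.lift (initial hkN x) p :=
    DFunLike.congr_fun (show ((FreeGroup.freeGroupCongr E).trans b.repr.symm).toMonoidHom.comp
      (FreeGroup.map Sum.inr) = FreeGroup.lift (initial hkN x) by
        ext i
        rw [FreeGroup.lift_apply_of]
        refine Eq.trans ?_ (hb (Sum.inl i))
        simp [E]
        rfl) p
  obtain ⟨γ, Θ, hΘ⟩ := exists_equiv_of_isPrimitive _ p (hΘ₀ ▸ hp)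
  have hw : IsPartialBasis fun i : Unit ⊕ Unit => sumCongr Θ (MulEquiv.refl (FreeGroup Unit))
      (FreeGroup.of (Sum.map Sum.inl id i : (Unit ⊕ γ) ⊕ Unit)) := by
    exact (isPartialBasis_of_injective (FreeGroupBasis.ofFreeGroup _)
      (Sum.map_injective.2 ⟨Sum.inl_injective, Function.injective_id⟩)).map _
  have h2 := ((isPartialBasis_initial_elim hkN x).trans hw).reindex
    (finSumFinEquiv.symm.trans
      (Equiv.sumCongr (Equiv.ofUnique (Fin 1) Unit) (Equiv.ofUnique (Fin 1) Unit)))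
  convert h2 using 1
  have hl : ∀ v, FreeGroup.lift (Sum.elim (initial hkN x) fun _ : Unit => x ⟨k, hkN⟩)
      (FreeGroup.map Sum.inl v) = FreeGroup.lift (initial hkN x) v := fun v =>
    DFunLike.congr_fun (show (FreeGroup.lift _).comp (FreeGroup.map Sum.inl) =
      FreeGroup.lift (initial hkN x) by ext i; simp) v
  ext i
  fin_cases i
  · have h3 : (finSumFinEquiv.symm.trans (Equiv.sumCongr (Equiv.ofUnique (Fin 1) Unit)
      (Equiv.ofUnique (Fin 1) Unit))) (0 : Fin 2) = Sum.inl () := rfl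
    simp only [Fin.zero_eta, h3, Sum.map_inl, sumCongr_of_inl, hΘ, hl]
    rfl
  · have h3 : (finSumFinEquiv.symm.trans (Equiv.sumCongr (Equiv.ofUnique (Fin 1) Unit)
      (Equiv.ofUnique (Fin 1) Unit))) (1 : Fin 2) = Sum.inr () := rfl
    simp [h3, sumCongr_of_inr]

theorem IsPrimitive.map {F' : Type} [Group F'] {p : F} (hp : IsPrimitive p) (φ : F ≃* F') :
    IsPrimitive (φ p) := by
  obtain ⟨ι, b, i, rfl⟩ := hp
  exact ⟨ι, b.map φ, i, rfl⟩

theorem notMem_of_existsAutPreserving {u : F}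
    (h : ExistsAutPreserving (Subgroup.closure (Set.range (initial hkN x))) u (x ⟨k, hkN⟩)) :
    u ∉ Subgroup.closure (Set.range (initial hkN x)) := by
  intro hu
  obtain ⟨φ, hφ, hφu⟩ := h
  apply notMem_closure_initial hkN x
  rw [← hφ, ← hφu]
  exact Subgroup.mem_map_of_mem _ hu

theorem not_existsFarPrimitive_of_existsAutPreserving {u : F}
    (h : ExistsAutPreserving (Subgroup.closure (Set.range (initial hkN x))) u (x ⟨k, hkN⟩)) :
    ¬ ExistsFarPrimitive (Subgroup.closure (Set.range (initial hkN x))) u := by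
  rintro ⟨p, hp, hpA, hfar⟩
  obtain ⟨φ, hφ, hφu⟩ := h
  have h1 := isPartialBasis_pair hkN x (hp.map φ)
    (by rw [← hφ]; exact Subgroup.mem_map_of_mem _ hpA)
  have h2 : IsPartialBasis ![p, u] := by
    convert h1.map φ.symm using 1
    ext i
    fin_cases i
    · simp
    · simp [← hφu]
  refine hfar ⟨_, h2.isFreeFactorOfRank, Subgroup.closure_mono ?_⟩
  rintro _ (rfl | rfl)
  · exact ⟨0, rfl⟩
  · exact ⟨1, rfl⟩

theorem existsAutPreserving_of_isPartialBasis {u : F}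
    (h : IsPartialBasis (Sum.elim (initial hkN x) fun _ : Unit => u)) :
    ExistsAutPreserving (Subgroup.closure (Set.range (initial hkN x))) u (x ⟨k, hkN⟩) := by
  obtain ⟨φ, hφ⟩ := exists_aut_of_isPartialBasis x h (isPartialBasis_initial_elim hkN x)
  refine ⟨φ, ?_, hφ (Sum.inr ())⟩
  rw [MonoidHom.map_closure, ← Set.range_comp]
  congr 2
  ext i
  exact hφ (Sum.inl i)

theorem existsAutPreserving_or_existsFarPrimitive (hk : 2 ≤ k) {u : F} (hu : IsPrimitive u)
    (hnot : u ∉ Subgroup.closure (Set.range (initial hkN x))) :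
    ExistsAutPreserving (Subgroup.closure (Set.range (initial hkN x))) u (x ⟨k, hkN⟩) ∨
      ExistsFarPrimitive (Subgroup.closure (Set.range (initial hkN x))) u := by
  by_cases hfar : ExistsFarPrimitive (Subgroup.closure (Set.range (initial hkN x))) u
  · exact Or.inr hfar
  refine Or.inl (existsAutPreserving_of_isPartialBasis hkN x ?_)
  have : IsFreeGroup F := x.isFreeGroup
  obtain ⟨r, rfl⟩ : ∃ r, k = r + 2 := ⟨k - 2, by omega⟩
  have h1 := isPartialBasis_extend_of_pairs x (isPartialBasis_initial hkN x) hu hnot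
    (fun p hp hpA => ?_) r FreeGroup.of
    (isPartialBasis_of_injective (FreeGroupBasis.ofFreeGroup _) Function.injective_id)
  · simpa using h1
  · by_contra hcon
    refine hfar ⟨p, hp, hpA, ?_⟩
    rintro ⟨H, hH, hle⟩
    obtain ⟨v, hv, rfl⟩ := hH.exists_isPartialBasis
    exact hcon ⟨v, hv, hle (Subgroup.subset_closure (by simp)),
      hle (Subgroup.subset_closure (by simp))⟩

end Main

end GradedAntipode

theorem mainTheorem5 (N k : ℕ) (hk : 2 ≤ k) (hkN : k < N)
    (x : FreeGroupBasis (Fin N) (FreeGroup (Fin N)))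
    (A : Subgroup (FreeGroup (Fin N)))
    (hA : A = Subgroup.closure (x '' {i : Fin N | (i : ℕ) < k}))
    (u : FreeGroup (Fin N)) (hu : GradedAntipode.IsPrimitive u) :
    -- at least one of the three conditions holds
    (u ∈ A ∨ GradedAntipode.ExistsAutPreserving A u (x ⟨k, hkN⟩) ∨
      GradedAntipode.ExistsFarPrimitive A u) ∧
    -- the second condition excludes the first and the third
    ¬ (GradedAntipode.ExistsAutPreserving A u (x ⟨k, hkN⟩) ∧ u ∈ A) ∧
    ¬ (GradedAntipode.ExistsAutPreserving A u (x ⟨k, hkN⟩) ∧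
      GradedAntipode.ExistsFarPrimitive A u) ∧
    -- in rank two, the first and the third exclude each other as well
    (k = 2 → ¬ (u ∈ A ∧ GradedAntipode.ExistsFarPrimitive A u)) := by
  rw [← GradedAntipode.range_initial hkN] at hA
  subst hA
  refine ⟨?_, fun h => GradedAntipode.notMem_of_existsAutPreserving hkN x h.1 h.2,
    fun h => GradedAntipode.not_existsFarPrimitive_of_existsAutPreserving hkN x h.1 h.2, ?_⟩
  · by_cases h : u ∈ Subgroup.closure (Set.range (GradedAntipode.initial hkN x))
    · exact Or.inl h
    · exact Or.inr (GradedAntipode.existsAutPreserving_or_existsFarPrimitive hkN x hk hu h)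
  · rintro rfl ⟨h, p, -, hp, hfar⟩
    refine hfar ⟨_, (GradedAntipode.isPartialBasis_initial hkN x).isFreeFactorOfRank, ?_⟩
    rw [Subgroup.closure_le]
    rintro _ (rfl | rfl)
    · exact hp
    · exact h
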